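/- Let $D\ge 1$ and $n\ge 2$ be integers, $\mathbf A=\mathbb C[v,v^{-1}]$, $\mathbf K=\mathbb C(v)$, and $[m]=(v^m-v^{-m})/(v-v^{-1})$ for $m\in\mathbb Z$. **Hecke algebra.** Let $S_D$ be the group of bijections $w:\mathbb Z\to\mathbb Z$ with $w(j+D)=w(j)+D$ for all $j$ (product: composition), with length function $\ell(w)=\sharp\{(k,l)\mid 1\le k\le D,\ k<l,\ w(k)>w(l)\}$. Let $\mathbf H_D$ be the affine Hecke algebra of type $GL_D$: the unital associative $\mathbf A$-algebra with generators $T_w$ ($w\in S_D$) and relations $T_1=1$, $T_wT_{w'}=T_{ww'}$ if $\ell(ww')=\ell(w)+\ell(w')$, and $(T_s+1)(T_s-v^{-2})=0$ for every simple reflection $s$ (exchanging $j+mD$ and $j+1+mD$ for all $m$, for some $j$). **The module $\mathbf T_D$ and the algebra $\mathbf S_D$.** Let $\mathfrak P_D$ be the set of functions $\mathfrak p:\mathbb Z\to\mathbb Z$ with $\mathfrak p(j+D)=\mathfrak p(j)+n$ for all $j$. The group $S_D$ acts on it on the right by $(\mathfrak p)w=\mathfrak p\circ w$, and the set $\mathfrak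 C_D$ of those $\lambda$ with $1\le\lambda(1)\le\dots\le\lambda(D)\le n$ is a fundamental domain. For $\mathfrak p$ in the orbit of $\lambda\in\mathfrak C_D$ put $T_{\mathfrak p}=\sum_{(\lambda)w=\mathfrak p}T_w\in T_\lambda\mathbf H_D$. Let $\mathbf T_D=\bigoplus_{\lambda\in\mathfrak C_D}T_\lambda\mathbf H_D$, a right $\mathbf H_D$-module, and $\mathbf S_D=\mathrm{End}_{\mathbf H_D}(\mathbf T_D)$ (the affine $q$-Schur algebra). Put $[\mathfrak p]=v^{x_{\mathfrak p}}T_{\mathfrak p}\in\mathbf T_D$, where $$x_{\mathfrak p}=\sharp\{(k,l)\mid \mathfrak p(k)\in[1,n],\ k<l,\ \mathfrak p(k)\ge\mathfrak p(l)\}.$$ Let ${}^\sharp\mathfrak p_i=\sharp\,\mathfrak p^{-1}(i)$; this depends only on $i$ modulo $n$, and ${}^\sharp\mathfrak p=({}^\sharp\mathfrak p_1,\dots,{}^\sharp\mathfrak p_n)$. For a matrix $\mathfrak s=(\mathfrak s_{ij})_{i,j\in\mathbb Z}$ with entries in $\mathbb N$, with $\mathfrak s_{i+n,j+n}=\mathfrak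 s_{ij}$, $\sum_j\mathfrak s_{ij}={}^\sharp\lambda_i$ and $\sum_i\mathfrak s_{ij}={}^\sharp\mu_j$ ($\lambda,\mu\in\mathfrak C_D$), let $T_{\mathfrak s}\in\mathbf S_D$ be the endomorphism with $T_\mu\mapsto\sum_wT_w\in T_\lambda\mathbf H_D$, where $w$ runs over the elements of $S_D$ with $\sharp\{k\in\mathbb Z\mid\lambda(w(k))=i,\ \mu(k)=j\}=\mathfrak s_{ij}$ for all $i,j$, and $T_\nu\mapsto0$ for $\nu\in\mathfrak C_D\setminus\{\mu\}$. Put $[\mathfrak s]=v^{y_{\mathfrak s}}T_{\mathfrak s}$ with $y_{\mathfrak s}=\sum\mathfrak s_{ij}\mathfrak s_{kl}$, the sum being over $i\ge k$, $j<l$, $i\in[1,n]$. For a matrix with a negative entry put $[\mathfrak s]=0$. **The modified algebra.** Indices $i$ of $\mathbf e_i,\mathbf f_i$ and of the entries of $n$-tuples are read modulo $n$. Let $\dot{\mathbf U}$ be the $\mathbf K$-algebra without unit generated by the elements $\mathbf a_\mu$, $\mathbf e_i\mathbf a_\mu$, $\mathbf f_i\mathbf a_\mu$, where $\mathbf e_i,\mathbf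 f_i$ ($i\in\mathbb Z/n$) and $\mathbf a_\mu$ ($\mu\in\mathbb Z^n$) satisfy: $\mathbf a_\mu=0$ if $\mu\notin\mathbb N^n$, and $$\mathbf a_\nu\mathbf a_\mu=\delta_{\nu\mu}\mathbf a_\mu,\quad \mathbf a_{\mu+\omega_i}\mathbf e_i=\mathbf e_i\mathbf a_{\mu+\omega_{i+1}},\quad \mathbf a_{\mu+\omega_{i+1}}\mathbf f_i=\mathbf f_i\mathbf a_{\mu+\omega_i},\quad [\mathbf e_i,\mathbf f_j]\mathbf a_\mu=\delta_{ij}[\mu_i-\mu_{i+1}]\mathbf a_\mu,$$ $$\sum_{k=0}^{1-a_{ij}}(-1)^k\mathbf e_i^{(k)}\mathbf e_j\mathbf e_i^{(1-a_{ij}-k)}=\sum_{k=0}^{1-a_{ij}}(-1)^k\mathbf f_i^{(k)}\mathbf f_j\mathbf f_i^{(1-a_{ij}-k)}=0\quad(i\ne j).$$ Here $\omega_i$ is the $i$-th unit tuple, $(a_{ij})$ is the Cartan matrix of type $A^{(1)}_{n-1}$, and $x^{(k)}=x^k/([k][k-1]\cdots[1])$. **Proposition.** There is a unique homomorphism of $\mathbf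 K$-algebras $\Phi_D:\dot{\mathbf U}\to\mathbf S_D\otimes_{\mathbf A}\mathbf K$ such that, for all $\lambda\in\mathfrak C_D$ and all $i$, $\Phi_D(\mathbf a_{{}^\sharp\lambda}\mathbf e_i)=[\mathfrak s]$, $\Phi_D(\mathbf f_i\mathbf a_{{}^\sharp\lambda})=[\mathfrak t]$, $\Phi_D(\mathbf a_{{}^\sharp\lambda})=[{}^\delta\lambda]$, and $\Phi_D(\mathbf a_\mu)=0$ for $\mu\in\mathbb N^n$ with $\sum_i\mu_i\ne D$. Here ${}^\delta\lambda_{kl}=\delta_{kl}{}^\sharp\lambda_k$; the matrix $\mathfrak s$ is obtained from ${}^\delta\lambda$ by subtracting $1$ in position $(k,k)$ and adding $1$ in position $(k,k+1)$ for every $k\equiv i$ modulo $n$; and $\mathfrak t$ is the transpose of $\mathfrak s$. Let $\dot{\mathbf U}$ act on $\mathbf T_D\otimes_{\mathbf A}\mathbf K$ through $\Phi_D$. Then for every $\mathfrak p\in\mathfrak P_D$ one has $\mathbf a_{{}^\sharp\mathfrak p}([\mathfrak p])=[\mathfrak p]$ and $\mathbf a_\mu([\mathfrak p])=0$ for $\mu\ne{}^\sharp\mathfrak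 p$. Accordingly write $\mathbf e_i([\mathfrak p])=(\mathbf e_i\mathbf a_{{}^\sharp\mathfrak p})([\mathfrak p])$ and $\mathbf f_i([\mathfrak p])=(\mathbf f_i\mathbf a_{{}^\sharp\mathfrak p})([\mathfrak p])$. For every $\mathfrak p\in\mathfrak P_D$ and every integer $i$, $$\mathbf e_i([\mathfrak p])=\sum_{k\in\mathfrak p^{-1}(i+1)}v^{\sharp\{l\in\mathfrak p^{-1}(i+1)\mid l>k\}-\sharp\{l\in\mathfrak p^{-1}(i)\mid l>k\}}\,[\mathfrak p_k^-],$$ $$\mathbf f_i([\mathfrak p])=\sum_{k\in\mathfrak p^{-1}(i)}v^{\sharp\{l\in\mathfrak p^{-1}(i)\mid l<k\}-\sharp\{l\in\mathfrak p^{-1}(i+1)\mid l<k\}}\,[\mathfrak p_k^+],$$ where $\mathfrak p_k^\pm\in\mathfrak P_D$ is the function with $\mathfrak p_k^\pm(k)=\mathfrak p(k)\pm1$ and $\mathfrak p_k^\pm(j)=\mathfrak p(j)$ for $j\not\equiv k$ modulo $D$. -/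

import Mathlib

open scoped TensorProduct LaurentPolynomial

namespace AffineSchur

noncomputable section

/-! Scalars: `A = ℂ[v, v⁻¹]` and `K = ℂ(v)`, its field of fractions. -/

/-- `A = ℂ[v, v⁻¹]`; the power `v ^ m` is `LaurentPolynomial.T m`. -/
abbrev BaseA : Type := ℂ[T;T⁻¹]

/-- `K = ℂ(v)`. -/
abbrev BaseK : Type := FractionRing BaseA

/-- The variable `v`, as an element of `K`. -/
def v : BaseK := algebraMap BaseA BaseK (LaurentPolynomial.T 1)

/-- The quantum integer `[m] = (v ^ m - v ^ (-m)) / (v - v⁻¹)`. -/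
def qInt (m : ℤ) : BaseK := (v ^ m - v ^ (-m)) / (v - v⁻¹)

/-- `[k]! = [k] [k - 1] ⋯ [1]`. -/
def qFact (k : ℕ) : BaseK := ∏ m ∈ Finset.range k, qInt ((m : ℤ) + 1)

/-! The affine symmetric group of type `GL_D`. -/

/-- The (extended) affine symmetric group `S_D`: the bijections `w` of `ℤ` with
`w (j + D) = w j + D`, under composition. It is the semidirect product of the finite symmetric
group (the permutations of `1, …, D`, extended periodically) and of `ℤ ^ D`
(the translations `j ↦ j + D * μ_j`). -/
def affSym (D : ℕ) : Subgroup (Equiv.Perm ℤ) where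
  carrier := {w | ∀ j, w (j + D) = w j + D}
  mul_mem' := by
    intro a b ha hb j
    simp only [Set.mem_ofPred_eq] at ha hb
    simp [Equiv.Perm.mul_apply, hb, ha]
  one_mem' := by intro j; simp
  inv_mem' := by
    intro a ha j
    simp only [Set.mem_ofPred_eq] at ha
    rw [Equiv.Perm.inv_eq_iff_eq, ha]
    simp

/-- The inversions `(k, l)` of `w`, up to simultaneous translation by multiples of `D`. -/
def invSet {D : ℕ} (w : affSym D) : Set (ℤ × ℤ) :=
  {x | (1 ≤ x.1 ∧ x.1 ≤ D) ∧ x.1 < x.2 ∧ w.1 x.2 < w.1 x.1}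

/-- The length function of `S_D`. -/
def length {D : ℕ} (w : affSym D) : ℕ := (invSet w).ncard

/-- `w` is a simple reflection: it exchanges `j + m * D` and `j + 1 + m * D` for all `m`,
and fixes all other integers. -/
def IsSimpleReflection {D : ℕ} (w : affSym D) : Prop :=
  ∃ j : ℤ, w.1 j = j + 1 ∧ w.1 (j + 1) = j ∧
    ∀ l : ℤ, ¬ (D : ℤ) ∣ l - j → ¬ (D : ℤ) ∣ l - (j + 1) → w.1 l = l

/-! The affine Hecke algebra. -/

/-- The defining relations of the affine Hecke algebra in the generators `T_w`, `w ∈ S_D`. -/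
inductive HeckeRel (D : ℕ) :
    FreeAlgebra BaseA (affSym D) → FreeAlgebra BaseA (affSym D) → Prop
  | one : HeckeRel D (FreeAlgebra.ι BaseA 1) 1
  | mul (w w' : affSym D) (h : length (w * w') = length w + length w') :
      HeckeRel D (FreeAlgebra.ι BaseA w * FreeAlgebra.ι BaseA w') (FreeAlgebra.ι BaseA (w * w'))
  | quad (s : affSym D) (h : IsSimpleReflection s) :
      HeckeRel D ((FreeAlgebra.ι BaseA s + 1) *
        (FreeAlgebra.ι BaseA s - algebraMap BaseA _ (LaurentPolynomial.T (-2)))) 0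

/-- The affine Hecke algebra `H_D` of type `GL_D` over `A`, in the Iwahori–Matsumoto
presentation: generators `T_w` (`w ∈ S_D`), with `T_w T_w' = T_{w w'}` whenever lengths add up,
and `(T_s + 1) (T_s - v⁻²) = 0` for the simple reflections. -/
def Hecke (D : ℕ) : Type := RingQuot (HeckeRel D)

instance (D : ℕ) : Ring (Hecke D) := inferInstanceAs (Ring (RingQuot (HeckeRel D)))

instance (D : ℕ) : Algebra BaseA (Hecke D) :=
  inferInstanceAs (Algebra BaseA (RingQuot (HeckeRel D)))

/-- The element `T_w` of `H_D`. -/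
def heckeT {D : ℕ} (w : affSym D) : Hecke D :=
  RingQuot.mkAlgHom BaseA (HeckeRel D) (FreeAlgebra.ι BaseA w)

theorem heckeT_mul {D : ℕ} (w w' : affSym D) (h : length (w * w') = length w + length w') :
    heckeT w * heckeT w' = heckeT (w * w') := by
  unfold heckeT
  rw [← RingQuot.mkAlgHom_rel BaseA (HeckeRel.mul w w' h)]
  exact (map_mul _ _ _).symm

/-! Periodic functions, the parameter set of the basis. -/

/-- The set `𝔓_D` of the functions `p : ℤ → ℤ` with `p (j + D) = p j + n`. -/
def PerFun (D n : ℕ) : Type := {p : ℤ → ℤ // ∀ j, p (j + D) = p j + n}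

/-- The set `ℭ_D` of the `p ∈ 𝔓_D` with `1 ≤ p 1 ≤ p 2 ≤ ⋯ ≤ p D ≤ n`. -/
def Dom (D n : ℕ) : Type :=
  {p : PerFun D n // 1 ≤ p.1 1 ∧ MonotoneOn p.1 (Set.Icc 1 (D : ℤ)) ∧ p.1 D ≤ n}

theorem per_add_mul {f : ℤ → ℤ} {a b : ℤ} (hf : ∀ j, f (j + a) = f j + b) (j q : ℤ) :
    f (j + a * q) = f j + b * q := by
  induction q using Int.induction_on with
  | zero => simp
  | succ i ih =>
    have := hf (j + a * i)
    rw [show j + a * ((i : ℤ) + 1) = j + a * i + a by ring, this, ih]; ring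
  | pred i ih =>
    have := hf (j + a * (-(i : ℤ) - 1))
    rw [show j + a * (-(i : ℤ) - 1) + a = j + a * (-(i : ℤ)) by ring, ih] at this
    linarith

theorem fiber_finite {D n : ℕ} [NeZero D] [NeZero n] (p : PerFun D n) (i : ℤ) :
    {k | p.1 k = i}.Finite := by
  have hD : (0 : ℤ) < D := by exact_mod_cast Nat.pos_of_ne_zero (NeZero.ne D)
  have hn : (0 : ℤ) < n := by exact_mod_cast Nat.pos_of_ne_zero (NeZero.ne n)
  refine ((Finset.Icc (0 : ℤ) D).image (fun r => r + D * ((i - p.1 r) / n))).finite_toSet.subset ?_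
  intro k hk
  simp only [Set.mem_ofPred_eq] at hk
  simp only [Finset.coe_image, Set.mem_image, Finset.coe_Icc, Set.mem_Icc]
  refine ⟨k % D, ⟨Int.emod_nonneg _ hD.ne', (Int.emod_lt_of_pos _ hD).le⟩, ?_⟩
  have h1 := per_add_mul p.2 (k % D) (k / D)
  rw [Int.emod_add_mul_ediv, hk] at h1
  rw [h1, add_sub_cancel_left, Int.mul_ediv_cancel_left _ hn.ne']
  exact Int.emod_add_mul_ediv k D

/-- The finite set `p⁻¹(i)`. -/
def fiber {D n : ℕ} [NeZero D] [NeZero n] (p : PerFun D n) (i : ℤ) : Finset ℤ :=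
  (fiber_finite p i).toFinset

/-- The tuple `♯p`, `♯p_i = ♯ p⁻¹(i)`. The number `♯ p⁻¹(i)` depends on `i` only modulo `n`;
tuples `(μ_1, …, μ_n)` are indexed by `ℤ / n`, the index `0` standing for `n`. -/
def sharp {D n : ℕ} [NeZero D] [NeZero n] (p : PerFun D n) : ZMod n → ℤ :=
  fun i => (fiber p (i.val : ℤ)).card

/-- The function `l ↦ p l + c` for `l ≡ k` modulo `D`, `l ↦ p l` otherwise. The functions
`p_k^±` are the cases `c = ± 1`. -/
def shift {D n : ℕ} (p : PerFun D n) (k c : ℤ) : PerFun D n :=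
  ⟨fun l => p.1 l + if (D : ℤ) ∣ l - k then c else 0, by
    intro j
    have h : ((D : ℤ) ∣ j + D - k) ↔ (D : ℤ) ∣ j - k := by
      rw [show j + (D : ℤ) - k = j - k + D by ring, dvd_add_self_right]
    simp only [h, p.2 j]
    ring⟩

/-- `x_p = ♯ {(k, l) | p k ∈ [1, n], k < l, p k ≥ p l}`. -/
def xdim {D n : ℕ} (p : PerFun D n) : ℕ :=
  {x : ℤ × ℤ | (1 ≤ p.1 x.1 ∧ p.1 x.1 ≤ n) ∧ x.1 < x.2 ∧ p.1 x.2 ≤ p.1 x.1}.ncard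

/-! Cosets. The group `S_D` acts on `𝔓_D` on the right by `(p) w = p ∘ w`. -/

theorem affSym_finite {D : ℕ} [NeZero D] (S : Set (affSym D))
    (h : ∀ j : ℤ, {m | ∃ w ∈ S, w.1 j = m}.Finite) : S.Finite := by
  have hD : (0 : ℤ) < D := by exact_mod_cast Nat.pos_of_ne_zero (NeZero.ne D)
  have hfin : (Set.pi Set.univ
      (fun j : Fin D => {m : ℤ | ∃ w ∈ S, w.1 (j : ℤ) = m})).Finite :=
    Set.Finite.pi (fun j => h _)
  refine Set.Finite.of_injOn (f := fun w : affSym D => fun j : Fin D => w.1 (j : ℤ)) ?_ ?_ hfin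
  · intro w hw j _
    exact ⟨w, hw, rfl⟩
  · intro w _ w' _ hww
    apply Subtype.ext
    apply Equiv.ext
    intro k
    have h0 := Int.emod_nonneg k hD.ne'
    have h1 := Int.emod_lt_of_pos k hD
    have h2 := congrFun hww ⟨(k % D).toNat, by omega⟩
    simp only [Int.toNat_of_nonneg h0] at h2
    have e1 := per_add_mul w.2 (k % D) (k / D)
    have e2 := per_add_mul w'.2 (k % D) (k / D)
    rw [Int.emod_add_mul_ediv] at e1 e2
    rw [e1, e2, h2]

/-- The set of the `w ∈ S_D` with `(l) w = p`. For `l ∈ ℭ_D` and `p` in the orbit of `l` it is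
the class in `S_l \ S_D` with which `p` is identified; otherwise it is empty. -/
def coset {D n : ℕ} (l p : PerFun D n) : Set (affSym D) := {w | ∀ k, l.1 (w.1 k) = p.1 k}

theorem coset_finite {D n : ℕ} [NeZero D] [NeZero n] (l p : PerFun D n) :
    (coset l p).Finite := by
  refine affSym_finite _ fun j => (fiber_finite l (p.1 j)).subset ?_
  rintro m ⟨w, hw, rfl⟩
  exact hw j

/-- The double coset attached to a matrix `s` and `l, m ∈ ℭ_D`: the set of the `w ∈ S_D` such
that the pair of flags `(L_{(l)w}, L_m)` has relative position `s`. As `L_{p,i}` has the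
topological basis `(e_k)`, `p k ≤ i`, the dimension of
`L_{p,i} ∩ L_{m,j} / (L_{p,i-1} ∩ L_{m,j} + L_{p,i} ∩ L_{m,j-1})` is the number of the `k` with
`p k = i` and `m k = j`. The set is empty unless the row sums of `s` are `♯l` and its column sums
are `♯m`. -/
def doubleCoset {D n : ℕ} (l : PerFun D n) (s : ℤ → ℤ → ℤ) (m : PerFun D n) : Set (affSym D) :=
  {w | ∀ i j : ℤ, ({k : ℤ | l.1 (w.1 k) = i ∧ m.1 k = j}.ncard : ℤ) = s i j}

theorem doubleCoset_finite {D n : ℕ} [NeZero D] [NeZero n] (l : PerFun D n) (s : ℤ → ℤ → ℤ)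
    (m : PerFun D n) : (doubleCoset l s m).Finite := by
  rcases (doubleCoset l s m).eq_empty_or_nonempty with h | ⟨w₁, h₁⟩
  · rw [h]; exact Set.finite_empty
  refine affSym_finite _ fun j => ?_
  have hfin : (⋃ k ∈ {k | m.1 k = m.1 j}, {x | l.1 x = l.1 (w₁.1 k)}).Finite :=
    (fiber_finite m (m.1 j)).biUnion fun k _ => fiber_finite l _
  refine hfin.subset ?_
  rintro x ⟨w, hw, rfl⟩
  have hf : ∀ u : affSym D, {k : ℤ | l.1 (u.1 k) = l.1 (w.1 j) ∧ m.1 k = m.1 j}.Finite :=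
    fun u => (fiber_finite m (m.1 j)).subset fun k hk => hk.2
  have e : {k : ℤ | l.1 (w₁.1 k) = l.1 (w.1 j) ∧ m.1 k = m.1 j}.ncard =
      {k : ℤ | l.1 (w.1 k) = l.1 (w.1 j) ∧ m.1 k = m.1 j}.ncard := by
    exact_mod_cast (h₁ (l.1 (w.1 j)) (m.1 j)).trans (hw (l.1 (w.1 j)) (m.1 j)).symm
  have hpos : 0 < {k : ℤ | l.1 (w.1 k) = l.1 (w.1 j) ∧ m.1 k = m.1 j}.ncard :=
    (Set.ncard_pos (hf w)).2 ⟨j, rfl, rfl⟩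
  rw [← e] at hpos
  obtain ⟨k, hk1, hk2⟩ := (Set.ncard_pos (hf w₁)).1 hpos
  simp only [Set.mem_iUnion, Set.mem_ofPred_eq]
  exact ⟨k, hk2, hk1.symm⟩

/-- `∑ T_w` over the coset of the `w` with `(l) w = p`. -/
def cosetSum {D n : ℕ} [NeZero D] [NeZero n] (l p : PerFun D n) : Hecke D :=
  ∑ w ∈ (coset_finite l p).toFinset, heckeT w

/-- `T_s = ∑ T_w` over the double coset of `s`. -/
def doubleCosetSum {D n : ℕ} [NeZero D] [NeZero n] (l : PerFun D n) (s : ℤ → ℤ → ℤ)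
    (m : PerFun D n) : Hecke D :=
  ∑ w ∈ (doubleCoset_finite l s m).toFinset, heckeT w

/-! The elements `T_p` lie in the right ideals `T_l H_D`. -/

theorem dom_monotone {D n : ℕ} [NeZero D] (l : Dom D n) : Monotone l.1.1 := by
  have hD : (0 : ℤ) < D := by exact_mod_cast Nat.pos_of_ne_zero (NeZero.ne D)
  obtain ⟨h1, h2, h3⟩ := l.2
  refine monotone_int_of_le_succ fun j => ?_
  have a0 := Int.emod_nonneg (j - 1) hD.ne'
  have a1 := Int.emod_lt_of_pos (j - 1) hD
  have a2 := Int.emod_add_mul_ediv (j - 1) D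
  set r := (j - 1) % (D : ℤ) with hr
  set q := (j - 1) / (D : ℤ) with hq
  have e1 := per_add_mul l.1.2 (r + 1) q
  have e2 := per_add_mul l.1.2 (r + 2) q
  rw [show r + 1 + D * q = j by linarith] at e1
  rw [show r + 2 + D * q = j + 1 by linarith] at e2
  rw [e1, e2]
  have key : l.1.1 (r + 1) ≤ l.1.1 (r + 2) := by
    rcases lt_or_ge (r + 1) D with h | h
    · exact h2 ⟨by linarith, by linarith⟩ ⟨by linarith, by linarith⟩ (by linarith)
    · have h4 : r + 1 = D := by linarith
      have h5 := l.1.2 1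
      rw [show r + 2 = 1 + (D : ℤ) by linarith, h5, h4]
      linarith
  linarith

theorem invSet_finite {D : ℕ} [NeZero D] (w : affSym D) : (invSet w).Finite := by
  have hD : (0 : ℤ) < D := by exact_mod_cast Nat.pos_of_ne_zero (NeZero.ne D)
  obtain ⟨M, hM⟩ : ∃ M : ℤ, ∀ j, |w.1 j - j| ≤ M := by
    refine ⟨∑ r ∈ Finset.Ico (0 : ℤ) D, |w.1 r - r|, fun j => ?_⟩
    have e := per_add_mul w.2 (j % D) (j / D)
    rw [Int.emod_add_mul_ediv] at e
    have e' := Int.emod_add_mul_ediv j D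
    have : w.1 j - j = w.1 (j % D) - j % D := by linarith
    rw [this]
    exact Finset.single_le_sum (f := fun r => |w.1 r - r|) (fun _ _ => abs_nonneg _)
      (Finset.mem_Ico.2 ⟨Int.emod_nonneg _ hD.ne', Int.emod_lt_of_pos _ hD⟩)
  refine ((Set.finite_Icc (1 : ℤ) D).prod (Set.finite_Icc (1 : ℤ) (D + 2 * M))).subset ?_
  rintro ⟨a, b⟩ ⟨⟨h1, h2⟩, h3, h4⟩
  have ha := abs_le.1 (hM a)
  have hb := abs_le.1 (hM b)
  simp only at h1 h2 h3 h4
  exact ⟨⟨h1, h2⟩, ⟨by linarith, by linarith⟩⟩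

/-- The simple reflection exchanging `m` and `m + 1`. -/
theorem exists_simple {D : ℕ} (hD : 2 ≤ D) (m : ℤ) : ∃ s : affSym D, ∀ j : ℤ,
    s.1 j = if (D : ℤ) ∣ j - m then j + 1 else if (D : ℤ) ∣ j - (m + 1) then j - 1 else j := by
  have h2 : ∀ a : ℤ, (D : ℤ) ∣ a → (D : ℤ) ∣ a + 1 → False := by
    intro a h h'
    have : (D : ℤ) ∣ 1 := by simpa using dvd_sub h' h
    have := Int.le_of_dvd one_pos this
    omega
  let f : ℤ → ℤ := fun j =>
    if (D : ℤ) ∣ j - m then j + 1 else if (D : ℤ) ∣ j - (m + 1) then j - 1 else j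
  have hf : Function.Involutive f := by
    intro j
    by_cases a : (D : ℤ) ∣ j - m
    · have b : ¬ (D : ℤ) ∣ j + 1 - m := fun h => h2 _ a (by convert h using 1; ring)
      have c : (D : ℤ) ∣ j + 1 - (m + 1) := by convert a using 1; ring
      simp only [f, if_pos a, if_neg b, if_pos c]; ring
    · by_cases b : (D : ℤ) ∣ j - (m + 1)
      · have c : (D : ℤ) ∣ j - 1 - m := by convert b using 1; ring
        simp only [f, if_neg a, if_pos b, if_pos c]; ring
      · simp only [f, if_neg a, if_neg b]
  refine ⟨⟨hf.toPerm f, ?_⟩, fun j => rfl⟩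
  intro j
  change f (j + D) = f j + D
  have e1 : ((D : ℤ) ∣ j + D - m) ↔ (D : ℤ) ∣ j - m := by
    rw [show j + (D : ℤ) - m = j - m + D by ring, dvd_add_self_right]
  have e2 : ((D : ℤ) ∣ j + D - (m + 1)) ↔ (D : ℤ) ∣ j - (m + 1) := by
    rw [show j + (D : ℤ) - (m + 1) = j - (m + 1) + D by ring, dvd_add_self_right]
  simp only [f, e1, e2]
  split_ifs <;> ring

theorem exists_sorted {D n : ℕ} [NeZero D] [NeZero n] (l : Dom D n) (p : PerFun D n)
    (h : (coset l.1 p).Nonempty) :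
    ∃ w ∈ coset l.1 p, ∀ a b : ℤ, a < b → p.1 a = p.1 b → w.1 a < w.1 b := by
  have hn : (0 : ℤ) < n := by exact_mod_cast Nat.pos_of_ne_zero (NeZero.ne n)
  have hD1 : 0 < D := Nat.pos_of_ne_zero (NeZero.ne D)
  obtain ⟨w, hw, hmin⟩ := (coset_finite l.1 p).exists_minimalFor length _ h
  refine ⟨w, hw, ?_⟩
  by_contra hcon
  push Not at hcon
  obtain ⟨a, b, hab, hp, hle⟩ := hcon
  have hmono := dom_monotone l
  -- there is an adjacent pair of values in the wrong order
  have hadj : ∃ m : ℤ, l.1.1 m = l.1.1 (m + 1) ∧ w.1.symm (m + 1) < w.1.symm m := by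
    by_contra hno
    push Not at hno
    have hinc : ∀ t : ℕ, w.1 b + t ≤ w.1 a → w.1.symm (w.1 b) ≤ w.1.symm (w.1 b + t) := by
      intro t
      induction t with
      | zero => intro _; simp
      | succ t ih =>
        intro ht
        push_cast at ht
        refine (ih (by linarith)).trans ?_
        have := hno (w.1 b + t) ?_
        · push_cast; rw [← add_assoc]; exact this
        · have i1 := hmono (show w.1 b ≤ w.1 b + t by linarith [Int.natCast_nonneg t])
          have i2 := hmono (show w.1 b + t ≤ w.1 b + t + 1 by linarith)
          have i3 := hmono (show w.1 b + t + 1 ≤ w.1 a by linarith)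
          have i4 := hw a
          have i5 := hw b
          linarith
    have := hinc (w.1 a - w.1 b).toNat (by rw [Int.toNat_of_nonneg (by linarith)]; linarith)
    rw [Int.toNat_of_nonneg (by linarith)] at this
    simp at this
    linarith
  obtain ⟨m, hm1, hm2⟩ := hadj
  have hD2 : 2 ≤ D := by
    by_contra hlt
    have : D = 1 := by omega
    have h1 := l.1.2 m
    have h3 : (D : ℤ) = 1 := by exact_mod_cast this
    have h4 : l.1.1 (m + D) = l.1.1 (m + 1) := congrArg l.1.1 (by rw [h3])
    linarith
  obtain ⟨s, hs⟩ := exists_simple hD2 m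
  have hD0 : (1 : ℤ) < D := by exact_mod_cast hD2
  have hper : ∀ j q : ℤ, w.1.symm (j + D * q) = w.1.symm j + D * q := by
    intro j q
    rw [Equiv.symm_apply_eq]
    have := per_add_mul w.2 (w.1.symm j) q
    rw [this]; simp
  have hls : ∀ j, l.1.1 (s.1 j) = l.1.1 j := by
    intro j
    rw [hs]
    split_ifs with c1 c2
    · obtain ⟨q, hq⟩ := c1
      have e1 := per_add_mul l.1.2 m q
      have e2 := per_add_mul l.1.2 (m + 1) q
      rw [show j + 1 = m + 1 + D * q by linarith, show j = m + D * q by linarith, e1, e2, hm1]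
    · obtain ⟨q, hq⟩ := c2
      have e1 := per_add_mul l.1.2 m q
      have e2 := per_add_mul l.1.2 (m + 1) q
      rw [show j - 1 = m + D * q by linarith, show j = m + 1 + D * q by linarith, e1, e2, hm1]
    · rfl
  have hsw : s * w ∈ coset l.1 p := by
    intro k
    change l.1.1 (s.1 (w.1 k)) = _
    rw [hls]; exact hw k
  -- order is preserved by `s` except on translates of `(m, m + 1)`
  have hord : ∀ x y : ℤ, x < y → s.1 y < s.1 x → ∃ q : ℤ, x = m + D * q ∧ y = m + 1 + D * q := by
    intro x y hxy hlt
    rw [hs, hs] at hlt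
    by_cases c1 : (D : ℤ) ∣ x - m
    · rw [if_pos c1] at hlt
      obtain ⟨q, hq⟩ := c1
      refine ⟨q, by linarith, ?_⟩
      split_ifs at hlt <;> linarith
    · rw [if_neg c1] at hlt
      by_cases c2 : (D : ℤ) ∣ x - (m + 1)
      · rw [if_pos c2] at hlt
        split_ifs at hlt <;> linarith
      · rw [if_neg c2] at hlt
        split_ifs at hlt with c3 c4
        · linarith
        · exfalso
          have : x = y - 1 + 0 ∨ y - 1 < x := by omega
          rcases this with h' | h'
          · apply c1
            convert c4 using 1
            linarith
          · linarith
        · linarith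
  have hsub : invSet (s * w) ⊂ invSet w := by
    rw [Set.ssubset_iff_of_subset]
    · -- the inversion at `(m, m + 1)` disappears
      set k := w.1.symm (m + 1) with hk
      have z0 := Int.emod_nonneg (k - 1) (by linarith : (D : ℤ) ≠ 0)
      have z1 := Int.emod_lt_of_pos (k - 1) (by linarith : (0 : ℤ) < D)
      have z2 := Int.emod_add_mul_ediv (k - 1) D
      set q := (k - 1) / (D : ℤ) with hq
      have ek : w.1 (k + D * (-q)) = m + 1 + D * (-q) := by
        rw [per_add_mul w.2, hk]; simp
      have em : w.1 (w.1.symm m + D * (-q)) = m + D * (-q) := by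
        rw [per_add_mul w.2]; simp
      have d1 : ¬ (D : ℤ) ∣ m + 1 + D * (-q) - m := by
        rw [show m + 1 + D * (-q) - m = 1 + D * (-q) by ring,
          dvd_add_left (Dvd.intro _ rfl)]
        intro h'
        have := Int.le_of_dvd one_pos h'
        linarith
      have d2 : (D : ℤ) ∣ m + 1 + D * (-q) - (m + 1) := ⟨-q, by ring⟩
      have d3 : (D : ℤ) ∣ m + D * (-q) - m := ⟨-q, by ring⟩
      refine ⟨(k + D * (-q), w.1.symm m + D * (-q)), ⟨⟨?_, ?_⟩, ?_, ?_⟩, ?_⟩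
      · change 1 ≤ k + D * (-q)
        linarith
      · change k + D * (-q) ≤ D
        linarith
      · change k + D * (-q) < w.1.symm m + D * (-q)
        linarith
      · change w.1 (w.1.symm m + D * (-q)) < w.1 (k + D * (-q))
        rw [ek, em]; linarith
      · rintro ⟨-, -, h4⟩
        change s.1 (w.1 (w.1.symm m + D * (-q))) < s.1 (w.1 (k + D * (-q))) at h4
        rw [ek, em, hs, hs, if_pos d3, if_neg d1, if_pos d2] at h4
        linarith
    · rintro ⟨x, y⟩ ⟨h1, h3, h4⟩
      refine ⟨h1, h3, ?_⟩
      change w.1 y < w.1 x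
      change s.1 (w.1 y) < s.1 (w.1 x) at h4
      change x < y at h3
      by_contra hge
      have hne : w.1 x ≠ w.1 y := fun e => by
        have := w.1.injective e
        linarith
      obtain ⟨q, hq1, hq2⟩ := hord _ _ (lt_of_le_of_ne (not_lt.1 hge) hne) h4
      have e1 : x = w.1.symm m + D * q := by rw [← hper, ← hq1]; simp
      have e2 : y = w.1.symm (m + 1) + D * q := by rw [← hper, ← hq2]; simp
      linarith
  have hlt : length (s * w) < length w := Set.ncard_lt_ncard hsub (invSet_finite w)
  exact absurd (hmin hsw hlt.le) (not_le.2 hlt)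

theorem ncard_periodic {D : ℕ} [NeZero D] (R : ℤ → ℤ → Prop)
    (hR : ∀ a b q : ℤ, R (a + D * q) (b + D * q) ↔ R a b) (w : affSym D) :
    {x : ℤ × ℤ | (1 ≤ x.1 ∧ x.1 ≤ D) ∧ R (w.1 x.1) (w.1 x.2)}.ncard =
      {x : ℤ × ℤ | (1 ≤ x.1 ∧ x.1 ≤ D) ∧ R x.1 x.2}.ncard := by
  have hD : (0 : ℤ) < D := by exact_mod_cast Nat.pos_of_ne_zero (NeZero.ne D)
  have red : ∀ k : ℤ, 1 ≤ k + D * (-((k - 1) / D)) ∧ k + D * (-((k - 1) / D)) ≤ D := by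
    intro k
    have z0 := Int.emod_nonneg (k - 1) hD.ne'
    have z1 := Int.emod_lt_of_pos (k - 1) hD
    have z2 := Int.emod_add_mul_ediv (k - 1) D
    constructor <;> linarith
  have uniq : ∀ k q r : ℤ, (1 ≤ k + D * q ∧ k + D * q ≤ D) →
      (1 ≤ k + D * r ∧ k + D * r ≤ D) → q = r := by
    intro k q r h1 h2
    have i1 : (D : ℤ) * (q - r) < D * 1 := by linarith
    have i2 : (D : ℤ) * (r - q) < D * 1 := by linarith
    have j1 := lt_of_mul_lt_mul_left i1 hD.le
    have j2 := lt_of_mul_lt_mul_left i2 hD.le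
    omega
  have hw := fun k q => per_add_mul w.2 k q
  refine Set.ncard_congr
    (fun x _ => (w.1 x.1 + D * (-((w.1 x.1 - 1) / D)), w.1 x.2 + D * (-((w.1 x.1 - 1) / D))))
    ?_ ?_ ?_
  · rintro ⟨a, b⟩ ⟨h1, h2⟩
    exact ⟨red _, (hR _ _ _).2 h2⟩
  · rintro ⟨a, b⟩ ⟨a', b'⟩ ⟨h1, -⟩ ⟨h1', -⟩ h
    simp only [Prod.mk.injEq] at h
    simp only at h1 h1'
    rw [← hw, ← hw, ← hw, ← hw] at h
    have e1 := w.1.injective h.1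
    have e2 := w.1.injective h.2
    set q := -((w.1 a - 1) / (D : ℤ))
    set r := -((w.1 a' - 1) / (D : ℤ))
    have : (0 : ℤ) = r - q := by
      refine uniq a' 0 (r - q) (by simpa using h1') ?_
      rw [show a' + D * (r - q) = a by linarith]
      exact h1
    have hqr : q = r := by linarith
    rw [hqr] at e1 e2
    exact Prod.ext (by simpa using e1) (by simpa using e2)
  · rintro ⟨c, d⟩ ⟨h1, h2⟩
    simp only at h1 h2
    set t := -((w.1.symm c - 1) / (D : ℤ)) with ht
    have ea : w.1 (w.1.symm c + D * t) = c + D * t := by rw [hw]; simp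
    have eb : w.1 (w.1.symm d + D * t) = d + D * t := by rw [hw]; simp
    refine ⟨(w.1.symm c + D * t, w.1.symm d + D * t), ⟨red _, ?_⟩, ?_⟩
    · simp only [ea, eb]
      exact (hR _ _ _).2 h2
    · simp only [ea, eb]
      have h3 := red (c + D * t)
      have : (0 : ℤ) = t + -((c + D * t - 1) / D) := by
        refine uniq c _ _ (by simpa using h1) ?_
        convert h3 using 2 <;> ring
      rw [show c + D * t + D * (-((c + D * t - 1) / D)) = c + D * (t + -((c + D * t - 1) / D)) by
        ring, show d + D * t + D * (-((c + D * t - 1) / D)) =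
          d + D * (t + -((c + D * t - 1) / D)) by ring, ← this]
      simp

theorem length_mul_sorted {D n : ℕ} [NeZero D] (l : Dom D n) (p : PerFun D n)
    (u w : affSym D) (hu : u ∈ coset l.1 l.1) (hw : w ∈ coset l.1 p)
    (hs : ∀ a b : ℤ, a < b → p.1 a = p.1 b → w.1 a < w.1 b) :
    length (u * w) = length u + length w := by
  have hmono := dom_monotone l
  have hs' : ∀ a b : ℤ, p.1 a = p.1 b → w.1 a < w.1 b → a < b := by
    intro a b hp hlt
    rcases lt_trichotomy a b with h | h | h
    · exact h
    · rw [h] at hlt; exact absurd hlt (lt_irrefl _)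
    · exact absurd (hs b a h hp.symm) (not_lt.2 hlt.le)
  have e : invSet (u * w) =
      {x : ℤ × ℤ | (1 ≤ x.1 ∧ x.1 ≤ D) ∧ (w.1 x.1 < w.1 x.2 ∧ u.1 (w.1 x.2) < u.1 (w.1 x.1))} ∪
        invSet w := by
    ext ⟨a, b⟩
    have ha := hw a
    have hb := hw b
    have ua := hu (w.1 a)
    have ub := hu (w.1 b)
    constructor
    · rintro ⟨h1, h2, h3⟩
      change a < b at h2
      change u.1 (w.1 b) < u.1 (w.1 a) at h3
      rcases lt_trichotomy (w.1 a) (w.1 b) with h | h | h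
      · exact Or.inl ⟨h1, h, h3⟩
      · exact absurd (w.1.injective h) h2.ne
      · exact Or.inr ⟨h1, h2, h⟩
    · rintro (⟨h1, h2, h3⟩ | ⟨h1, h2, h3⟩)
      · simp only at h2 h3
        have i1 := hmono h2.le
        have i2 := hmono h3.le
        refine ⟨h1, hs' a b (by linarith) h2, h3⟩
      · simp only at h2 h3
        refine ⟨h1, h2, ?_⟩
        change u.1 (w.1 b) < u.1 (w.1 a)
        by_contra hge
        have i1 := hmono h3.le
        have i2 := hmono (not_lt.1 hge)
        have := hs a b h2 (by linarith)
        linarith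
  have hfin := invSet_finite (u * w)
  unfold length
  rw [e] at hfin ⊢
  rw [Set.ncard_union_eq ?_ (hfin.subset Set.subset_union_left) (invSet_finite w)]
  · congr 1
    refine ncard_periodic (fun c d => c < d ∧ u.1 d < u.1 c) (fun a b q => ?_) w
    rw [per_add_mul u.2, per_add_mul u.2]
    simp
  · rw [Set.disjoint_left]
    rintro ⟨a, b⟩ ⟨-, h2, -⟩ ⟨-, -, h4⟩
    exact lt_asymm h2 h4

theorem cosetSum_mem {D n : ℕ} [NeZero D] [NeZero n] (l : Dom D n) (p : PerFun D n) :
    cosetSum l.1 p ∈ Submodule.span (Hecke D)ᵐᵒᵖ {cosetSum l.1 l.1} := by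
  rcases (coset l.1 p).eq_empty_or_nonempty with h | h
  · have : cosetSum l.1 p = 0 := by
      unfold cosetSum
      apply Finset.sum_eq_zero
      intro w hw
      rw [Set.Finite.mem_toFinset, h] at hw
      exact absurd hw (Set.notMem_empty w)
    rw [this]
    exact Submodule.zero_mem _
  · obtain ⟨w, hw, hs⟩ := exists_sorted l p h
    have e : cosetSum l.1 p = MulOpposite.op (heckeT w) • cosetSum l.1 l.1 := by
      change cosetSum l.1 p = cosetSum l.1 l.1 * heckeT w
      unfold cosetSum
      rw [Finset.sum_mul]
      symm
      refine Finset.sum_bij (fun u _ => u * w) ?_ ?_ ?_ ?_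
      · intro u hu
        rw [Set.Finite.mem_toFinset] at hu ⊢
        intro k
        change l.1.1 (u.1 (w.1 k)) = _
        rw [hu (w.1 k)]; exact hw k
      · intro u _ u' _ h'
        exact mul_right_cancel h'
      · intro x hx
        rw [Set.Finite.mem_toFinset] at hx
        refine ⟨x * w⁻¹, ?_, by simp⟩
        rw [Set.Finite.mem_toFinset]
        intro k
        change l.1.1 (x.1 (w.1.symm k)) = _
        rw [hx, ← hw]; simp
      · intro u hu
        rw [Set.Finite.mem_toFinset] at hu
        exact heckeT_mul u w (length_mul_sorted l p u w hu hw hs)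
    rw [e]
    exact Submodule.smul_mem _ _ (Submodule.mem_span_singleton_self _)

/-! The tensor module `T_D` and the affine `q`-Schur algebra `S_D`. -/

instance {D n : ℕ} [NeZero D] : Finite (Dom D n) := by
  have hD : (0 : ℤ) < D := by exact_mod_cast Nat.pos_of_ne_zero (NeZero.ne D)
  have hb : ∀ (l : Dom D n) (j : Fin D), l.1.1 ((j : ℤ) + 1) ∈ Set.Icc (1 : ℤ) n := by
    intro l j
    have hj : (j : ℤ) < D := by exact_mod_cast j.2
    have hj0 : (0 : ℤ) ≤ j := Int.natCast_nonneg _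
    have hm := dom_monotone l
    exact ⟨l.2.1.trans (hm (by linarith)), (hm (by linarith)).trans l.2.2.2⟩
  refine Finite.of_injective
    (fun (l : Dom D n) (j : Fin D) => (⟨_, hb l j⟩ : Set.Icc (1 : ℤ) n)) ?_
  intro l l' h
  apply Subtype.ext
  apply Subtype.ext
  funext k
  have h0 := Int.emod_nonneg (k - 1) hD.ne'
  have h1 := Int.emod_lt_of_pos (k - 1) hD
  have h2 := congrArg Subtype.val (congrFun h ⟨((k - 1) % D).toNat, by omega⟩)
  simp only [Int.toNat_of_nonneg h0] at h2
  have e1 := per_add_mul l.1.2 ((k - 1) % D + 1) ((k - 1) / D)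
  have e2 := per_add_mul l'.1.2 ((k - 1) % D + 1) ((k - 1) / D)
  have e3 := Int.emod_add_mul_ediv (k - 1) D
  rw [show (k - 1) % D + 1 + D * ((k - 1) / D) = k by linarith] at e1 e2
  rw [e1, e2, h2]

/-- `T_D = ⨁_{l ∈ ℭ_D} T_l H_D`, a right `H_D`-module. As `ℭ_D` is finite, the direct sum is the
product. -/
abbrev TMod (D n : ℕ) [NeZero D] [NeZero n] : Type :=
  ∀ l : Dom D n, Submodule.span (Hecke D)ᵐᵒᵖ {cosetSum l.1 l.1}

/-- The element `T_p` of `T_D`. It lies in the summand `T_l H_D` for which `p` is in the orbit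
of `l`: the sums that define the other components are empty. -/
def Tvec {D n : ℕ} [NeZero D] [NeZero n] (p : PerFun D n) : TMod D n :=
  fun l => ⟨cosetSum l.1 p, cosetSum_mem l p⟩

/-- The affine `q`-Schur algebra `S_D`, the endomorphism ring of the right `H_D`-module `T_D`. -/
abbrev Schur (D n : ℕ) [NeZero D] [NeZero n] : Type := Module.End (Hecke D)ᵐᵒᵖ (TMod D n)

/-- `S` is the element `T_s` of `S_D`, i.e. the endomorphism with `T_m ↦ T_s` if `s ∈ 𝔖_{lm}`,
where `T_s` is seen in the summand `T_l H_D`, and `T_m ↦ 0` if there is no such `l`. It is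
unique, because the `T_m` generate `T_D`. -/
def IsSchurT {D n : ℕ} [NeZero D] [NeZero n] (s : ℤ → ℤ → ℤ) (S : Schur D n) : Prop :=
  ∀ m l : Dom D n, ((S (Tvec m.1) l : _) : Hecke D) = doubleCosetSum l.1 s m.1

/-- `y_s = ∑ s_{ij} s_{kl}` over `i ≥ k`, `j < l`, `i ∈ [1, n]`. -/
def ydim (n : ℕ) (s : ℤ → ℤ → ℤ) : ℤ :=
  ∑ᶠ x ∈ {x : (ℤ × ℤ) × (ℤ × ℤ) |
      x.2.1 ≤ x.1.1 ∧ x.1.2 < x.2.2 ∧ 1 ≤ x.1.1 ∧ x.1.1 ≤ n},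
    s x.1.1 x.1.2 * s x.2.1 x.2.2

/-- `E` is the (image in `S_D ⊗ K` of the) normalized element `[s] = v ^ y_s T_s`. -/
def IsSchurBracket {D n : ℕ} [NeZero D] [NeZero n] (s : ℤ → ℤ → ℤ)
    (E : BaseK ⊗[BaseA] Schur D n) : Prop :=
  ∃ S : Schur D n, IsSchurT s S ∧
    E = (1 : BaseK) ⊗ₜ[BaseA] ((LaurentPolynomial.T (ydim n s) : BaseA) • S)

/-- The normalized element `[p] = v ^ x_p T_p` of `T_D`, seen in `T_D ⊗ K`. -/
def bracket {D n : ℕ} [NeZero D] [NeZero n] (p : PerFun D n) : BaseK ⊗[BaseA] TMod D n :=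
  (1 : BaseK) ⊗ₜ[BaseA] ((LaurentPolynomial.T (xdim p : ℤ) : BaseA) • Tvec p)

/-- The action of `S_D ⊗ K` on `T_D ⊗ K`, `(a ⊗ S) (b ⊗ x) = a b ⊗ S x`. -/
def schurAct (D n : ℕ) [NeZero D] [NeZero n] :
    BaseK ⊗[BaseA] Schur D n →ₐ[BaseK] Module.End BaseK (BaseK ⊗[BaseA] TMod D n) :=
  Algebra.TensorProduct.lift (Algebra.ofId BaseK _)
    ((Module.End.baseChangeHom BaseA BaseK (TMod D n)).comp
      (Algebra.lsmul BaseA BaseA (TMod D n)))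
    (fun a _ => Algebra.commutes a _)

/-! The modified algebra. -/

/-- The Cartan matrix of type `A_{n-1}^{(1)}`, indexed by `ℤ / n` (for `n = 2`, the off-diagonal
entries are `-2`). -/
def cartan {n : ℕ} (i j : ZMod n) : ℤ :=
  (if i = j then 2 else 0) - (if i = j + 1 then 1 else 0) - (if i = j - 1 then 1 else 0)

/-- The tuple `ω_i`, `ω_{i,j} = δ_{ij}`. -/
def omega {n : ℕ} (i : ZMod n) : ZMod n → ℤ := Pi.single i 1

/-- The symbols `e_i`, `f_i`, `a_μ`. The tuple `μ` may have negative entries; the corresponding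
`a_μ` are set equal to zero below. -/
inductive Gen (n : ℕ) : Type
  | e (i : ZMod n)
  | f (i : ZMod n)
  | a (μ : ZMod n → ℤ)

/-- The divided power `x ^ k / [k]!`. -/
def divPow {R : Type*} [Ring R] [Algebra BaseK R] (x : R) (k : ℕ) : R := (qFact k)⁻¹ • x ^ k

/-- `∑_{k=0}^{N} (-1)^k x^{(k)} y x^{(N-k)}`. -/
def serre {R : Type*} [Ring R] [Algebra BaseK R] (N : ℕ) (x y : R) : R :=
  ∑ k ∈ Finset.range (N + 1), (-1) ^ k * (divPow x k * y * divPow x (N - k))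

/-- The free unital algebra on the symbols `e_i`, `f_i`, `a_μ`. -/
abbrev FreeU (n : ℕ) : Type := FreeAlgebra BaseK (Gen n)

/-- The symbol `e_i` in the free algebra. -/
def eF {n : ℕ} (i : ZMod n) : FreeU n := FreeAlgebra.ι BaseK (Gen.e i)

/-- The symbol `f_i` in the free algebra. -/
def fF {n : ℕ} (i : ZMod n) : FreeU n := FreeAlgebra.ι BaseK (Gen.f i)

/-- The symbol `a_μ` in the free algebra. -/
def aF {n : ℕ} (μ : ZMod n → ℤ) : FreeU n := FreeAlgebra.ι BaseK (Gen.a μ)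

/-- The relations between `e_i`, `f_i`, `a_μ`. -/
inductive URel (n : ℕ) : FreeU n → FreeU n → Prop
  | a_neg (μ : ZMod n → ℤ) (h : ∃ i, μ i < 0) : URel n (aF μ) 0
  | a_mul_self (μ : ZMod n → ℤ) : URel n (aF μ * aF μ) (aF μ)
  | a_mul (μ ν : ZMod n → ℤ) (h : μ ≠ ν) : URel n (aF μ * aF ν) 0
  | a_e (μ : ZMod n → ℤ) (i : ZMod n) :
      URel n (aF (μ + omega i) * eF i) (eF i * aF (μ + omega (i + 1)))
  | a_f (μ : ZMod n → ℤ) (i : ZMod n) :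
      URel n (aF (μ + omega (i + 1)) * fF i) (fF i * aF (μ + omega i))
  | e_f_self (i : ZMod n) (μ : ZMod n → ℤ) :
      URel n ((eF i * fF i - fF i * eF i) * aF μ) (qInt (μ i - μ (i + 1)) • aF μ)
  | e_f (i j : ZMod n) (h : i ≠ j) (μ : ZMod n → ℤ) :
      URel n ((eF i * fF j - fF j * eF i) * aF μ) 0
  | serre_e (i j : ZMod n) (h : i ≠ j) :
      URel n (serre (1 - cartan i j).toNat (eF i) (eF j)) 0
  | serre_f (i j : ZMod n) (h : i ≠ j) :
      URel n (serre (1 - cartan i j).toNat (fF i) (fF j)) 0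

/-- The unital algebra generated by `e_i`, `f_i`, `a_μ` modulo the relations; the modified
algebra is built inside it. -/
def UAmb (n : ℕ) : Type := RingQuot (URel n)

instance (n : ℕ) : Ring (UAmb n) := inferInstanceAs (Ring (RingQuot (URel n)))

instance (n : ℕ) : Algebra BaseK (UAmb n) := inferInstanceAs (Algebra BaseK (RingQuot (URel n)))

/-- The quotient map onto `UAmb n`. -/
def toU (n : ℕ) : FreeU n →ₐ[BaseK] UAmb n := RingQuot.mkAlgHom BaseK (URel n)

/-- The modified algebra `U̇` of `gl_n^` at level `0`: the algebra without unit generated by the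
elements `a_μ`, `e_i a_μ` and `f_i a_μ`. -/
def Udot (n : ℕ) : NonUnitalSubalgebra BaseK (UAmb n) :=
  NonUnitalAlgebra.adjoin BaseK
    ((Set.range fun μ => toU n (aF μ)) ∪
      (Set.range fun x : ZMod n × (ZMod n → ℤ) => toU n (eF x.1 * aF x.2)) ∪
      (Set.range fun x : ZMod n × (ZMod n → ℤ) => toU n (fF x.1 * aF x.2)))

/-- The element `a_μ` of `U̇`. -/
def aEl {n : ℕ} (μ : ZMod n → ℤ) : Udot n :=
  ⟨toU n (aF μ), NonUnitalAlgebra.subset_adjoin BaseK (Or.inl (Or.inl ⟨μ, rfl⟩))⟩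

/-- The element `e_i a_μ` of `U̇`. -/
def eaEl {n : ℕ} (i : ZMod n) (μ : ZMod n → ℤ) : Udot n :=
  ⟨toU n (eF i * aF μ), NonUnitalAlgebra.subset_adjoin BaseK (Or.inl (Or.inr ⟨(i, μ), rfl⟩))⟩

/-- The element `f_i a_μ` of `U̇`. -/
def faEl {n : ℕ} (i : ZMod n) (μ : ZMod n → ℤ) : Udot n :=
  ⟨toU n (fF i * aF μ), NonUnitalAlgebra.subset_adjoin BaseK (Or.inr ⟨(i, μ), rfl⟩)⟩

theorem toU_a_mul_e {n : ℕ} (i : ZMod n) (μ : ZMod n → ℤ) :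
    toU n (aF μ * eF i) = toU n (eF i * aF (μ - omega i + omega (i + 1))) := by
  have h := RingQuot.mkAlgHom_rel BaseK (URel.a_e (μ - omega i) i)
  rw [sub_add_cancel] at h
  exact h

/-- The element `a_μ e_i` of `U̇`. -/
def aeEl {n : ℕ} (i : ZMod n) (μ : ZMod n → ℤ) : Udot n :=
  ⟨toU n (aF μ * eF i), by
    rw [toU_a_mul_e]
    exact (eaEl i (μ - omega i + omega (i + 1))).2⟩

/-! The homomorphism `Φ_D`. -/

/-- The matrix `δl`, `δl_{ij} = δ_{ij} ♯l_i`. -/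
def diagMat {D n : ℕ} [NeZero D] [NeZero n] (l : PerFun D n) (i j : ℤ) : ℤ :=
  if i = j then sharp l (i : ZMod n) else 0

/-- The `n`-periodic matrix `s` obtained from `δl` by subtracting `1` in the position `(i, i)` and
adding `1` in the position `(i, i + 1)`, simultaneously for all `i` in the given class
modulo `n`. -/
def raiseMat {D n : ℕ} [NeZero D] [NeZero n] (l : PerFun D n) (i : ZMod n) (k j : ℤ) : ℤ :=
  diagMat l k j - (if (k : ZMod n) = i ∧ j = k then 1 else 0)
    + (if (k : ZMod n) = i ∧ j = k + 1 then 1 else 0)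

/-- `Φ` is the homomorphism `Φ_D : U̇ → S_D ⊗ K`:
`Φ (a_{♯l} e_i) = [s]` with `s = raiseMat l i`, `Φ (f_i a_{♯l}) = [t]` with `t` the transpose of
`s`, `Φ (a_μ) = 0` if `∑ μ_i ≠ D`, and `Φ (a_{♯l}) = [δl]`. (If `♯l_i = 0`, then `s` has a negative
entry, its double coset is empty, and the first two values are zero.) -/
structure IsPhi {D n : ℕ} [NeZero D] [NeZero n]
    (Φ : Udot n →ₙₐ[BaseK] (BaseK ⊗[BaseA] Schur D n)) : Prop where
  map_ae : ∀ (l : Dom D n) (i : ZMod n),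
    IsSchurBracket (raiseMat l.1 i) (Φ (aeEl i (sharp l.1)))
  map_fa : ∀ (l : Dom D n) (i : ZMod n),
    IsSchurBracket (fun k j => raiseMat l.1 i j k) (Φ (faEl i (sharp l.1)))
  map_a_zero : ∀ μ : ZMod n → ℤ, (∀ i, 0 ≤ μ i) → ∑ i, μ i ≠ D → Φ (aEl μ) = 0
  map_a : ∀ l : Dom D n, IsSchurBracket (diagMat l.1) (Φ (aEl (sharp l.1)))

end

end AffineSchur

open AffineSchur

namespace AffineSchur
set_option linter.unusedSectionVars false

/-! Everything rests on the rule for right multiplication of the normalized vectors. For the swap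
`s` of `j` and `j + 1`, `[q] T_s` is `v⁻¹ [q ∘ s]` if `q j < q (j + 1)` and `v⁻² [q]` if `q j = q (j
+ 1)` (`normVec_mul_heckeT`). The first case is additivity of lengths over a whole coset, combined
with the growth of `x_q` by one; the second is the quadratic relation. Hence each `[p]` arises from
a monotone function, which is dominant up to a translation, by successive multiplications by `v
T_s`.

The operators `e_i` and `f_i` are defined on the generators `T_m` of `T_D`, with values a power of
`v` times a sum of vectors `T_{m_k^∓}`. Such a sum runs over a set of group elements stable under
right multiplication by the stabilizer of `m`, so it is a left multiple `X T_m`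
(`exists_mul_cosetSum`), and left multiplication by `X` commutes with the right action. The explicit
formula holds for monotone `p`, where all terms carry the same power of `v`, and an induction on
`x_p` extends it to all `p` (`apply_normVec`). In that induction a term on which `T_s` acts by `v⁻²`
instead of `v⁻¹` is one for which a neighbour of `k` crosses `k`, and this lowers the exponent of
`v` by one as well (`moveExp_comp_swap`). A sign `ε` treats `e_i` (`ε = 1`) and `f_i` (`ε = -1`)
together.

The commutation relations are then read off on the vectors `[p]`. In a commutator, the moves of two
points in different classes modulo `D` cancel (`moveExp_comm`); the moves within one class remain.
They are absent for `i ≠ j`, and for `i = j` they telescope to the quantum integer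
(`sum_T_sub_sum_T`). The Serre relations are not checked on vectors. They follow from the other
relations and from the nilpotency of `e_i` and `f_i`, which holds because weights are bounded: `e_j`
is a lowest weight vector for the adjoint action of the `sl_2` of index `i`, and vanishing of high
iterated `q`-commutators descends to the one in the Serre relation (`serre_eq_zero`).

Finally, describing the double cosets of the bidiagonal matrices identifies the operators with the
elements `[s]`. Uniqueness holds because the `T_m` generate `T_D`, so that `[s]` is determined, and
because every admissible weight is some `♯l`. -/

/-! ### Lengths of products and the action on periodic functions -/

theorem natCast_pos_of_neZero (D : ℕ) [NeZero D] : (0 : ℤ) < D := by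
  exact_mod_cast Nat.pos_of_ne_zero (NeZero.ne D)

/-- A pair inverted by `u * w` is either inverted by `w`, or kept in order by `w` and then inverted
by `u`. The hypothesis says that `u` restores no pair inverted by `w`, so both kinds occur in full;
counting pairs modulo translation is invariant under `w`, so the second kind contributes the length
of `u`. -/
theorem length_mul_of_inversions {D : ℕ} [NeZero D] (u w : affSym D)
    (h : ∀ a b : ℤ, a < b → w.1 b < w.1 a → u.1 (w.1 b) < u.1 (w.1 a)) :
    length (u * w) = length u + length w := by
  have e : invSet (u * w) =
      {x : ℤ × ℤ | (1 ≤ x.1 ∧ x.1 ≤ D) ∧ (w.1 x.1 < w.1 x.2 ∧ u.1 (w.1 x.2) < u.1 (w.1 x.1))} ∪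
        invSet w := by
    ext ⟨a, b⟩
    constructor
    · rintro ⟨h1, h2, h3⟩
      change a < b at h2
      change u.1 (w.1 b) < u.1 (w.1 a) at h3
      rcases lt_trichotomy (w.1 a) (w.1 b) with h | h | h
      · exact Or.inl ⟨h1, h, h3⟩
      · exact absurd (w.1.injective h) h2.ne
      · exact Or.inr ⟨h1, h2, h⟩
    · rintro (⟨h1, h2, h3⟩ | ⟨h1, h2, h3⟩)
      · simp only at h2 h3
        refine ⟨h1, ?_, h3⟩
        rcases lt_trichotomy a b with h' | h' | h'
        · exact h'
        · rw [h'] at h2; exact absurd h2 (lt_irrefl _)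
        · exact absurd (h b a h' h2) (not_lt.2 h3.le)
      · exact ⟨h1, h2, h a b h2 h3⟩
  have hfin := invSet_finite (u * w)
  unfold length
  rw [e] at hfin ⊢
  rw [Set.ncard_union_eq ?_ (hfin.subset Set.subset_union_left) (invSet_finite w)]
  · congr 1
    refine ncard_periodic (fun c d => c < d ∧ u.1 d < u.1 c) (fun a b q => ?_) w
    rw [per_add_mul u.2, per_add_mul u.2]
    simp
  · rw [Set.disjoint_left]
    rintro ⟨a, b⟩ ⟨-, h2, -⟩ ⟨-, -, h4⟩
    exact lt_asymm h2 h4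

theorem inv_apply_eq_symm {D : ℕ} (w : affSym D) (j : ℤ) : (w⁻¹).1 j = w.1.symm j := rfl

/-- The right action `(p) w = p ∘ w`. -/
def PerFun.comp {D n : ℕ} (p : PerFun D n) (w : affSym D) : PerFun D n :=
  ⟨fun j => p.1 (w.1 j), fun j => by simp only [w.2 j, p.2]⟩

@[simp] theorem PerFun.comp_apply {D n : ℕ} (p : PerFun D n) (w : affSym D) (j : ℤ) :
    (p.comp w).1 j = p.1 (w.1 j) := rfl

theorem PerFun.ext {D n : ℕ} {p q : PerFun D n} (h : ∀ j, p.1 j = q.1 j) : p = q :=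
  Subtype.ext (funext h)

theorem PerFun.add_mul {D n : ℕ} (p : PerFun D n) (j q : ℤ) :
    p.1 (j + D * q) = p.1 j + n * q := per_add_mul p.2 j q

theorem PerFun.eq_add_of_dvd {D n : ℕ} (p : PerFun D n) {k l : ℤ} (h : (D : ℤ) ∣ l - k) :
    ∃ t : ℤ, l = k + D * t ∧ p.1 l = p.1 k + n * t := by
  obtain ⟨t, ht⟩ := h
  have : l = k + D * t := by linarith
  exact ⟨t, this, by rw [this, p.add_mul]⟩

theorem PerFun.eq_of_dvd {D n : ℕ} [NeZero n] (p : PerFun D n) {k l : ℤ} (h : (D : ℤ) ∣ l - k)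
    (e : p.1 l = p.1 k) : l = k := by
  obtain ⟨t, h1, h2⟩ := p.eq_add_of_dvd h
  have : (n : ℤ) * t = 0 := by linarith
  rcases mul_eq_zero.1 this with h | h
  · exact absurd h (natCast_pos_of_neZero n).ne'
  · rw [h1, h]; simp

/-! ### Fibers, weights, and uniqueness of the dominant representative -/

section fibers
variable {D n : ℕ} [NeZero D] [NeZero n]

@[simp] theorem mem_fiber {p : PerFun D n} {i k : ℤ} : k ∈ fiber p i ↔ p.1 k = i := by
  simp [fiber]

theorem card_fiber_comp (p : PerFun D n) (w : affSym D) (i : ℤ) :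
    (fiber (p.comp w) i).card = (fiber p i).card := by
  refine Finset.card_bij (fun k _ => w.1 k) ?_ ?_ ?_
  · intro k hk; simpa using hk
  · intro a _ b _ h; exact w.1.injective h
  · intro k hk; exact ⟨w.1.symm k, by simpa using hk, by simp⟩

theorem card_fiber_add_mul (p : PerFun D n) (i q : ℤ) :
    (fiber p (i + n * q)).card = (fiber p i).card := by
  symm
  refine Finset.card_bij (fun k _ => k + D * q) ?_ ?_ ?_
  · intro k hk
    simp only [mem_fiber, p.add_mul] at hk ⊢
    rw [hk]
  · intro a _ b _ h; exact add_right_cancel h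
  · intro k hk
    refine ⟨k + D * (-q), ?_, by ring⟩
    simp only [mem_fiber, p.add_mul] at hk ⊢
    rw [hk]; ring

theorem sharp_intCast (p : PerFun D n) (i : ℤ) : sharp p (i : ZMod n) = (fiber p i).card := by
  unfold sharp
  rw [ZMod.val_intCast]
  have := card_fiber_add_mul p (i % n) (i / n)
  rw [Int.emod_add_mul_ediv] at this
  rw [this]

theorem sharp_comp (p : PerFun D n) (w : affSym D) : sharp (p.comp w) = sharp p := by
  funext i
  unfold sharp
  rw [card_fiber_comp]

theorem exists_intCast_eq (i : ZMod n) : ∃ j : ℤ, (j : ZMod n) = i := ⟨i.val, by simp⟩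

theorem mem_coset {l p : PerFun D n} {w : affSym D} : w ∈ coset l p ↔ l.comp w = p := by
  constructor
  · intro h; exact PerFun.ext h
  · rintro rfl k; rfl

theorem sharp_eq_of_coset {l p : PerFun D n} (h : (coset l p).Nonempty) : sharp l = sharp p := by
  obtain ⟨w, hw⟩ := h
  rw [← mem_coset.1 hw, sharp_comp]

theorem cosetSum_eq_zero {l p : PerFun D n} (h : ¬ (coset l p).Nonempty) : cosetSum l p = 0 := by
  unfold cosetSum
  apply Finset.sum_eq_zero
  intro w hw
  rw [Set.Finite.mem_toFinset] at hw
  exact absurd ⟨w, hw⟩ h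

theorem finite_setOf_lt_le (p : PerFun D n) (a c : ℤ) : {b : ℤ | a < b ∧ p.1 b ≤ c}.Finite := by
  have hD := natCast_pos_of_neZero D
  have hn := natCast_pos_of_neZero n
  refine Set.Finite.subset (((Finset.Ico (0 : ℤ) D).biUnion fun r =>
    (Finset.Icc (a / D) ((c - p.1 r) / n)).image fun t => r + D * t)).finite_toSet ?_
  rintro b ⟨h1, h2⟩
  simp only [Finset.coe_biUnion, Set.mem_iUnion, Finset.coe_image, Set.mem_image,
    Finset.mem_coe, Finset.mem_Ico, Finset.mem_Icc]
  refine ⟨b % D, ⟨Int.emod_nonneg _ hD.ne', Int.emod_lt_of_pos _ hD⟩, b / D, ⟨?_, ?_⟩,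
    Int.emod_add_mul_ediv b D⟩
  · exact Int.ediv_le_ediv hD h1.le
  · rw [Int.le_ediv_iff_mul_le hn]
    have := p.add_mul (b % D) (b / D)
    rw [Int.emod_add_mul_ediv] at this
    linarith

/-- Dominance fixes where the values become positive: between `0` and `1`. This normalization
removes the freedom of translating the argument. -/
theorem Dom.apply_zero_lt (l : Dom D n) {j : ℤ} : l.1.1 j ≤ 0 ↔ j ≤ 0 := by
  have hm := dom_monotone l
  constructor
  · intro h
    by_contra hj
    have := hm (show (1 : ℤ) ≤ j by linarith)
    have := l.2.1
    linarith
  · intro h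
    have h1 := hm h
    have h2 := l.1.2 0
    have h3 := l.2.2.2
    rw [zero_add] at h2
    linarith

/-- Each orbit contains at most one dominant function. By `Dom.apply_zero_lt`, `w` preserves the
positive integers, hence the numbers of positive points with value at most `c` agree for `l` and
`m`. These points form initial segments, so equal numbers give equal sets, and the sets determine
the function. -/
theorem Dom.eq_of_comp_eq (l m : Dom D n) (w : affSym D) (h : l.1.comp w = m.1) : l = m := by
  have hD := natCast_pos_of_neZero D
  have key : ∀ c : ℤ, {j : ℤ | 0 < j ∧ l.1.1 j ≤ c} = {j : ℤ | 0 < j ∧ m.1.1 j ≤ c} := by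
    intro c
    have hcard : {j : ℤ | 0 < j ∧ l.1.1 j ≤ c}.ncard = {j : ℤ | 0 < j ∧ m.1.1 j ≤ c}.ncard := by
      symm
      refine Set.ncard_congr (fun j _ => w.1 j) ?_ ?_ ?_
      · rintro j ⟨h1, h2⟩
        rw [← h] at h2
        refine ⟨?_, h2⟩
        rw [← not_le] at h1 ⊢
        rwa [← l.apply_zero_lt, ← PerFun.comp_apply, h, m.apply_zero_lt]
      · intro a b _ _ e; exact w.1.injective e
      · rintro j ⟨h1, h2⟩
        refine ⟨w.1.symm j, ⟨?_, ?_⟩, by simp⟩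
        · rw [← not_le] at h1 ⊢
          rw [← m.apply_zero_lt, ← h, PerFun.comp_apply]
          simpa [l.apply_zero_lt] using h1
        · rw [← h]; simpa using h2
    have hl := finite_setOf_lt_le l.1 0 c
    have hm := finite_setOf_lt_le m.1 0 c
    -- Two initial segments are comparable; whichever inclusion holds, equality of cardinalities
    -- makes it an equality.
    by_cases hs : {j : ℤ | 0 < j ∧ l.1.1 j ≤ c} ⊆ {j : ℤ | 0 < j ∧ m.1.1 j ≤ c}
    · exact Set.eq_of_subset_of_ncard_le hs hcard.ge hm
    · symm
      refine Set.eq_of_subset_of_ncard_le ?_ hcard.le hl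
      rw [Set.not_subset] at hs
      obtain ⟨x, ⟨hx0, hx1⟩, hx2⟩ := hs
      rintro y ⟨hy0, hy1⟩
      refine ⟨hy0, ?_⟩
      have hxy : ¬ x ≤ y := fun hxy => hx2 ⟨hx0, (dom_monotone m hxy).trans hy1⟩
      exact (dom_monotone l (not_le.1 hxy).le).trans hx1
  have pos : ∀ j : ℤ, 0 < j → l.1.1 j = m.1.1 j := by
    intro j hj
    have h1 : j ∈ {j : ℤ | 0 < j ∧ m.1.1 j ≤ l.1.1 j} := 
      (Set.ext_iff.1 (key _) j).1 ⟨hj, le_rfl⟩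
    have h2 : j ∈ {k : ℤ | 0 < k ∧ l.1.1 k ≤ m.1.1 j} := 
      (Set.ext_iff.1 (key _) j).2 ⟨hj, le_rfl⟩
    exact le_antisymm h2.2 h1.2
  apply Subtype.ext
  apply PerFun.ext
  intro j
  -- As `D ≥ 1`, translating by `|j| + 1` periods reaches the positive integers, where equality is
  -- known.
  have hj : 0 < j + D * (|j| + 1) := by
    have : 1 * (|j| + 1) ≤ D * (|j| + 1) := by
      apply mul_le_mul_of_nonneg_right _ (by positivity)
      omega
    have := neg_abs_le j
    linarith
  have := pos _ hj
  rw [PerFun.add_mul, PerFun.add_mul] at this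
  linarith

theorem cosetSum_dom_ne (l m : Dom D n) (h : l ≠ m) : cosetSum l.1 m.1 = 0 :=
  cosetSum_eq_zero fun ⟨w, hw⟩ => h (l.eq_of_comp_eq m w (mem_coset.1 hw))

end fibers

/-! Simple reflections. -/

/-- `s` is the simple reflection exchanging `m` and `m + 1`. -/
structure IsSwap {D : ℕ} (s : affSym D) (m : ℤ) : Prop where
  two_le : 2 ≤ D
  apply_left : ∀ j, (D : ℤ) ∣ j - m → s.1 j = j + 1
  apply_right : ∀ j, (D : ℤ) ∣ j - (m + 1) → s.1 j = j - 1
  apply_other : ∀ j, ¬ (D : ℤ) ∣ j - m → ¬ (D : ℤ) ∣ j - (m + 1) → s.1 j = j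

theorem not_dvd_succ {D : ℕ} (h : 2 ≤ D) {a : ℤ} (ha : (D : ℤ) ∣ a) : ¬ (D : ℤ) ∣ a - 1 := by
  intro h'
  have : (D : ℤ) ∣ 1 := by simpa using dvd_sub ha h'
  have := Int.le_of_dvd one_pos this
  omega

theorem exists_isSwap {D : ℕ} (hD : 2 ≤ D) (m : ℤ) : ∃ s : affSym D, IsSwap s m := by
  obtain ⟨s, hs⟩ := exists_simple hD m
  refine ⟨s, hD, fun j hj => by rw [hs, if_pos hj], fun j hj => ?_,
    fun j h1 h2 => by rw [hs, if_neg h1, if_neg h2]⟩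
  rw [hs, if_neg, if_pos hj]
  intro h
  exact not_dvd_succ hD h (by convert hj using 1; ring)

namespace IsSwap
variable {D : ℕ} {s : affSym D} {m : ℤ}

theorem isSimpleReflection (h : IsSwap s m) : IsSimpleReflection s :=
  ⟨m, h.apply_left m (by simp), by simpa using h.apply_right (m + 1) (by simp), h.apply_other⟩

theorem apply_apply (h : IsSwap s m) (j : ℤ) : s.1 (s.1 j) = j := by
  by_cases h1 : (D : ℤ) ∣ j - m
  · rw [h.apply_left j h1, h.apply_right]
    · ring
    · convert h1 using 1; ring
  · by_cases h2 : (D : ℤ) ∣ j - (m + 1)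
    · rw [h.apply_right j h2, h.apply_left]
      · ring
      · convert h2 using 1; ring
    · rw [h.apply_other j h1 h2, h.apply_other j h1 h2]

theorem apply_lt_iff (h : IsSwap s m) {x y : ℤ} (hxy : x < y) :
    s.1 y < s.1 x ↔ (D : ℤ) ∣ x - m ∧ y = x + 1 := by
  constructor
  · intro hlt
    by_cases c1 : (D : ℤ) ∣ x - m
    · refine ⟨c1, ?_⟩
      rw [h.apply_left x c1] at hlt
      by_cases d1 : (D : ℤ) ∣ y - m
      · rw [h.apply_left y d1] at hlt; omega
      · by_cases d2 : (D : ℤ) ∣ y - (m + 1)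
        · rw [h.apply_right y d2] at hlt
          have : y = x + 1 ∨ y = x + 2 - 1 := by omega
          omega
        · rw [h.apply_other y d1 d2] at hlt; omega
    · exfalso
      have hx : s.1 x ≤ x := by
        by_cases c2 : (D : ℤ) ∣ x - (m + 1)
        · rw [h.apply_right x c2]; omega
        · rw [h.apply_other x c1 c2]
      by_cases d1 : (D : ℤ) ∣ y - m
      · rw [h.apply_left y d1] at hlt; omega
      · by_cases d2 : (D : ℤ) ∣ y - (m + 1)
        · rw [h.apply_right y d2] at hlt
          apply c1
          have : x = y - 1 := by omega
          rw [this]; convert d2 using 1; ring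
        · rw [h.apply_other y d1 d2] at hlt; omega
  · rintro ⟨h1, rfl⟩
    rw [h.apply_left x h1, h.apply_right (x + 1) (by convert h1 using 1; ring)]
    omega

/-- A simple reflection changes the order of exactly the pairs of exchanged neighbours. -/
theorem apply_lt_apply_iff (h : IsSwap s m) (x y : ℤ) :
    s.1 x < s.1 y ↔ (x < y ∧ ¬ ((D : ℤ) ∣ x - m ∧ y = x + 1)) ∨
      ((D : ℤ) ∣ y - m ∧ x = y + 1) := by
  rcases lt_trichotomy x y with hxy | rfl | hxy
  · have := h.apply_lt_iff hxy
    have hne : s.1 x ≠ s.1 y := fun e => hxy.ne (s.1.injective e)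
    constructor
    · intro h'
      left
      exact ⟨hxy, fun h'' => absurd (this.2 h'') (not_lt.2 h'.le)⟩
    · rintro (⟨-, h'⟩ | ⟨-, h'⟩)
      · rw [← this] at h'
        exact lt_of_le_of_ne (not_lt.1 h') hne
      · omega
  · simp
  · rw [h.apply_lt_iff hxy]
    constructor
    · exact Or.inr
    · rintro (⟨h', -⟩ | h')
      · omega
      · exact h'

theorem perFun_eq (h : IsSwap s m) {n : ℕ} {p : PerFun D n} (he : p.1 m = p.1 (m + 1)) :
    p.comp s = p := by
  apply PerFun.ext
  intro j
  rw [PerFun.comp_apply]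
  by_cases h1 : (D : ℤ) ∣ j - m
  · rw [h.apply_left j h1]
    obtain ⟨t, rfl, -⟩ := p.eq_add_of_dvd h1
    rw [show m + D * t + 1 = m + 1 + D * t by ring, p.add_mul, p.add_mul, he]
  · by_cases h2 : (D : ℤ) ∣ j - (m + 1)
    · rw [h.apply_right j h2]
      obtain ⟨t, rfl, -⟩ := p.eq_add_of_dvd h2
      rw [show m + 1 + D * t - 1 = m + D * t by ring, p.add_mul, p.add_mul, he]
    · rw [h.apply_other j h1 h2]

end IsSwap

/-! Right multiplication in the Hecke algebra. -/

section hecke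
variable {D n : ℕ} [NeZero D] [NeZero n]

theorem heckeT_quad {s : affSym D} (h : IsSimpleReflection s) :
    (heckeT s + 1) * (heckeT s - algebraMap BaseA _ (LaurentPolynomial.T (-2))) = 0 := by
  have := RingQuot.mkAlgHom_rel BaseA (HeckeRel.quad s h)
  rw [map_zero, map_mul, map_add, map_sub, map_one, AlgHom.commutes] at this
  exact this

theorem add_one_mul_heckeT {s : affSym D} (h : IsSimpleReflection s) :
    (1 + heckeT s) * heckeT s = (LaurentPolynomial.T (-2) : BaseA) • (1 + heckeT s) := by
  have := heckeT_quad h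
  rw [mul_sub, sub_eq_zero, ← Algebra.commutes, ← Algebra.smul_def] at this
  rw [add_comm, this]

/-- If `l ∘ u = p` with `l` monotone, a strict inequality between values of `p` forces the same
inequality between values of `u`. So no `u` in the coset undoes an inversion of `w`, lengths add in
every term, and right multiplication by `w` is a bijection between the two cosets. -/
theorem cosetSum_mul_heckeT (l : Dom D n) (p : PerFun D n) (w : affSym D)
    (h : ∀ a b : ℤ, a < b → w.1 b < w.1 a → p.1 (w.1 b) < p.1 (w.1 a)) :
    cosetSum l.1 p * heckeT w = cosetSum l.1 (p.comp w) := by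
  unfold cosetSum
  rw [Finset.sum_mul]
  refine Finset.sum_bij (fun u _ => u * w) ?_ ?_ ?_ ?_
  · intro u hu
    rw [Set.Finite.mem_toFinset] at hu ⊢
    intro k
    exact hu (w.1 k)
  · intro u _ u' _ h'
    exact mul_right_cancel h'
  · intro x hx
    rw [Set.Finite.mem_toFinset] at hx
    refine ⟨x * w⁻¹, ?_, by simp⟩
    rw [Set.Finite.mem_toFinset]
    intro k
    change l.1.1 (x.1 (w.1.symm k)) = _
    rw [hx]; simp
  · intro u hu
    rw [Set.Finite.mem_toFinset] at hu
    refine heckeT_mul u w (length_mul_of_inversions u w fun a b hab hw => ?_)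
    by_contra hcon
    have h1 := dom_monotone l (not_lt.1 hcon)
    have h2 := h a b hab hw
    have h3 := hu (w.1 a)
    have h4 := hu (w.1 b)
    linarith

/-- Here `p ∘ s = p`, so the coset is a union of pairs `{u, u s}`. The sum therefore has the right
factor `1 + T_s`, on which `T_s` acts by `v⁻²`. -/
theorem cosetSum_mul_heckeT_of_eq (l : Dom D n) (p : PerFun D n) {s : affSym D} {m : ℤ}
    (h : IsSwap s m) (he : p.1 m = p.1 (m + 1)) :
    cosetSum l.1 p * heckeT s = (LaurentPolynomial.T (-2) : BaseA) • cosetSum l.1 p := by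
  classical
  set S := (coset_finite l.1 p).toFinset with hS
  have hps := h.perFun_eq he
  have hss : s * s = 1 := Subtype.ext (Equiv.ext fun j => h.apply_apply j)
  have hmem : ∀ w, w ∈ S → w * s ∈ S := by
    intro w hw
    rw [hS, Set.Finite.mem_toFinset] at hw ⊢
    intro k
    change l.1.1 (w.1 (s.1 k)) = _
    rw [hw, ← PerFun.comp_apply, hps]
  have hap : s.1 m = m + 1 := h.apply_left m (by simp)
  have hap' : s.1 (m + 1) = m := by simpa using h.apply_right (m + 1) (by simp)
  -- From each pair `{u, u s}` the shorter element is chosen, the one that keeps `m` and `m + 1` in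
  -- order.
  have key : cosetSum l.1 p =
      (∑ w ∈ S.filter (fun w => w.1 m < w.1 (m + 1)), heckeT w) * (1 + heckeT s) := by
    unfold cosetSum
    rw [← hS, ← Finset.sum_filter_add_sum_filter_not S (fun w => w.1 m < w.1 (m + 1)), mul_add,
      mul_one]
    congr 1
    rw [Finset.sum_mul]
    symm
    refine Finset.sum_bij (fun u _ => u * s) ?_ ?_ ?_ ?_
    · intro u hu
      rw [Finset.mem_filter] at hu ⊢
      refine ⟨hmem u hu.1, ?_⟩
      change ¬ (u.1 (s.1 m) < u.1 (s.1 (m + 1)))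
      rw [hap, hap']
      exact not_lt.2 hu.2.le
    · intro u _ u' _ h'
      exact mul_right_cancel h'
    · intro x hx
      rw [Finset.mem_filter] at hx
      refine ⟨x * s, ?_, by rw [mul_assoc, hss, mul_one]⟩
      rw [Finset.mem_filter]
      refine ⟨hmem x hx.1, ?_⟩
      change x.1 (s.1 m) < x.1 (s.1 (m + 1))
      rw [hap, hap']
      refine lt_of_le_of_ne (not_lt.1 hx.2) fun e => ?_
      have := x.1.injective e
      omega
    · intro u hu
      rw [Finset.mem_filter] at hu
      refine heckeT_mul u s (length_mul_of_inversions u s fun a b hab hw => ?_)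
      obtain ⟨h1, rfl⟩ := (h.apply_lt_iff hab).1 hw
      rw [h.apply_left a h1, h.apply_right (a + 1) (by convert h1 using 1; ring)]
      obtain ⟨t, ht⟩ := h1
      have h3 := per_add_mul u.2 m t
      have h4 := per_add_mul u.2 (m + 1) t
      rw [show a + 1 - 1 = m + D * t by linarith, show a + 1 = m + 1 + D * t by linarith, h3, h4]
      linarith [hu.2]
  rw [key, mul_assoc, add_one_mul_heckeT h.isSimpleReflection, mul_smul_comm]

/-! Left multiples of the generators. -/

/-- Minimal representatives for the left cosets of the stabilizer of `m`, obtained from the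
representatives of `exists_sorted` by inversion. -/
theorem exists_factor (m : Dom D n) (x : affSym D) : ∃ w u : affSym D, x = w * u ∧
    u ∈ coset m.1 m.1 ∧ ∀ a b : ℤ, a < b → m.1.1 a = m.1.1 b → w.1 a < w.1 b := by
  obtain ⟨w, hw, hs⟩ := exists_sorted m (m.1.comp x⁻¹) ⟨x⁻¹, mem_coset.2 rfl⟩
  refine ⟨w⁻¹, w * x, by simp, ?_, ?_⟩
  · intro k
    have := hw (x.1 k)
    rw [PerFun.comp_apply, inv_apply_eq_symm] at this
    simpa using this
  · intro a b hab he
    rw [inv_apply_eq_symm, inv_apply_eq_symm]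
    by_contra hcon
    have hne : w.1.symm b ≠ w.1.symm a := fun e => hab.ne' (w.1.symm.injective e)
    have := hs _ _ (lt_of_le_of_ne (not_lt.1 hcon) hne) (by
      rw [← hw, ← hw]; simp [he])
    simp at this
    omega

/-- The quotient `w'⁻¹ * w` stabilizes `m` and increases on the level sets of `m`, hence is strictly
increasing on all of `ℤ`. An increasing bijection of `ℤ` is a translation, and one that stabilizes a
dominant function keeps the place where its values become positive, so it is the identity. -/
theorem sorted_factor_unique (m : Dom D n) {w w' u u' : affSym D} (e : w * u = w' * u')
    (hu : u ∈ coset m.1 m.1) (hu' : u' ∈ coset m.1 m.1)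
    (hw : ∀ a b : ℤ, a < b → m.1.1 a = m.1.1 b → w.1 a < w.1 b)
    (hw' : ∀ a b : ℤ, a < b → m.1.1 a = m.1.1 b → w'.1 a < w'.1 b) : w = w' := by
  have aux : ∀ z : affSym D, z ∈ coset m.1 m.1 →
      (∀ a b : ℤ, a < b → m.1.1 a = m.1.1 b → z.1 a < z.1 b) → z = 1 := by
    intro z hz hm
    have hmono : StrictMono z.1 := by
      intro a b hab
      rcases (dom_monotone m hab.le).lt_or_eq with h | h
      · by_contra hcon
        have h1 := dom_monotone m (not_lt.1 hcon)
        have h2 := hz a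
        have h3 := hz b
        linarith
      · exact hm a b hab h
    have hz0 : ∀ k, (z.1 k ≤ 0 ↔ k ≤ 0) := by
      intro k
      rw [← m.apply_zero_lt, hz, m.apply_zero_lt]
    have hsucc : ∀ k, z.1 (k + 1) = z.1 k + 1 := by
      intro k
      refine le_antisymm ?_ (hmono (lt_add_one k))
      by_contra hcon
      have hc := not_le.1 hcon
      obtain ⟨y, hy⟩ := z.1.surjective (z.1 k + 1)
      have h1 : k < y := hmono.lt_iff_lt.1 (by rw [hy]; omega)
      have h2 : y < k + 1 := hmono.lt_iff_lt.1 (by rw [hy]; omega)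
      omega
    have h0 : z.1 0 = 0 := by
      have h1 := (hz0 0).2 le_rfl
      have h2 : ¬ z.1 (0 + 1) ≤ 0 := by rw [hz0]; omega
      rw [hsucc] at h2
      omega
    apply Subtype.ext
    apply Equiv.ext
    intro k
    change z.1 k = k
    induction k using Int.induction_on with
    | zero => exact h0
    | succ i ih => rw [hsucc, ih]
    | pred i ih =>
      have := hsucc (-(i : ℤ) - 1)
      rw [sub_add_cancel, ih] at this
      omega
  have e1 : w'⁻¹ * w = u' * u⁻¹ := by
    rw [inv_mul_eq_iff_eq_mul, ← mul_assoc, ← e]; simp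
  have hc : w'⁻¹ * w ∈ coset m.1 m.1 := by
    rw [e1]
    intro k
    change m.1.1 (u'.1 (u.1.symm k)) = _
    rw [hu', ← hu]; simp
  have := aux _ hc fun a b hab he => by
    by_contra hcon
    have hne : (w'⁻¹ * w).1 b ≠ (w'⁻¹ * w).1 a :=
      fun e => hab.ne' ((w'⁻¹ * w).1.injective e)
    have h1 := hw' _ _ (lt_of_le_of_ne (not_lt.1 hcon) hne) (by rw [hc, hc, he])
    have h2 : ∀ k, w'.1 ((w'⁻¹ * w).1 k) = w.1 k := by
      intro k
      change w'.1 (w'.1.symm (w.1 k)) = _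
      simp
    rw [h2, h2] at h1
    exact absurd (hw a b hab he) (not_lt.2 h1.le)
  rw [inv_mul_eq_one] at this
  exact this.symm

/-- The left factor `X` is the sum of `T_w` over the minimal representatives in `Y`. Its existence
is what turns a prescribed value at `T_m` into an endomorphism. -/
theorem exists_mul_cosetSum (m : Dom D n) (Y : Finset (affSym D))
    (hY : ∀ w ∈ Y, ∀ u ∈ coset m.1 m.1, w * u ∈ Y) :
    ∃ X : Hecke D, X * cosetSum m.1 m.1 = ∑ w ∈ Y, heckeT w := by
  classical
  refine ⟨∑ w ∈ Y.filter (fun w => ∀ a b : ℤ, a < b → m.1.1 a = m.1.1 b → w.1 a < w.1 b),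
    heckeT w, ?_⟩
  unfold cosetSum
  rw [Finset.sum_mul_sum, ← Finset.sum_product']
  refine Finset.sum_bij (fun x _ => x.1 * x.2) ?_ ?_ ?_ ?_
  · rintro ⟨w, u⟩ h
    simp only [Finset.mem_product, Finset.mem_filter, Set.Finite.mem_toFinset] at h
    exact hY w h.1.1 u h.2
  · rintro ⟨w, u⟩ h ⟨w', u'⟩ h' e
    simp only [Finset.mem_product, Finset.mem_filter, Set.Finite.mem_toFinset] at h h'
    have := sorted_factor_unique m e h.2 h'.2 h.1.2 h'.1.2
    subst this
    exact Prod.ext rfl (mul_left_cancel e)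
  · intro x hx
    obtain ⟨w, u, rfl, hu, hw⟩ := exists_factor m x
    refine ⟨(w, u), ?_, rfl⟩
    simp only [Finset.mem_product, Finset.mem_filter, Set.Finite.mem_toFinset]
    refine ⟨⟨?_, hw⟩, hu⟩
    have := hY _ hx u⁻¹ (fun k => by rw [← hu, inv_apply_eq_symm]; simp)
    simpa using this
  · rintro ⟨w, u⟩ h
    simp only [Finset.mem_product, Finset.mem_filter, Set.Finite.mem_toFinset] at h
    -- Since `u` stabilizes the monotone `m`, any pair it inverts lies in one level set, and there
    -- `w` keeps the order.
    refine heckeT_mul w u (length_mul_of_inversions w u fun a b hab hu => ?_)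
    refine h.1.2 _ _ hu (le_antisymm (dom_monotone m hu.le) ?_)
    rw [h.2, h.2]
    exact dom_monotone m hab.le

end hecke

/-! ### Endomorphisms of the tensor module -/

section schur
variable {D n : ℕ} [NeZero D] [NeZero n]

theorem TMod.ext {x y : TMod D n} (h : ∀ l, ((x l : _) : Hecke D) = y l) : x = y :=
  funext fun l => Subtype.ext (h l)

@[simp] theorem TMod.smul_apply (a : BaseA) (x : TMod D n) (l : Dom D n) :
    (((a • x) l : _) : Hecke D) = a • (x l : Hecke D) := rfl

@[simp] theorem Tvec_apply (p : PerFun D n) (l : Dom D n) :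
    ((Tvec p l : _) : Hecke D) = cosetSum l.1 p := rfl

theorem Tvec_dom [DecidableEq (Dom D n)] (m : Dom D n) :
    Tvec m.1 = Pi.single m
      (⟨cosetSum m.1 m.1, Submodule.mem_span_singleton_self _⟩ :
        Submodule.span (Hecke D)ᵐᵒᵖ {cosetSum m.1 m.1}) := by
  apply TMod.ext
  intro l
  rw [Tvec_apply]
  by_cases h : l = m
  · subst h; rw [Pi.single_eq_same]
  · rw [Pi.single_eq_of_ne h, cosetSum_dom_ne l m h]; rfl

/-- Each summand of `T_D` is the cyclic right module generated by its `T_m`. -/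
theorem schur_ext {S S' : Schur D n} (h : ∀ m : Dom D n, S (Tvec m.1) = S' (Tvec m.1)) :
    S = S' := by
  classical
  refine LinearMap.pi_ext fun m x => ?_
  obtain ⟨a, ha⟩ := Submodule.mem_span_singleton.1 x.2
  have : Pi.single m x = a • (Tvec m.1 : TMod D n) := by
    rw [Tvec_dom, ← Pi.single_smul]
    congr 1
    exact Subtype.ext ha.symm
  rw [this, map_smul, map_smul, h]

/-- Left multiplication by `X`, as a map between right ideals. -/
noncomputable def leftMul (X : Hecke D) (m l : Dom D n)
    (h : X * cosetSum m.1 m.1 ∈ Submodule.span (Hecke D)ᵐᵒᵖ {cosetSum l.1 l.1}) :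
    Submodule.span (Hecke D)ᵐᵒᵖ {cosetSum m.1 m.1} →ₗ[(Hecke D)ᵐᵒᵖ]
      Submodule.span (Hecke D)ᵐᵒᵖ {cosetSum l.1 l.1} where
  toFun x := ⟨X * x.1, by
    obtain ⟨a, ha⟩ := Submodule.mem_span_singleton.1 x.2
    rw [← ha]
    have : X * (a • cosetSum m.1 m.1) = a • (X * cosetSum m.1 m.1) := by
      change X * (cosetSum m.1 m.1 * a.unop) = X * cosetSum m.1 m.1 * a.unop
      rw [mul_assoc]
    rw [this]
    exact Submodule.smul_mem _ _ h⟩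
  map_add' x y := Subtype.ext (mul_add X x.1 y.1)
  map_smul' a x := Subtype.ext (mul_assoc X x.1 a.unop).symm

/-- Left multiplications commute with the right action and, by hypothesis, send `T_m` into the
required right ideals. They are assembled componentwise into an endomorphism with prescribed values.
-/
theorem exists_schur (y : Dom D n → TMod D n)
    (h : ∀ m l : Dom D n, ∃ X : Hecke D, X * cosetSum m.1 m.1 = (y m l : Hecke D)) :
    ∃ S : Schur D n, ∀ m : Dom D n, S (Tvec m.1) = y m := by
  classical
  have := Fintype.ofFinite (Dom D n)
  choose X hX using h
  have hmem : ∀ m l : Dom D n,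
      X m l * cosetSum m.1 m.1 ∈ Submodule.span (Hecke D)ᵐᵒᵖ {cosetSum l.1 l.1} := by
    intro m l
    rw [hX]
    exact (y m l).2
  refine ⟨LinearMap.pi fun l => ∑ m, (leftMul (X m l) m l (hmem m l)).comp (LinearMap.proj m), ?_⟩
  intro m
  apply TMod.ext
  intro l
  rw [LinearMap.pi_apply, LinearMap.sum_apply, Finset.sum_eq_single m]
  · exact hX m l
  · intro m' _ hne
    rw [LinearMap.comp_apply, LinearMap.proj_apply, Tvec_dom, Pi.single_eq_of_ne hne, map_zero]
  · intro h; exact absurd (Finset.mem_univ _) h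

theorem Tvec_mul_heckeT (p : PerFun D n) (w : affSym D)
    (h : ∀ a b : ℤ, a < b → w.1 b < w.1 a → p.1 (w.1 b) < p.1 (w.1 a)) :
    MulOpposite.op (heckeT w) • Tvec p = Tvec (p.comp w) :=
  TMod.ext fun l => cosetSum_mul_heckeT l p w h

theorem Tvec_mul_heckeT_of_eq (p : PerFun D n) {s : affSym D} {m : ℤ}
    (h : IsSwap s m) (he : p.1 m = p.1 (m + 1)) :
    MulOpposite.op (heckeT s) • Tvec p = (LaurentPolynomial.T (-2) : BaseA) • Tvec p :=
  TMod.ext fun l => cosetSum_mul_heckeT_of_eq l p h he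

/-- The action of a diagonal function of the weight: the component at `l` is multiplied by
`c (♯l)`. -/
noncomputable def weightOp (c : (ZMod n → ℤ) → BaseA) : Schur D n :=
  LinearMap.pi fun l => c (sharp l.1) • LinearMap.proj l

/-- A nonzero component of `T_p` lies over some `l` in its orbit, and `♯` is constant on orbits. -/
theorem weightOp_Tvec (c : (ZMod n → ℤ) → BaseA) (p : PerFun D n) :
    weightOp c (Tvec p) = c (sharp p) • Tvec p := by
  apply TMod.ext
  intro l
  change c (sharp l.1) • cosetSum l.1 p = c (sharp p) • cosetSum l.1 p
  by_cases h : (coset l.1 p).Nonempty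
  · rw [sharp_eq_of_coset h]
  · rw [cosetSum_eq_zero h, smul_zero, smul_zero]

/-- The normalized element `v ^ x_p T_p` of `T_D`. -/
noncomputable def normVec (p : PerFun D n) : TMod D n :=
  (LaurentPolynomial.T (xdim p : ℤ) : BaseA) • Tvec p

theorem weightOp_normVec (c : (ZMod n → ℤ) → BaseA) (p : PerFun D n) :
    weightOp c (normVec p) = c (sharp p) • normVec p := by
  unfold normVec
  have : ∀ (S : Schur D n) (a : BaseA) (x : TMod D n), S (a • x) = a • S x := by
    intro S a x
    exact LinearMap.map_smul_of_tower S a x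
  rw [this, weightOp_Tvec, smul_comm]

end schur

/-- The number of classes of a periodic relation, counted in a transversal of the translations
by `D`, does not depend on the transversal. -/
theorem ncard_transversal {D : ℕ} {R : ℤ → ℤ → Prop} {f g : ℤ → ℤ → ℤ}
    (hR : ∀ a b q : ℤ, R (a + D * q) (b + D * q) ↔ R a b)
    (hf : ∀ a b q : ℤ, f (a + D * q) (b + D * q) = f a b + q)
    (hg : ∀ a b q : ℤ, g (a + D * q) (b + D * q) = g a b + q) :
    {x : ℤ × ℤ | R x.1 x.2 ∧ f x.1 x.2 = 0}.ncard =
      {x : ℤ × ℤ | R x.1 x.2 ∧ g x.1 x.2 = 0}.ncard := by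
  -- The functions `f` and `g` record the period in which a pair lies, so `f = 0` and `g = 0` each
  -- select one pair per class. A pair is translated to where `g` vanishes; the value of `f` there
  -- recovers the translation.
  refine Set.ncard_congr
    (fun x _ => (x.1 + D * (-g x.1 x.2), x.2 + D * (-g x.1 x.2))) ?_ ?_ ?_
  · rintro ⟨a, b⟩ ⟨h1, h2⟩
    exact ⟨(hR _ _ _).2 h1, by simp only [hg]; ring⟩
  · rintro ⟨a, b⟩ ⟨a', b'⟩ ⟨-, h1⟩ ⟨-, h2⟩ e
    simp only [Prod.mk.injEq] at e h1 h2
    have e1 := hf a b (-g a b)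
    have e2 := hf a' b' (-g a' b')
    rw [e.1, e.2, e2, h1, h2] at e1
    have : g a b = g a' b' := by linarith
    rw [this] at e
    exact Prod.ext (by linarith [e.1]) (by linarith [e.2])
  · rintro ⟨a, b⟩ ⟨h1, h2⟩
    refine ⟨(a + D * (-f a b), b + D * (-f a b)), ⟨(hR _ _ _).2 h1, by simp only [hf]; ring⟩, ?_⟩
    simp only at h2
    simp only [hg, h2]
    ext <;> simp

/-! ### The statistic `x_p` under swaps and shifts -/

section xdim
variable {D n : ℕ} [NeZero D] [NeZero n]

theorem finite_setOf_gt_ge (p : PerFun D n) (k c : ℤ) : {a : ℤ | a < k ∧ c ≤ p.1 a}.Finite := by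
  -- Rotating the graph by a half turn exchanges the two kinds of bounded regions.
  let r : PerFun D n := ⟨fun j => -p.1 (-j), fun j => by
    have := p.2 (-(j + D))
    rw [show -(j + (D : ℤ)) + D = -j by ring] at this
    linarith⟩
  have := (finite_setOf_lt_le r (-k) (-c)).image fun j => -j
  refine this.subset ?_
  rintro a ⟨h1, h2⟩
  refine ⟨-a, ⟨by linarith, ?_⟩, by simp⟩
  change -p.1 (- -a) ≤ -c
  rw [neg_neg]; linarith

theorem ediv_eq_zero_iff_mem {a m : ℤ} (hm : 0 < m) : (a - 1) / m = 0 ↔ 1 ≤ a ∧ a ≤ m := by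
  constructor
  · intro h
    have h1 := Int.emod_nonneg (a - 1) hm.ne'
    have h2 := Int.emod_lt_of_pos (a - 1) hm
    have h3 := Int.emod_add_mul_ediv (a - 1) m
    rw [h, mul_zero] at h3
    omega
  · rintro ⟨h1, h2⟩
    exact Int.ediv_eq_zero_of_lt (by omega) (by omega)

/-- The condition on the value at the first point becomes the vanishing of an integer that grows by
one per period, the form used by `ncard_transversal`. -/
theorem xdim_eq (p : PerFun D n) :
    xdim p = {x : ℤ × ℤ | (x.1 < x.2 ∧ p.1 x.2 ≤ p.1 x.1) ∧ (p.1 x.1 - 1) / n = 0}.ncard := by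
  unfold xdim
  congr 1
  ext x
  simp only [Set.mem_ofPred_eq, ediv_eq_zero_iff_mem (natCast_pos_of_neZero n)]
  exact and_comm

theorem finite_xdim (p : PerFun D n) :
    {x : ℤ × ℤ | (x.1 < x.2 ∧ p.1 x.2 ≤ p.1 x.1) ∧ (p.1 x.1 - 1) / n = 0}.Finite := by
  have h : (⋃ c ∈ Finset.Icc (1 : ℤ) n, ⋃ a ∈ fiber p c,
      (Prod.mk a) '' {b | a < b ∧ p.1 b ≤ c}).Finite :=
    Set.Finite.biUnion (Finset.finite_toSet _) fun c _ =>
      Set.Finite.biUnion (Finset.finite_toSet _) fun a _ => (finite_setOf_lt_le p a c).image _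
  refine h.subset ?_
  rintro ⟨a, b⟩ ⟨⟨h1, h2⟩, h3⟩
  rw [ediv_eq_zero_iff_mem (natCast_pos_of_neZero n)] at h3
  simp only [Set.mem_iUnion]
  exact ⟨p.1 a, Finset.mem_Icc.2 h3, a, by simp, b, ⟨h1, h2⟩, rfl⟩

theorem fun_add_mul_ediv (p : PerFun D n) (a q : ℤ) :
    (p.1 (a + D * q) - 1) / n = (p.1 a - 1) / n + q := by
  rw [p.add_mul, show p.1 a + n * q - 1 = p.1 a - 1 + n * q by ring,
    Int.add_mul_ediv_left _ _ (natCast_pos_of_neZero n).ne']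

theorem sub_add_mul_ediv (c a q : ℤ) : (a + D * q - c) / D = (a - c) / D + q := by
  rw [show a + D * q - c = a - c + D * q by ring,
    Int.add_mul_ediv_left _ _ (natCast_pos_of_neZero D).ne']

theorem dvd_add_mul_sub {a c q : ℤ} : (D : ℤ) ∣ a + D * q - c ↔ (D : ℤ) ∣ a - c := by
  rw [show a + D * q - c = a - c + D * q by ring]
  exact dvd_add_left (Dvd.intro _ rfl)

theorem eq_of_dvd_of_ediv {a c : ℤ} (h : (D : ℤ) ∣ a - c) (h0 : (a - c) / D = 0) : a = c := by
  have := Int.ediv_mul_cancel h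
  rw [h0] at this
  linarith

/-- Applying `s` to both entries carries the pairs counted for `p ∘ s` to those counted for `p`,
together with the translates of the single pair `(m + 1, m)`, whose order `s` reverses. -/
theorem xdim_comp_swap (p : PerFun D n) {s : affSym D} {m : ℤ} (h : IsSwap s m)
    (hlt : p.1 m < p.1 (m + 1)) : xdim (p.comp s) = xdim p + 1 := by
  have e1 : xdim (p.comp s) = ({x : ℤ × ℤ | (x.1 < x.2 ∧ p.1 x.2 ≤ p.1 x.1) ∧
      (p.1 x.1 - 1) / n = 0} ∪ {x : ℤ × ℤ | ((D : ℤ) ∣ x.2 - m ∧ x.1 = x.2 + 1) ∧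
      (p.1 x.1 - 1) / n = 0}).ncard := by
    rw [xdim_eq]
    refine Set.ncard_congr (fun x _ => (s.1 x.1, s.1 x.2)) ?_ ?_ ?_
    · rintro ⟨a, b⟩ ⟨⟨h1, h2⟩, h3⟩
      simp only [PerFun.comp_apply] at h1 h2 h3
      by_cases hab : s.1 a < s.1 b
      · exact Or.inl ⟨⟨hab, h2⟩, h3⟩
      · right
        refine ⟨?_, h3⟩
        have := (h.apply_lt_iff h1).1 (lt_of_le_of_ne (not_lt.1 hab)
          fun e => h1.ne' (s.1.injective e))
        obtain ⟨c1, rfl⟩ := this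
        have c2 : (D : ℤ) ∣ a + 1 - (m + 1) := by convert c1 using 1; ring
        simp only [h.apply_left a c1, h.apply_right _ c2]
        refine ⟨?_, by ring⟩
        convert c1 using 1; ring
    · rintro ⟨a, b⟩ ⟨a', b'⟩ _ _ e
      simp only [Prod.mk.injEq] at e
      exact Prod.ext (s.1.injective e.1) (s.1.injective e.2)
    · rintro ⟨a, b⟩ hx
      refine ⟨(s.1 a, s.1 b), ?_, by simp only [h.apply_apply]⟩
      simp only [Set.mem_ofPred_eq, PerFun.comp_apply, h.apply_apply]
      rcases hx with ⟨⟨h1, h2⟩, h3⟩ | ⟨⟨h1, h2⟩, h3⟩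
      · simp only at h1 h2 h3
        refine ⟨⟨?_, h2⟩, h3⟩
        rw [h.apply_lt_apply_iff]
        left
        refine ⟨h1, ?_⟩
        rintro ⟨c1, rfl⟩
        obtain ⟨t, rfl, -⟩ := p.eq_add_of_dvd c1
        rw [show m + D * t + 1 = m + 1 + D * t by ring, p.add_mul, p.add_mul] at h2
        linarith
      · simp only at h1 h2 h3
        refine ⟨⟨?_, ?_⟩, h3⟩
        · rw [h.apply_lt_apply_iff]
          exact Or.inr ⟨h1, h2⟩
        · rw [h2]
          obtain ⟨t, rfl, -⟩ := p.eq_add_of_dvd h1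
          rw [show m + D * t + 1 = m + 1 + D * t by ring, p.add_mul, p.add_mul]
          linarith
  -- The extra pairs form one class modulo translation; normalizing the second entry to `m`, instead
  -- of the value at the first entry, leaves exactly one.
  have e2 : {x : ℤ × ℤ | ((D : ℤ) ∣ x.2 - m ∧ x.1 = x.2 + 1) ∧ (p.1 x.1 - 1) / n = 0}.ncard
      = 1 := by
    rw [ncard_transversal (D := D) (R := fun a b => (D : ℤ) ∣ b - m ∧ a = b + 1)
      (f := fun a _ => (p.1 a - 1) / n) (g := fun _ b => (b - m) / D)]
    · rw [Set.ncard_eq_one]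
      refine ⟨(m + 1, m), ?_⟩
      ext ⟨a, b⟩
      simp only [Set.mem_ofPred_eq, Set.mem_singleton_iff, Prod.mk.injEq]
      constructor
      · rintro ⟨⟨c1, rfl⟩, c2⟩
        have := eq_of_dvd_of_ediv c1 c2
        omega
      · rintro ⟨rfl, rfl⟩
        simp
    · intro a b q
      rw [dvd_add_mul_sub]
      constructor <;> rintro ⟨c1, c2⟩ <;> exact ⟨c1, by linarith⟩
    · intro a b q; exact fun_add_mul_ediv p a q
    · intro a b q; exact sub_add_mul_ediv m b q
  have hf2 := Set.finite_of_ncard_ne_zero (by rw [e2]; exact one_ne_zero)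
  rw [e1, Set.ncard_union_eq _ (finite_xdim p) hf2, e2, xdim_eq]
  rw [Set.disjoint_left]
  rintro ⟨a, b⟩ ⟨⟨h1, -⟩, -⟩ ⟨⟨-, h2⟩, -⟩
  simp only at h1 h2
  omega

/-- The pairs that contribute to `x_p`, sorted by their position relative to the class of `k`. -/
theorem xdim_split (p : PerFun D n) (k : ℤ) :
    xdim p = {x : ℤ × ℤ | (¬ (D : ℤ) ∣ x.1 - k ∧ ¬ (D : ℤ) ∣ x.2 - k) ∧
        (x.1 < x.2 ∧ p.1 x.2 ≤ p.1 x.1) ∧ (p.1 x.1 - 1) / n = 0}.ncard +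
      {b : ℤ | k < b ∧ p.1 b ≤ p.1 k}.ncard + {a : ℤ | a < k ∧ p.1 k ≤ p.1 a}.ncard := by
  have hn := natCast_pos_of_neZero n
  have hD := natCast_pos_of_neZero D
  have hper : ∀ a b q : ℤ, (a + D * q < b + D * q ∧ p.1 (b + D * q) ≤ p.1 (a + D * q)) ↔
      (a < b ∧ p.1 b ≤ p.1 a) := by
    intro a b q
    rw [p.add_mul, p.add_mul]
    simp
  have e2 : {x : ℤ × ℤ | ((D : ℤ) ∣ x.1 - k ∧ x.1 < x.2 ∧ p.1 x.2 ≤ p.1 x.1) ∧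
      (p.1 x.1 - 1) / n = 0}.ncard = {b : ℤ | k < b ∧ p.1 b ≤ p.1 k}.ncard := by
    rw [ncard_transversal (D := D) (R := fun a b => (D : ℤ) ∣ a - k ∧ a < b ∧ p.1 b ≤ p.1 a)
      (f := fun a _ => (p.1 a - 1) / n) (g := fun a _ => (a - k) / D)]
    · refine Set.ncard_congr (fun x _ => x.2) ?_ ?_ ?_
      · rintro ⟨a, b⟩ ⟨⟨h1, h2⟩, h3⟩
        have := eq_of_dvd_of_ediv h1 h3
        simp only at this
        subst this
        exact h2
      · rintro ⟨a, b⟩ ⟨a', b'⟩ ⟨⟨h1, -⟩, h3⟩ ⟨⟨h1', -⟩, h3'⟩ e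
        have e1 := eq_of_dvd_of_ediv h1 h3
        have e2 := eq_of_dvd_of_ediv h1' h3'
        simp only at e e1 e2
        rw [e, e1, e2]
      · intro b hb
        exact ⟨(k, b), ⟨⟨by simp, hb⟩, by simp⟩, rfl⟩
    · intro a b q
      rw [dvd_add_mul_sub, hper]
    · intro a b q; exact fun_add_mul_ediv p a q
    · intro a b q; exact sub_add_mul_ediv k a q
  have e3 : {x : ℤ × ℤ | ((D : ℤ) ∣ x.2 - k ∧ x.1 < x.2 ∧ p.1 x.2 ≤ p.1 x.1) ∧
      (p.1 x.1 - 1) / n = 0}.ncard = {a : ℤ | a < k ∧ p.1 k ≤ p.1 a}.ncard := by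
    rw [ncard_transversal (D := D) (R := fun a b => (D : ℤ) ∣ b - k ∧ a < b ∧ p.1 b ≤ p.1 a)
      (f := fun a _ => (p.1 a - 1) / n) (g := fun _ b => (b - k) / D)]
    · refine Set.ncard_congr (fun x _ => x.1) ?_ ?_ ?_
      · rintro ⟨a, b⟩ ⟨⟨h1, h2⟩, h3⟩
        have := eq_of_dvd_of_ediv h1 h3
        simp only at this
        subst this
        exact h2
      · rintro ⟨a, b⟩ ⟨a', b'⟩ ⟨⟨h1, -⟩, h3⟩ ⟨⟨h1', -⟩, h3'⟩ e
        have e1 := eq_of_dvd_of_ediv h1 h3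
        have e2 := eq_of_dvd_of_ediv h1' h3'
        simp only at e e1 e2
        rw [e, e1, e2]
      · intro a ha
        exact ⟨(a, k), ⟨⟨by simp, ha⟩, by simp⟩, rfl⟩
    · intro a b q
      rw [dvd_add_mul_sub, hper]
    · intro a b q; exact fun_add_mul_ediv p a q
    · intro a b q; exact sub_add_mul_ediv k b q
  have hfin := finite_xdim p
  rw [← e2, ← e3, xdim_eq, ← Set.ncard_union_eq ?_ (hfin.subset fun x hx => hx.2)
    (hfin.subset fun x hx => ⟨hx.1.2, hx.2⟩), ← Set.ncard_union_eq ?_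
    ((hfin.subset fun x hx => hx.2).union (hfin.subset fun x hx => ⟨hx.1.2, hx.2⟩))
    (hfin.subset fun x hx => ⟨hx.1.2, hx.2⟩)]
  · congr 1
    ext ⟨a, b⟩
    simp only [Set.mem_union, Set.mem_ofPred_eq]
    tauto
  · rw [Set.disjoint_left]
    rintro ⟨a, b⟩ (⟨⟨h1, h2⟩, -⟩ | ⟨⟨h1, h3, h4⟩, -⟩) ⟨⟨h2', -⟩, -⟩
    · exact h2 h2'
    · simp only at h1 h2' h3 h4
      -- Two points of one class never contribute: a later translate has a strictly larger value.
      have h5 : (D : ℤ) ∣ b - a := by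
        have := dvd_sub h2' h1
        rwa [show b - k - (a - k) = b - a by ring] at this
      obtain ⟨t, rfl, h6⟩ := p.eq_add_of_dvd h5
      have h7 : (0 : ℤ) < D * t := by linarith
      have h8 : 0 < t := by
        by_contra hc
        have := mul_nonpos_of_nonneg_of_nonpos hD.le (not_lt.1 hc)
        linarith
      have := mul_pos hn h8
      linarith
  · rw [Set.disjoint_left]
    rintro x ⟨⟨h1, -⟩, -⟩ ⟨⟨h2, -⟩, -⟩
    exact h1 h2

theorem shift_apply (p : PerFun D n) (k c l : ℤ) :
    (shift p k c).1 l = p.1 l + if (D : ℤ) ∣ l - k then c else 0 := rfl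

theorem shift_apply_of_dvd (p : PerFun D n) {k l : ℤ} (c : ℤ) (h : (D : ℤ) ∣ l - k) :
    (shift p k c).1 l = p.1 l + c := by
  rw [shift_apply, if_pos h]

theorem shift_apply_of_not_dvd (p : PerFun D n) {k l : ℤ} (c : ℤ) (h : ¬ (D : ℤ) ∣ l - k) :
    (shift p k c).1 l = p.1 l := by
  rw [shift_apply, if_neg h, add_zero]

theorem shift_apply_self (p : PerFun D n) (k c : ℤ) : (shift p k c).1 k = p.1 k + c :=
  shift_apply_of_dvd p c (by simp)

theorem shift_shift (p : PerFun D n) (k c d : ℤ) :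
    shift (shift p k c) k d = shift p k (c + d) := by
  apply PerFun.ext
  intro l
  simp only [shift_apply]
  split_ifs <;> ring

theorem shift_zero (p : PerFun D n) (k : ℤ) : shift p k 0 = p := by
  apply PerFun.ext
  intro l
  simp only [shift_apply]
  split_ifs <;> ring

theorem shift_comm (p : PerFun D n) (k l c d : ℤ) :
    shift (shift p k c) l d = shift (shift p l d) k c := by
  apply PerFun.ext
  intro j
  simp only [shift_apply]
  ring

/-- Only pairs involving the class of `k` change. With `k` as first point, the later points of value
`p k` are lost; with `k` as second point, the earlier points of value `p k - 1` are gained.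
Translates of `k` do not interfere, since their values differ from `p k` by multiples of `n ≥ 2`. -/
theorem xdim_shift_neg (hn : 2 ≤ n) (p : PerFun D n) (k : ℤ) :
    xdim (shift p k (-1)) + ((fiber p (p.1 k)).filter fun l => k < l).card =
      xdim p + ((fiber p (p.1 k - 1)).filter fun l => l < k).card := by
  have hD := natCast_pos_of_neZero D
  have hn' : (2 : ℤ) ≤ n := by exact_mod_cast hn
  set q := shift p k (-1) with hq
  have hqk : q.1 k = p.1 k - 1 := shift_apply_self p k (-1)
  have hcl : ∀ l : ℤ, (D : ℤ) ∣ l - k → ∃ t, l = k + D * t ∧ p.1 l = p.1 k + n * t ∧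
      q.1 l = p.1 k - 1 + n * t := by
    intro l h
    obtain ⟨t, h1, h2⟩ := p.eq_add_of_dvd h
    refine ⟨t, h1, h2, ?_⟩
    rw [hq, shift_apply_of_dvd p _ h, h2]; ring
  have hncl : ∀ l : ℤ, ¬ (D : ℤ) ∣ l - k → q.1 l = p.1 l := fun l h =>
    shift_apply_of_not_dvd p _ h
  have hpos : ∀ t : ℤ, k < k + D * t ↔ 0 < t := by
    intro t
    rw [lt_add_iff_pos_right, mul_pos_iff_of_pos_left hD]
  have hneg : ∀ t : ℤ, k + D * t < k ↔ t < 0 := by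
    intro t
    rw [add_lt_iff_neg_left]
    exact ⟨fun h => by by_contra hc; nlinarith, fun h => mul_neg_of_pos_of_neg hD h⟩
  have s2 : {b : ℤ | k < b ∧ q.1 b ≤ q.1 k}.ncard +
      ((fiber p (p.1 k)).filter fun l => k < l).card = {b : ℤ | k < b ∧ p.1 b ≤ p.1 k}.ncard := by
    rw [← Set.ncard_coe_finset, ← Set.ncard_union_eq _ (finite_setOf_lt_le q k _)
      (Finset.finite_toSet _)]
    · congr 1
      ext b
      simp only [Set.mem_union, Set.mem_ofPred_eq, Finset.coe_filter, mem_fiber]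
      by_cases h : (D : ℤ) ∣ b - k
      · obtain ⟨t, rfl, h2, h3⟩ := hcl b h
        rw [hpos, h2, h3, hqk]
        constructor
        · rintro (⟨h4, h5⟩ | ⟨h4, h5⟩) <;> nlinarith
        · rintro ⟨h4, h5⟩; nlinarith
      · rw [hncl b h, hqk]; omega
    · rw [Set.disjoint_left]
      rintro b ⟨h1, h2⟩ hb
      simp only [Finset.coe_filter, mem_fiber, Set.mem_ofPred_eq] at hb
      by_cases h : (D : ℤ) ∣ b - k
      · have := p.eq_of_dvd h hb.1
        omega
      · rw [hncl b h, hqk] at h2; omega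
  have s3 : {a : ℤ | a < k ∧ q.1 k ≤ q.1 a}.ncard = {a : ℤ | a < k ∧ p.1 k ≤ p.1 a}.ncard +
      ((fiber p (p.1 k - 1)).filter fun l => l < k).card := by
    rw [← Set.ncard_coe_finset, ← Set.ncard_union_eq _ (finite_setOf_gt_ge p k _)
      (Finset.finite_toSet _)]
    · congr 1
      ext b
      simp only [Set.mem_union, Set.mem_ofPred_eq, Finset.coe_filter, mem_fiber]
      by_cases h : (D : ℤ) ∣ b - k
      · obtain ⟨t, rfl, h2, h3⟩ := hcl b h
        rw [hneg, h2, h3, hqk]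
        constructor
        · rintro ⟨h4, h5⟩; nlinarith
        · rintro (⟨h4, h5⟩ | ⟨h4, h5⟩) <;> nlinarith
      · rw [hncl b h, hqk]; omega
    · rw [Set.disjoint_left]
      rintro b ⟨h1, h2⟩ hb
      simp only [Finset.coe_filter, mem_fiber, Set.mem_ofPred_eq] at hb
      omega
  have s1 : {x : ℤ × ℤ | (¬ (D : ℤ) ∣ x.1 - k ∧ ¬ (D : ℤ) ∣ x.2 - k) ∧
      (x.1 < x.2 ∧ q.1 x.2 ≤ q.1 x.1) ∧ (q.1 x.1 - 1) / n = 0} =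
      {x : ℤ × ℤ | (¬ (D : ℤ) ∣ x.1 - k ∧ ¬ (D : ℤ) ∣ x.2 - k) ∧
      (x.1 < x.2 ∧ p.1 x.2 ≤ p.1 x.1) ∧ (p.1 x.1 - 1) / n = 0} := by
    ext ⟨a, b⟩
    simp only [Set.mem_ofPred_eq]
    refine and_congr_right fun h => ?_
    rw [hncl a h.1, hncl b h.2]
  rw [xdim_split q k, xdim_split p k, s1, s3, ← s2]
  ring

theorem xdim_shift_pos (hn : 2 ≤ n) (p : PerFun D n) (k : ℤ) :
    xdim (shift p k 1) + ((fiber p (p.1 k)).filter fun l => l < k).card =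
      xdim p + ((fiber p (p.1 k + 1)).filter fun l => k < l).card := by
  have hn' : (2 : ℤ) ≤ n := by exact_mod_cast hn
  have h := xdim_shift_neg hn (shift p k 1) k
  rw [shift_shift, add_neg_cancel, shift_zero, shift_apply_self, add_sub_cancel_right] at h
  -- The lowering formula is applied to the raised function. The fibers involved change only at
  -- points congruent to `k`, and among these only `k` itself has a value close enough to matter;
  -- the strict order condition excludes it.
  have key : ∀ (c : ℤ) (P : ℤ → Prop) [DecidablePred P], (c = p.1 k + 1 ∨ c = p.1 k) → ¬ P k →
      (fiber (shift p k 1) c).filter P = (fiber p c).filter P := by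
    intro c P _ hc hP
    ext l
    simp only [Finset.mem_filter, mem_fiber]
    refine and_congr_left fun hl => ?_
    by_cases hd : (D : ℤ) ∣ l - k
    · have hlk : l ≠ k := fun e => hP (e ▸ hl)
      rw [shift_apply_of_dvd p _ hd]
      obtain ⟨t, rfl, h2⟩ := p.eq_add_of_dvd hd
      rw [h2]
      have ht : t ≠ 0 := by rintro rfl; simp at hlk
      have : (n : ℤ) * t ≤ -2 ∨ 2 ≤ (n : ℤ) * t := by
        rcases lt_or_gt_of_ne ht with h | h
        · left; nlinarith
        · right; nlinarith
      omega
    · rw [shift_apply_of_not_dvd p _ hd]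
  rw [key _ (fun l => k < l) (Or.inl rfl) (lt_irrefl k),
    key _ (fun l => l < k) (Or.inr rfl) (lt_irrefl k)] at h
  omega

end xdim

/-! ### Moving one point: the formulas for the raising and lowering operators -/

section move
variable {D n : ℕ} [NeZero D] [NeZero n]

/-- The exponent of `v` in the coefficient of `[p_k^{-ε}]` in the action of `e_i` (`ε = 1`,
`a = i + 1`) or `f_i` (`ε = -1`, `a = i`) on `[p]`. -/
noncomputable def moveExp (ε : ℤ) (p : PerFun D n) (a k : ℤ) : ℤ :=
  ((fiber p a).filter fun l => ε * k < ε * l).card -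
    ((fiber p (a - ε)).filter fun l => ε * k < ε * l).card

/-- The sum of the `T_{p_k^{-ε}}` over `k ∈ p⁻¹(a)`. -/
noncomputable def moveSum (ε : ℤ) (p : PerFun D n) (a : ℤ) : TMod D n :=
  ∑ k ∈ fiber p a, Tvec (shift p k (-ε))

/-- The sum of the `v ^ c [p_k^{-ε}]` over `k ∈ p⁻¹(a)`, `c` being the exponent `moveExp`. -/
noncomputable def normMove (ε : ℤ) (p : PerFun D n) (a : ℤ) : TMod D n :=
  ∑ k ∈ fiber p a, (LaurentPolynomial.T (moveExp ε p a k) : BaseA) • normVec (shift p k (-ε))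

theorem xdim_shift (hn : 2 ≤ n) {ε : ℤ} (hε : ε = 1 ∨ ε = -1) (p : PerFun D n) {a k : ℤ}
    (hk : p.1 k = a) :
    xdim (shift p k (-ε)) + ((fiber p a).filter fun l => ε * k < ε * l).card =
      xdim p + ((fiber p (a - ε)).filter fun l => ε * l < ε * k).card := by
  subst hk
  rcases hε with rfl | rfl
  · simpa using xdim_shift_neg hn p k
  · simpa using xdim_shift_pos hn p k

/-- For monotone `p` the fiber over `a - ε` lies entirely on one side of `k`. Then `x` of the
shifted function plus the exponent of `v` no longer depends on `k`; this is the source of the scalar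
used to define the operators on the generators. -/
theorem normMove_of_monotone (hn : 2 ≤ n) {ε : ℤ} (hε : ε = 1 ∨ ε = -1) (p : PerFun D n) (a : ℤ)
    (hp : Monotone p.1) :
    normMove ε p a = (LaurentPolynomial.T (xdim p + (fiber p (a - ε)).card : ℤ) : BaseA) •
      moveSum ε p a := by
  unfold normMove moveSum
  rw [Finset.smul_sum]
  refine Finset.sum_congr rfl fun k hk => ?_
  rw [mem_fiber] at hk
  unfold normVec
  rw [smul_smul, ← LaurentPolynomial.T_add]
  congr 2
  have h := xdim_shift hn hε p hk
  have hlt : ∀ l, p.1 l = a - ε → ε * l < ε * k := by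
    intro l hl
    rcases hε with rfl | rfl
    · by_contra hc
      have := hp (show k ≤ l by linarith)
      linarith
    · by_contra hc
      have := hp (show l ≤ k by linarith)
      linarith
  have h1 : ((fiber p (a - ε)).filter fun l => ε * k < ε * l) = ∅ := by
    apply Finset.filter_false_of_mem
    intro l hl
    exact not_lt.2 (hlt l (mem_fiber.1 hl)).le
  have h2 : ((fiber p (a - ε)).filter fun l => ε * l < ε * k) = fiber p (a - ε) :=
    Finset.filter_true_of_mem fun l hl => hlt l (mem_fiber.1 hl)
  rw [h2] at h
  unfold moveExp
  rw [h1, Finset.card_empty]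
  push_cast
  have : ((xdim (shift p k (-ε)) + ((fiber p a).filter fun l => ε * k < ε * l).card : ℕ) : ℤ) =
    (xdim p + (fiber p (a - ε)).card : ℕ) := by rw [h]
  push_cast at this
  linarith

theorem shift_comp (p : PerFun D n) (w : affSym D) (k c : ℤ) :
    (shift p (w.1 k) c).comp w = shift (p.comp w) k c := by
  apply PerFun.ext
  intro l
  simp only [PerFun.comp_apply, shift_apply]
  congr 1
  have : (D : ℤ) ∣ w.1 l - w.1 k ↔ (D : ℤ) ∣ l - k := by
    constructor
    · rintro ⟨t, ht⟩
      refine ⟨t, ?_⟩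
      have := per_add_mul w.2 k t
      have : w.1 l = w.1 (k + D * t) := by linarith
      have := w.1.injective this
      linarith
    · rintro ⟨t, ht⟩
      refine ⟨t, ?_⟩
      have := per_add_mul w.2 k t
      rw [show l = k + D * t by linarith, this]
      ring
  simp only [this]

theorem sum_fiber_comp {M : Type*} [AddCommMonoid M] (p : PerFun D n) (w : affSym D) (a : ℤ)
    (g : ℤ → M) : ∑ k ∈ fiber (p.comp w) a, g (w.1 k) = ∑ k ∈ fiber p a, g k := by
  refine Finset.sum_bij (fun k _ => w.1 k) ?_ ?_ ?_ (fun _ _ => rfl)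
  · intro k hk; simpa using hk
  · intro a _ b _ h; exact w.1.injective h
  · intro k hk; exact ⟨w.1.symm k, by simpa using hk, by simp⟩

/-- The translation `j ↦ j + t`. -/
def translation (D : ℕ) (t : ℤ) : affSym D := ⟨Equiv.addRight t, fun j => by simp; ring⟩

@[simp] theorem translation_apply (t j : ℤ) : (translation D t).1 j = j + t := rfl

theorem exists_dom_of_monotone (p : PerFun D n) (hp : Monotone p.1) :
    ∃ (m : Dom D n) (t : ℤ), p = m.1.comp (translation D t) := by
  have hn := natCast_pos_of_neZero n
  -- The last point with value at most `0` has to be moved to `0` to make the function dominant.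
  obtain ⟨t, h1, h2⟩ : ∃ t : ℤ, p.1 t ≤ 0 ∧ 1 ≤ p.1 (t + 1) := by
    obtain ⟨t, h1, h2⟩ := Int.exists_greatest_of_bdd (P := fun t => p.1 t ≤ 0)
      ⟨D * (|p.1 0| + 1), fun z hz => by
        by_contra hc
        have h1 := hp (not_le.1 hc).le
        have h2 := p.add_mul 0 (|p.1 0| + 1)
        rw [zero_add] at h2
        have := neg_abs_le (p.1 0)
        nlinarith [abs_nonneg (p.1 0)]⟩
      ⟨D * (-|p.1 0|), by
        have h2 := p.add_mul 0 (-|p.1 0|)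
        rw [zero_add] at h2
        have := le_abs_self (p.1 0)
        nlinarith [abs_nonneg (p.1 0)]⟩
    refine ⟨t, h1, ?_⟩
    by_contra hc
    have := h2 (t + 1) (by omega)
    omega
  refine ⟨⟨p.comp (translation D t), ?_, ?_, ?_⟩, -t, ?_⟩
  · rw [PerFun.comp_apply, translation_apply, add_comm]; exact h2
  · intro a _ b _ hab
    exact hp (by simpa using hab)
  · rw [PerFun.comp_apply, translation_apply, add_comm, p.2]; linarith
  · apply PerFun.ext
    intro j
    simp

theorem schur_smul (S : Schur D n) (a : BaseA) (x : TMod D n) : S (a • x) = a • S x :=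
  LinearMap.map_smul_of_tower S a x

/-- A translation has no inversions, so its `T_w` acts on every vector `T_q` simply by composition;
this carries the formula from dominant to monotone functions. -/
theorem moveSum_of_monotone {ε a : ℤ} {S : Schur D n}
    (hS : ∀ m : Dom D n, S (Tvec m.1) =
      (LaurentPolynomial.T ((fiber m.1 (a - ε)).card : ℤ) : BaseA) • moveSum ε m.1 a)
    (p : PerFun D n) (hp : Monotone p.1) :
    S (Tvec p) = (LaurentPolynomial.T ((fiber p (a - ε)).card : ℤ) : BaseA) • moveSum ε p a := by
  obtain ⟨m, t, rfl⟩ := exists_dom_of_monotone p hp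
  have h : ∀ q : PerFun D n, MulOpposite.op (heckeT (translation D t)) • Tvec q =
      Tvec (q.comp (translation D t)) := by
    intro q
    apply Tvec_mul_heckeT
    intro a b hab hw
    simp at hw
    omega
  rw [← h, map_smul, hS, card_fiber_comp, smul_comm]
  congr 1
  unfold moveSum
  rw [Finset.smul_sum, ← sum_fiber_comp m.1 (translation D t)]
  refine Finset.sum_congr rfl fun k _ => ?_
  rw [h, shift_comp]

/-- For unequal values the factor `v⁻¹` compensates the growth of `x_q` by one. For equal values the
quadratic relation gives `v⁻²`, which is the additional `-1` in the exponent. -/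
theorem normVec_mul_heckeT (q : PerFun D n) {s : affSym D} {j : ℤ} (h : IsSwap s j)
    (hq : q.1 j ≤ q.1 (j + 1)) :
    MulOpposite.op (heckeT s) • normVec q =
      (LaurentPolynomial.T (-1 - if q.1 j = q.1 (j + 1) then 1 else 0) : BaseA) •
        normVec (q.comp s) := by
  unfold normVec
  split_ifs with he
  · rw [smul_comm, Tvec_mul_heckeT_of_eq q h he, h.perFun_eq he, smul_comm]
    rfl
  · have hlt := lt_of_le_of_ne hq he
    rw [smul_comm, Tvec_mul_heckeT q s, xdim_comp_swap q h hlt, smul_smul,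
      ← LaurentPolynomial.T_add]
    · congr 2
      push_cast
      ring
    · intro a b hab hw
      obtain ⟨c1, rfl⟩ := (h.apply_lt_iff hab).1 hw
      rw [h.apply_left a c1, h.apply_right (a + 1) (by convert c1 using 1; ring)]
      obtain ⟨t, rfl, -⟩ := q.eq_add_of_dvd c1
      rw [show j + D * t + 1 - 1 = j + D * t by ring, show j + D * t + 1 = j + 1 + D * t by ring,
        q.add_mul, q.add_mul]
      linarith

/-- A strict inequality between integers survives, at worst as an equality, when one point moves by
one. So `normVec_mul_heckeT` applies to every term of a move. -/
theorem shift_swap_le {ε : ℤ} (hε : ε = 1 ∨ ε = -1) (p : PerFun D n) {j : ℤ} (k : ℤ)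
    (hlt : p.1 j < p.1 (j + 1)) : (shift p k (-ε)).1 j ≤ (shift p k (-ε)).1 (j + 1) := by
  rw [shift_apply, shift_apply]
  rcases hε with rfl | rfl <;> split_ifs <;> omega

/-- Equality occurs only if a translate of `k` is the member of the pair that moves towards the
other, and the neighbour `k - ε` already has the value to which `k` moves. -/
theorem shift_swap_eq_iff {ε : ℤ} (hε : ε = 1 ∨ ε = -1) (hD : 2 ≤ D) (p : PerFun D n) {j k : ℤ}
    (hlt : p.1 j < p.1 (j + 1)) :
    (shift p k (-ε)).1 j = (shift p k (-ε)).1 (j + 1) ↔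
      (if ε = 1 then (D : ℤ) ∣ k - ε - j else (D : ℤ) ∣ k - j) ∧ p.1 (k - ε) = p.1 k - ε := by
  have hd : ¬ ((D : ℤ) ∣ j - k ∧ (D : ℤ) ∣ j + 1 - k) := by
    rintro ⟨h1, h2⟩
    apply not_dvd_succ hD h2
    convert h1 using 1; ring
  rw [shift_apply, shift_apply]
  rcases hε with rfl | rfl
  · rw [if_pos rfl, show (D : ℤ) ∣ k - 1 - j ↔ (D : ℤ) ∣ j + 1 - k by
      rw [← dvd_neg, show -(k - 1 - j) = j + 1 - k by ring]]
    constructor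
    · intro h
      have h2 : (D : ℤ) ∣ j + 1 - k := by
        by_contra hc
        rw [if_neg hc] at h
        split_ifs at h <;> omega
      refine ⟨h2, ?_⟩
      rw [if_neg fun h' => hd ⟨h', h2⟩, if_pos h2] at h
      obtain ⟨t, ht⟩ := h2
      have e1 := p.add_mul (k - 1) t
      have e2 := p.add_mul k t
      rw [show k - 1 + D * t = j by linarith] at e1
      rw [show k + D * t = j + 1 by linarith] at e2
      linarith
    · rintro ⟨h2, h⟩
      rw [if_neg fun h' => hd ⟨h', h2⟩, if_pos h2]
      obtain ⟨t, ht⟩ := h2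
      have e1 := p.add_mul (k - 1) t
      have e2 := p.add_mul k t
      rw [show k - 1 + D * t = j by linarith] at e1
      rw [show k + D * t = j + 1 by linarith] at e2
      linarith
  · rw [if_neg (show ¬ ((-1 : ℤ) = 1) by norm_num), show (D : ℤ) ∣ k - j ↔ (D : ℤ) ∣ j - k from dvd_sub_comm]
    constructor
    · intro h
      have h2 : (D : ℤ) ∣ j - k := by
        by_contra hc
        rw [if_neg hc] at h
        split_ifs at h <;> omega
      refine ⟨h2, ?_⟩
      rw [if_neg fun h' => hd ⟨h2, h'⟩, if_pos h2] at h
      obtain ⟨t, ht⟩ := h2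
      have e1 := p.add_mul (k - -1) t
      have e2 := p.add_mul k t
      rw [show k - -1 + D * t = j + 1 by linarith] at e1
      rw [show k + D * t = j by linarith] at e2
      linarith
    · rintro ⟨h2, h⟩
      rw [if_neg fun h' => hd ⟨h2, h'⟩, if_pos h2]
      obtain ⟨t, ht⟩ := h2
      have e1 := p.add_mul (k - -1) t
      have e2 := p.add_mul k t
      rw [show k - -1 + D * t = j + 1 by linarith] at e1
      rw [show k + D * t = j by linarith] at e2
      linarith

theorem card_filter_fiber_comp (p : PerFun D n) {s : affSym D} {j : ℤ} (h : IsSwap s j)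
    (ε k c : ℤ) :
    ((fiber (p.comp s) c).filter fun l => ε * s.1 k < ε * l).card =
      ((fiber p c).filter fun l => ε * s.1 k < ε * s.1 l).card := by
  refine Finset.card_bij (fun l _ => s.1 l) ?_ ?_ ?_
  · intro l hl
    simpa [h.apply_apply] using hl
  · intro a _ b _ e; exact s.1.injective e
  · intro l hl
    exact ⟨s.1 l, by simpa [h.apply_apply] using hl, h.apply_apply l⟩

/-- The relative order of `k` and `l` after a swap, when the values at `k` and `l` are at most
`1` apart. -/
theorem swap_mul_lt_iff {ε : ℤ} (hε : ε = 1 ∨ ε = -1) (p : PerFun D n) {s : affSym D} {j : ℤ}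
    (h : IsSwap s j) (hlt : p.1 j < p.1 (j + 1)) {k l : ℤ} (hl : ε * p.1 l ≤ ε * p.1 k) :
    ε * s.1 k < ε * s.1 l ↔ ε * k < ε * l ∨
      ((if ε = 1 then (D : ℤ) ∣ k - ε - j else (D : ℤ) ∣ k - j) ∧ l = k - ε) := by
  have hval : ∀ x : ℤ, (D : ℤ) ∣ x - j → p.1 x < p.1 (x + 1) := by
    intro x hx
    obtain ⟨t, rfl, -⟩ := p.eq_add_of_dvd hx
    rw [show j + D * t + 1 = j + 1 + D * t by ring, p.add_mul, p.add_mul]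
    linarith
  rcases hε with rfl | rfl
  · simp only [one_mul, if_true] at hl ⊢
    rw [h.apply_lt_apply_iff]
    constructor
    · rintro (⟨h1, -⟩ | ⟨h1, rfl⟩)
      · exact Or.inl h1
      · right; simpa using h1
    · rintro (h1 | ⟨h1, rfl⟩)
      · left
        refine ⟨h1, ?_⟩
        rintro ⟨h2, rfl⟩
        have := hval k h2
        omega
      · right; exact ⟨h1, by ring⟩
  · rw [if_neg (by norm_num)]
    rw [show -1 * s.1 k < -1 * s.1 l ↔ s.1 l < s.1 k by constructor <;> intro <;> linarith,
      show -1 * k < -1 * l ↔ l < k by constructor <;> intro <;> linarith, h.apply_lt_apply_iff]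
    constructor
    · rintro (⟨h1, -⟩ | ⟨h1, rfl⟩)
      · exact Or.inl h1
      · right; exact ⟨h1, by ring⟩
    · rintro (h1 | ⟨h1, rfl⟩)
      · left
        refine ⟨h1, ?_⟩
        rintro ⟨h2, rfl⟩
        have := hval l h2
        omega
      · right; exact ⟨h1, by ring⟩

/-- The count over the fiber of `a` is unchanged because the swapped points have different values.
The count over the fiber of `a - ε` gains the point `k - ε` exactly when that point crosses `k`,
which is the case of equality in `shift_swap_eq_iff`. -/
theorem moveExp_comp_swap {ε : ℤ} (hε : ε = 1 ∨ ε = -1) (p : PerFun D n) {s : affSym D} {j : ℤ}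
    (h : IsSwap s j) (hlt : p.1 j < p.1 (j + 1)) {a k : ℤ} (hk : p.1 k = a) :
    moveExp ε (p.comp s) a (s.1 k) = moveExp ε p a k -
      if (shift p k (-ε)).1 j = (shift p k (-ε)).1 (j + 1) then 1 else 0 := by
  have hεε : ε * ε = 1 := by rcases hε with rfl | rfl <;> norm_num
  unfold moveExp
  rw [card_filter_fiber_comp p h, card_filter_fiber_comp p h]
  have e1 : ((fiber p a).filter fun l => ε * s.1 k < ε * s.1 l) =
      (fiber p a).filter fun l => ε * k < ε * l := by
    apply Finset.filter_congr
    intro l hl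
    rw [mem_fiber] at hl
    rw [swap_mul_lt_iff hε p h hlt (by rw [hl, hk])]
    refine or_iff_left ?_
    rintro ⟨h1, rfl⟩
    split_ifs at h1 with h2
    · subst h2
      obtain ⟨t, ht, e⟩ := p.eq_add_of_dvd h1
      have e2 := p.add_mul (j + 1) t
      rw [show j + 1 + D * t = k by linarith] at e2
      linarith
    · have h3 : ε = -1 := by tauto
      subst h3
      obtain ⟨t, ht, e⟩ := p.eq_add_of_dvd h1
      have e2 := p.add_mul (j + 1) t
      rw [show j + 1 + D * t = k - -1 by linarith] at e2
      linarith
  rw [e1]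
  have hsw : ∀ l, p.1 l = a - ε → (ε * s.1 k < ε * s.1 l ↔ ε * k < ε * l ∨
      ((if ε = 1 then (D : ℤ) ∣ k - ε - j else (D : ℤ) ∣ k - j) ∧ l = k - ε)) := by
    intro l hl
    refine swap_mul_lt_iff hε p h hlt ?_
    rw [hl, hk, mul_sub]
    linarith
  have hiff := shift_swap_eq_iff hε h.two_le p (k := k) hlt
  rw [hk] at hiff
  by_cases hE : (shift p k (-ε)).1 j = (shift p k (-ε)).1 (j + 1)
  · rw [if_pos hE]
    obtain ⟨h1, h2⟩ := hiff.1 hE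
    have e2 : ((fiber p (a - ε)).filter fun l => ε * s.1 k < ε * s.1 l) =
        insert (k - ε) ((fiber p (a - ε)).filter fun l => ε * k < ε * l) := by
      ext l
      simp only [Finset.mem_filter, Finset.mem_insert, mem_fiber]
      constructor
      · rintro ⟨h3, h4⟩
        rcases (hsw l h3).1 h4 with h5 | ⟨-, h5⟩
        · exact Or.inr ⟨h3, h5⟩
        · exact Or.inl h5
      · rintro (rfl | ⟨h3, h4⟩)
        · exact ⟨h2, (hsw _ h2).2 (Or.inr ⟨h1, rfl⟩)⟩
        · exact ⟨h3, (hsw l h3).2 (Or.inl h4)⟩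
    rw [e2, Finset.card_insert_of_notMem]
    · push_cast; ring
    · rw [Finset.mem_filter, not_and]
      intro _
      rw [mul_sub]
      linarith
  · rw [if_neg hE]
    have e2 : ((fiber p (a - ε)).filter fun l => ε * s.1 k < ε * s.1 l) =
        (fiber p (a - ε)).filter fun l => ε * k < ε * l := by
      apply Finset.filter_congr
      intro l hl
      rw [mem_fiber] at hl
      rw [hsw l hl]
      refine or_iff_left ?_
      rintro ⟨h1, rfl⟩
      exact hE (hiff.2 ⟨h1, hl⟩)
    rw [e2]; ring

theorem two_le_of_descent (p : PerFun D n) {j : ℤ} (hj : p.1 (j + 1) < p.1 j) : 2 ≤ D := by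
  by_contra hc
  have hD0 := Nat.pos_of_ne_zero (NeZero.ne D)
  have hD1 : (D : ℤ) = 1 := by
    have : D = 1 := by omega
    exact_mod_cast this
  have h1 := p.2 j
  have hn0 := natCast_pos_of_neZero n
  have h2 := congrArg p.1 (show j + (D : ℤ) = j + 1 by rw [hD1])
  linarith

/-- Both sides behave in the same way under multiplication by `v T_s` at an ascent, so the formula
for monotone functions spreads to all functions by induction on `x_p`. -/
theorem apply_normVec (hn : 2 ≤ n) {ε a : ℤ} (hε : ε = 1 ∨ ε = -1) {S : Schur D n}
    (hS : ∀ m : Dom D n, S (Tvec m.1) =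
      (LaurentPolynomial.T ((fiber m.1 (a - ε)).card : ℤ) : BaseA) • moveSum ε m.1 a)
    (p : PerFun D n) : S (normVec p) = normMove ε p a := by
  induction hx : xdim p using Nat.strong_induction_on generalizing p with
  | _ N ih =>
  by_cases hp : Monotone p.1
  · rw [normMove_of_monotone hn hε p a hp]
    unfold normVec
    rw [schur_smul, moveSum_of_monotone hS p hp, smul_smul, ← LaurentPolynomial.T_add]
  · obtain ⟨j, hj⟩ : ∃ j, p.1 (j + 1) < p.1 j := by
      by_contra hc
      push Not at hc
      exact hp (monotone_int_of_le_succ hc)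
    obtain ⟨s, hs⟩ := exists_isSwap (two_le_of_descent p hj) j
    -- Removing a descent of `p` gives `q` with an ascent at `j` and with `x_q = x_p - 1`.
    obtain ⟨q, rfl⟩ : ∃ q : PerFun D n, p = q.comp s := ⟨p.comp s, by
      apply PerFun.ext
      intro l
      simp only [PerFun.comp_apply, hs.apply_apply]⟩
    have hlt : q.1 j < q.1 (j + 1) := by
      rw [PerFun.comp_apply, PerFun.comp_apply, hs.apply_left j (by simp),
        hs.apply_right (j + 1) (by simp)] at hj
      simpa using hj
    have hxq := xdim_comp_swap q hs hlt
    have hq := normVec_mul_heckeT q hs hlt.le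
    rw [if_neg hlt.ne] at hq
    have hq' : normVec (q.comp s) =
        (LaurentPolynomial.T 1 : BaseA) • MulOpposite.op (heckeT s) • normVec q := by
      rw [hq, smul_smul, ← LaurentPolynomial.T_add]
      simp
    rw [hq', schur_smul, map_smul, ih _ (by omega) q rfl]
    unfold normMove
    rw [← sum_fiber_comp (q.comp s) s]
    have hqq : (q.comp s).comp s = q := by
      apply PerFun.ext
      intro l
      simp only [PerFun.comp_apply, hs.apply_apply]
    rw [hqq, Finset.smul_sum, Finset.smul_sum]
    refine Finset.sum_congr rfl fun k hk => ?_
    rw [mem_fiber] at hk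
    -- In each term, the factor `v⁻¹` or `v⁻²` produced by `T_s`, multiplied by `v`, is the change
    -- of exponent in `moveExp_comp_swap`.
    rw [smul_comm (MulOpposite.op (heckeT s)),
      normVec_mul_heckeT _ hs (shift_swap_le hε q k hlt), smul_smul, smul_smul,
      ← LaurentPolynomial.T_add, ← LaurentPolynomial.T_add,
      moveExp_comp_swap hε q hs hlt hk]
    have e : (shift q k (-ε)).comp s = shift (q.comp s) (s.1 k) (-ε) := by
      rw [← shift_comp, hs.apply_apply]
    rw [e]
    congr 2
    ring

end move

/-! ### Commutators of raising and lowering operators -/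

section commutator
variable {D n : ℕ} [NeZero D] [NeZero n]

/-- The number of elements of `p⁻¹(a)` congruent to `k` with the property `P`. -/
noncomputable def classCount (p : PerFun D n) (k a : ℤ) (P : ℤ → Prop) [DecidablePred P] : ℕ :=
  ((fiber p a).filter fun l => (D : ℤ) ∣ l - k ∧ P l).card

/-- Outside the class of `k` nothing changes; inside it, the points of new value `a` are those of
old value `a - c`. -/
theorem card_filter_shift (p : PerFun D n) (k c a : ℤ) (P : ℤ → Prop) [DecidablePred P] :
    ((fiber (shift p k c) a).filter P).card + classCount p k a P =
      ((fiber p a).filter P).card + classCount p k (a - c) P := by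
  have h1 : ∀ q : PerFun D n, ((fiber q a).filter P).card =
      ((fiber q a).filter fun l => ¬ (D : ℤ) ∣ l - k ∧ P l).card + classCount q k a P := by
    intro q
    unfold classCount
    rw [← Finset.card_filter_add_card_filter_not (s := (fiber q a).filter P)
      (fun l => (D : ℤ) ∣ l - k), add_comm, Finset.filter_filter, Finset.filter_filter]
    simp only [and_comm]
  have h2 : ((fiber (shift p k c) a).filter fun l => ¬ (D : ℤ) ∣ l - k ∧ P l) =
      ((fiber p a).filter fun l => ¬ (D : ℤ) ∣ l - k ∧ P l) := by
    ext l
    simp only [Finset.mem_filter, mem_fiber]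
    refine and_congr_left fun h => ?_
    rw [shift_apply_of_not_dvd p c h.1]
  have h3 : classCount (shift p k c) k a P = classCount p k (a - c) P := by
    unfold classCount
    congr 1
    ext l
    simp only [Finset.mem_filter, mem_fiber]
    refine and_congr_left fun h => ?_
    rw [shift_apply_of_dvd p c h.1]
    constructor <;> intro <;> linarith
  rw [h1, h1 p, h2, h3]
  ring

/-- The reflection `l ↦ k + k' - l` exchanges the classes of `k` and `k'` and turns points to the
right of `k'` into points to the left of `k`. Thus the effect of moving `k` on counts at `k'`
mirrors the effect of moving `k'` on counts at `k`. -/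
theorem classCount_dual (p : PerFun D n) {k k' b c : ℤ} (h : b - p.1 k' = p.1 k - c) :
    classCount p k b (fun l => k' < l) = classCount p k' c (fun l => l < k) := by
  unfold classCount
  have key : ∀ x y l : ℤ, (D : ℤ) ∣ l - x →
      (D : ℤ) ∣ x + y - l - y ∧ p.1 (x + y - l) = p.1 x + p.1 y - p.1 l := by
    intro x y l hl
    obtain ⟨t, rfl, h1⟩ := p.eq_add_of_dvd hl
    refine ⟨⟨-t, by ring⟩, ?_⟩
    have := p.add_mul y (-t)
    rw [show x + y - (x + D * t) = y + D * (-t) by ring, this, h1]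
    ring
  refine Finset.card_bij (fun l _ => k + k' - l) ?_ ?_ ?_
  · intro l hl
    simp only [Finset.mem_filter, mem_fiber] at hl ⊢
    obtain ⟨h1, h2⟩ := key k k' l hl.2.1
    exact ⟨by linarith, h1, by linarith⟩
  · intro a _ b _ e; linarith
  · intro l hl
    simp only [Finset.mem_filter, mem_fiber] at hl
    obtain ⟨h1, h2⟩ := key k' k l hl.2.1
    rw [add_comm k' k] at h1 h2
    refine ⟨k + k' - l, ?_, by ring⟩
    simp only [Finset.mem_filter, mem_fiber]
    exact ⟨by linarith, h1, by linarith⟩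

/-- Values in the class of `k` differ by multiples of `n ≥ 2`, so within distance one of `p k` only
`k` itself occurs. -/
theorem classCount_eq_zero (hn : 2 ≤ n) (p : PerFun D n) {k a : ℤ} (P : ℤ → Prop)
    [DecidablePred P] (hP : ¬ P k) (h1 : p.1 k - 1 ≤ a) (h2 : a ≤ p.1 k + 1) :
    classCount p k a P = 0 := by
  have hn' : (2 : ℤ) ≤ n := by exact_mod_cast hn
  unfold classCount
  rw [Finset.card_eq_zero]
  apply Finset.filter_false_of_mem
  rintro l hl ⟨h3, h4⟩
  rw [mem_fiber] at hl
  obtain ⟨t, rfl, h5⟩ := p.eq_add_of_dvd h3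
  have : t = 0 := by
    by_contra ht
    rcases lt_or_gt_of_ne ht with h | h <;> nlinarith
  subst this
  simp at h4
  exact hP h4

theorem moveExp_one (p : PerFun D n) (a k : ℤ) :
    moveExp 1 p a k = ((fiber p a).filter fun l => k < l).card -
      ((fiber p (a - 1)).filter fun l => k < l).card := by
  unfold moveExp
  simp only [one_mul]

theorem moveExp_neg_one (p : PerFun D n) (a k : ℤ) :
    moveExp (-1) p a k = ((fiber p a).filter fun l => l < k).card -
      ((fiber p (a + 1)).filter fun l => l < k).card := by
  unfold moveExp
  simp only [sub_neg_eq_add, neg_mul, one_mul, neg_lt_neg_iff]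

/-- Moving `k` first or `k'` first gives the same total exponent: each correction caused by the
first move has its mirror image on the other side under `classCount_dual`. -/
theorem moveExp_comm (p : PerFun D n) {i j k k' : ℤ} (hk : p.1 k = j) (hk' : p.1 k' = i + 1) :
    moveExp (-1) p j k + moveExp 1 (shift p k 1) (i + 1) k' =
      moveExp 1 p (i + 1) k' + moveExp (-1) (shift p k' (-1)) j k := by
  simp only [moveExp_one, moveExp_neg_one]
  have e1 := card_filter_shift p k 1 (i + 1) (fun l => k' < l)
  have e2 := card_filter_shift p k 1 (i + 1 - 1) (fun l => k' < l)
  have e3 := card_filter_shift p k' (-1) j (fun l => l < k)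
  have e4 := card_filter_shift p k' (-1) (j + 1) (fun l => l < k)
  have d1 := classCount_dual p (k := k) (k' := k') (b := i + 1) (c := j) (by rw [hk, hk']; ring)
  have d2 := classCount_dual p (k := k) (k' := k') (b := i + 1 - 1) (c := j + 1)
    (by rw [hk, hk']; ring)
  have d3 := classCount_dual p (k := k) (k' := k') (b := i + 1 - 1 - 1) (c := j + 1 + 1)
    (by rw [hk, hk']; ring)
  rw [sub_neg_eq_add] at e3 e4
  omega

theorem moveExp_shift_self_pos (hn : 2 ≤ n) (p : PerFun D n) {i k : ℤ} (hk : p.1 k = i) :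
    moveExp 1 (shift p k 1) (i + 1) k = moveExp 1 p (i + 1) k := by
  simp only [moveExp_one]
  have e1 := card_filter_shift p k 1 (i + 1) (fun l => k < l)
  have e2 := card_filter_shift p k 1 (i + 1 - 1) (fun l => k < l)
  rw [classCount_eq_zero hn p _ (lt_irrefl k) (by omega) (by omega),
    classCount_eq_zero hn p _ (lt_irrefl k) (by omega) (by omega)] at e1 e2
  omega

theorem moveExp_shift_self_neg (hn : 2 ≤ n) (p : PerFun D n) {i k : ℤ} (hk : p.1 k = i + 1) :
    moveExp (-1) (shift p k (-1)) i k = moveExp (-1) p i k := by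
  simp only [moveExp_neg_one]
  have e1 := card_filter_shift p k (-1) i (fun l => l < k)
  have e2 := card_filter_shift p k (-1) (i + 1) (fun l => l < k)
  rw [classCount_eq_zero hn p (fun l => l < k) (lt_irrefl k) (by omega) (by omega),
    classCount_eq_zero hn p (fun l => l < k) (lt_irrefl k) (by omega) (by omega)] at e1 e2
  omega

/-- The sum of the `v ^ c [p]` over `k ∈ p⁻¹(b)`, `l ∈ p⁻¹(b')`, `l ≡ k`, where `[p]` is seen as
the result of moving `k` by `c` and `l` by `-c`. -/
noncomputable def returnSum (p : PerFun D n) (c : ℤ) (b b' : ℤ) (x : ℤ → ℤ → ℤ) : TMod D n :=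
  ∑ k ∈ fiber p b, ∑ l ∈ (fiber p b').filter (fun l => (D : ℤ) ∣ l - k),
    (LaurentPolynomial.T (x k l) : BaseA) • normVec (shift (shift p k c) l (-c))

theorem sum_fiber_shift {M : Type*} [AddCommMonoid M] (p : PerFun D n) (k c a : ℤ) (g : ℤ → M) :
    ∑ l ∈ fiber (shift p k c) a, g l =
      ∑ l ∈ (fiber p (a - c)).filter (fun l => (D : ℤ) ∣ l - k), g l +
        ∑ l ∈ (fiber p a).filter (fun l => ¬ (D : ℤ) ∣ l - k), g l := by
  rw [← Finset.sum_filter_add_sum_filter_not _ (fun l => (D : ℤ) ∣ l - k)]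
  congr 1
  · apply Finset.sum_congr _ fun _ _ => rfl
    ext l
    simp only [Finset.mem_filter, mem_fiber]
    refine and_congr_left fun h => ?_
    rw [shift_apply_of_dvd p c h]
    constructor <;> intro <;> linarith
  · apply Finset.sum_congr _ fun _ _ => rfl
    ext l
    simp only [Finset.mem_filter, mem_fiber]
    refine and_congr_left fun h => ?_
    rw [shift_apply_of_not_dvd p c h]

/-- The terms where the two moved points lie in different classes cancel by `moveExp_comm`. What
remains are the terms in which both moves act on one class, and hence restore `p`. -/
theorem commutator_normVec {E F : Schur D n} {i j : ℤ}
    (hE : ∀ p, E (normVec p) = normMove 1 p (i + 1))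
    (hF : ∀ p, F (normVec p) = normMove (-1) p j) (p : PerFun D n) :
    E (F (normVec p)) - F (E (normVec p)) =
      returnSum p 1 j i
        (fun k l => moveExp (-1) p j k + moveExp 1 (shift p k 1) (i + 1) l) -
      returnSum p (-1) (i + 1) (j + 1)
        (fun k l => moveExp 1 p (i + 1) k + moveExp (-1) (shift p k (-1)) j l) := by
  rw [hE, hF]
  unfold normMove
  rw [map_sum, map_sum]
  have h1 : ∀ k, E ((LaurentPolynomial.T (moveExp (-1) p j k) : BaseA) •
      normVec (shift p k (- -1))) = (∑ l ∈ (fiber p i).filter (fun l => (D : ℤ) ∣ l - k),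
        (LaurentPolynomial.T (moveExp (-1) p j k + moveExp 1 (shift p k 1) (i + 1) l) : BaseA) •
          normVec (shift (shift p k 1) l (-1))) +
      ∑ l ∈ (fiber p (i + 1)).filter (fun l => ¬ (D : ℤ) ∣ l - k),
        (LaurentPolynomial.T (moveExp (-1) p j k + moveExp 1 (shift p k 1) (i + 1) l) : BaseA) •
          normVec (shift (shift p k 1) l (-1)) := by
    intro k
    rw [schur_smul, hE]
    unfold normMove
    rw [neg_neg, Finset.smul_sum, sum_fiber_shift, add_sub_cancel_right]
    simp only [smul_smul, ← LaurentPolynomial.T_add]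
  have h2 : ∀ k, F ((LaurentPolynomial.T (moveExp 1 p (i + 1) k) : BaseA) •
      normVec (shift p k (-1))) = (∑ l ∈ (fiber p (j + 1)).filter (fun l => (D : ℤ) ∣ l - k),
        (LaurentPolynomial.T (moveExp 1 p (i + 1) k + moveExp (-1) (shift p k (-1)) j l) : BaseA) •
          normVec (shift (shift p k (-1)) l (- -1))) +
      ∑ l ∈ (fiber p j).filter (fun l => ¬ (D : ℤ) ∣ l - k),
        (LaurentPolynomial.T (moveExp 1 p (i + 1) k + moveExp (-1) (shift p k (-1)) j l) : BaseA) •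
          normVec (shift (shift p k (-1)) l (- -1)) := by
    intro k
    rw [schur_smul, hF]
    unfold normMove
    rw [Finset.smul_sum, sum_fiber_shift, sub_neg_eq_add]
    simp only [smul_smul, ← LaurentPolynomial.T_add]
  rw [Finset.sum_congr rfl fun k _ => h1 k, Finset.sum_congr rfl fun k _ => h2 k,
    Finset.sum_add_distrib, Finset.sum_add_distrib]
  have h3 : (∑ k ∈ fiber p j, ∑ l ∈ (fiber p (i + 1)).filter (fun l => ¬ (D : ℤ) ∣ l - k),
        (LaurentPolynomial.T (moveExp (-1) p j k + moveExp 1 (shift p k 1) (i + 1) l) : BaseA) •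
          normVec (shift (shift p k 1) l (-1))) =
      ∑ k ∈ fiber p (i + 1), ∑ l ∈ (fiber p j).filter (fun l => ¬ (D : ℤ) ∣ l - k),
        (LaurentPolynomial.T (moveExp 1 p (i + 1) k + moveExp (-1) (shift p k (-1)) j l) : BaseA) •
          normVec (shift (shift p k (-1)) l (- -1)) := by
    rw [Finset.sum_comm' (t' := fiber p (i + 1))
      (s' := fun k => (fiber p j).filter (fun l => ¬ (D : ℤ) ∣ l - k))]
    · refine Finset.sum_congr rfl fun k hk => Finset.sum_congr rfl fun l hl => ?_
      rw [mem_fiber] at hk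
      rw [Finset.mem_filter, mem_fiber] at hl
      rw [moveExp_comm p hl.1 hk, shift_comm, neg_neg]
    · intro x y
      simp only [Finset.mem_filter, dvd_sub_comm]
      tauto
  rw [h3]
  unfold returnSum
  abel

/-- Points congruent modulo `D` have values congruent modulo `n`, so the inner sums are empty. -/
theorem returnSum_eq_zero (p : PerFun D n) {c b b' : ℤ} {x : ℤ → ℤ → ℤ}
    (h : (b : ZMod n) ≠ (b' : ZMod n)) : returnSum p c b b' x = 0 := by
  unfold returnSum
  refine Finset.sum_eq_zero fun k hk => Finset.sum_eq_zero fun l hl => ?_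
  exfalso
  rw [Finset.mem_filter, mem_fiber] at hl
  rw [mem_fiber] at hk
  obtain ⟨t, -, h1⟩ := p.eq_add_of_dvd hl.2
  apply h
  rw [← hk, ← hl.1, h1]
  simp

theorem returnSum_self (p : PerFun D n) (c b : ℤ) (x : ℤ → ℤ → ℤ) :
    returnSum p c b b x =
      (∑ k ∈ fiber p b, (LaurentPolynomial.T (x k k) : BaseA)) • normVec p := by
  unfold returnSum
  rw [Finset.sum_smul]
  refine Finset.sum_congr rfl fun k hk => ?_
  rw [mem_fiber] at hk
  have : (fiber p b).filter (fun l => (D : ℤ) ∣ l - k) = {k} := by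
    ext l
    simp only [Finset.mem_filter, mem_fiber, Finset.mem_singleton]
    constructor
    · rintro ⟨h1, h2⟩; exact p.eq_of_dvd h2 (h1.trans hk.symm)
    · rintro rfl; exact ⟨hk, by simp⟩
  rw [this, Finset.sum_singleton, shift_shift, add_neg_cancel, shift_zero]

theorem sum_T_telescope (S : Finset ℤ) (σ : ℤ → ℤ) :
    ∑ k ∈ S, ((LaurentPolynomial.T (∑ l ∈ S.filter (fun l => l < k), σ l + σ k) : BaseA) -
      LaurentPolynomial.T (∑ l ∈ S.filter (fun l => l < k), σ l)) =
      LaurentPolynomial.T (∑ l ∈ S, σ l) - 1 := by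
  induction S using Finset.induction_on_max with
  | empty => simp
  | insert a S hmax ih =>
    have ha : a ∉ S := fun h => lt_irrefl a (hmax a h)
    have h1 : (insert a S).filter (fun l => l < a) = S := by
      ext l
      simp only [Finset.mem_filter, Finset.mem_insert]
      constructor
      · rintro ⟨rfl | h, h'⟩
        · exact absurd h' (lt_irrefl _)
        · exact h
      · intro h; exact ⟨Or.inr h, hmax l h⟩
    rw [Finset.sum_insert ha, h1]
    have h2 : ∀ k ∈ S, (insert a S).filter (fun l => l < k) = S.filter (fun l => l < k) := by
      intro k hk
      rw [Finset.filter_insert, if_neg (not_lt.2 (hmax k hk).le)]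
    have h3 : ∑ k ∈ S, ((LaurentPolynomial.T
        (∑ l ∈ (insert a S).filter (fun l => l < k), σ l + σ k) : BaseA) -
        LaurentPolynomial.T (∑ l ∈ (insert a S).filter (fun l => l < k), σ l)) =
        LaurentPolynomial.T (∑ l ∈ S, σ l) - 1 := by
      rw [← ih]
      exact Finset.sum_congr rfl fun k hk => by rw [h2 k hk]
    rw [h3, Finset.sum_insert ha, add_comm (σ a)]
    ring

theorem card_filter_lt_add_card_filter_gt (A : Finset ℤ) (k : ℤ) :
    (A.filter fun l => l < k).card + (A.filter fun l => k < l).card +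
      (if k ∈ A then 1 else 0) = A.card := by
  have h1 := Finset.card_filter_add_card_filter_not (s := A) (fun l => l < k)
  have h2 := Finset.card_filter_add_card_filter_not (s := A.filter (fun l => ¬ l < k))
    (fun l => k < l)
  rw [Finset.filter_filter, Finset.filter_filter] at h2
  have h3 : A.filter (fun l => ¬ l < k ∧ k < l) = A.filter (fun l => k < l) := by
    apply Finset.filter_congr; intro l _; omega
  have h4 : A.filter (fun l => ¬ l < k ∧ ¬ k < l) = A.filter (fun l => l = k) := by
    apply Finset.filter_congr; intro l _; omega
  rw [h3, h4, Finset.filter_eq'] at h2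
  split_ifs at h2 ⊢ <;> simp only [Finset.card_singleton, Finset.card_empty] at h2 <;> omega

/-- The signed count of points determines the difference of the two sums of a commutator. -/
theorem sum_T_sub_sum_T (A B : Finset ℤ) (hAB : Disjoint A B) (φ : ℤ → ℤ)
    (hφ : ∀ k, φ k = (A.filter fun l => l < k).card - (B.filter fun l => l < k).card +
      ((B.filter fun l => k < l).card - (A.filter fun l => k < l).card)) :
    ((LaurentPolynomial.T 1 : BaseA) - LaurentPolynomial.T (-1)) *
      (∑ k ∈ A, LaurentPolynomial.T (φ k) - ∑ k ∈ B, LaurentPolynomial.T (φ k)) =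
      LaurentPolynomial.T ((A.card : ℤ) - B.card) -
        LaurentPolynomial.T (-((A.card : ℤ) - B.card)) := by
  classical
  -- Let `S` be the sum of `σ` over the points before `k`. Up to the common factor `v ^ (♯B - ♯A)`,
  -- the product of `v - v⁻¹` with `v ^ φ k` is `v ^ (S + 2) - v ^ S` for `k ∈ A` and `v ^ S - v ^
  -- (S - 2)` for `k ∈ B`. With the signs, both are increments of one telescoping sum along `A ∪ B`.
  set σ : ℤ → ℤ := fun l => if l ∈ A then 2 else -2 with hσ
  have hB : ∀ l ∈ B, l ∉ A := fun l hl hl' => Finset.disjoint_left.1 hAB hl' hl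
  have hsum : ∀ P : ℤ → Prop, ∀ _ : DecidablePred P, ∑ l ∈ (A ∪ B).filter P, σ l =
      2 * (A.filter P).card - 2 * (B.filter P).card := by
    intro P _
    rw [Finset.filter_union, Finset.sum_union (Finset.disjoint_filter_filter hAB),
      Finset.sum_congr rfl (g := fun _ => (2 : ℤ))
        fun l hl => if_pos (Finset.mem_of_mem_filter l hl),
      Finset.sum_congr (s₁ := B.filter P) rfl (g := fun _ => (-2 : ℤ))
        fun l hl => if_neg (hB l (Finset.mem_of_mem_filter l hl))]
    simp only [Finset.sum_const, nsmul_eq_mul]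
    ring
  have key := sum_T_telescope (A ∪ B) σ
  have htot : ∑ l ∈ A ∪ B, σ l = 2 * A.card - 2 * B.card := by
    have := hsum (fun _ => True) inferInstance
    simpa using this
  rw [htot, Finset.sum_union hAB] at key
  have hA' : ∀ k ∈ A, ((LaurentPolynomial.T 1 : BaseA) - LaurentPolynomial.T (-1)) *
      LaurentPolynomial.T (φ k) = LaurentPolynomial.T ((B.card : ℤ) - A.card) *
      (LaurentPolynomial.T (∑ l ∈ (A ∪ B).filter (fun l => l < k), σ l + σ k) -
        LaurentPolynomial.T (∑ l ∈ (A ∪ B).filter (fun l => l < k), σ l)) := by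
    intro k hk
    have e1 := card_filter_lt_add_card_filter_gt A k
    have e2 := card_filter_lt_add_card_filter_gt B k
    rw [if_pos hk] at e1
    rw [if_neg fun h => hB k h hk] at e2
    rw [hsum, sub_mul, mul_sub, ← LaurentPolynomial.T_add, ← LaurentPolynomial.T_add,
      ← LaurentPolynomial.T_add, ← LaurentPolynomial.T_add]
    have hk2 : σ k = 2 := if_pos hk
    rw [hφ, hk2]
    congr 2 <;> omega
  have hB' : ∀ k ∈ B, ((LaurentPolynomial.T 1 : BaseA) - LaurentPolynomial.T (-1)) *
      LaurentPolynomial.T (φ k) = -(LaurentPolynomial.T ((B.card : ℤ) - A.card) *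
      (LaurentPolynomial.T (∑ l ∈ (A ∪ B).filter (fun l => l < k), σ l + σ k) -
        LaurentPolynomial.T (∑ l ∈ (A ∪ B).filter (fun l => l < k), σ l))) := by
    intro k hk
    have e1 := card_filter_lt_add_card_filter_gt A k
    have e2 := card_filter_lt_add_card_filter_gt B k
    rw [if_neg (hB k hk)] at e1
    rw [if_pos hk] at e2
    rw [hsum, sub_mul, ← mul_neg, neg_sub, mul_sub, ← LaurentPolynomial.T_add,
      ← LaurentPolynomial.T_add, ← LaurentPolynomial.T_add, ← LaurentPolynomial.T_add]
    have hk2 : σ k = -2 := if_neg (hB k hk)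
    rw [hφ, hk2]
    congr 2 <;> omega
  rw [mul_sub, Finset.mul_sum, Finset.mul_sum, Finset.sum_congr rfl hA', Finset.sum_congr rfl hB',
    Finset.sum_neg_distrib, sub_neg_eq_add, ← Finset.mul_sum, ← Finset.mul_sum, ← mul_add, key,
    mul_sub, ← LaurentPolynomial.T_add, mul_one]
  congr 2 <;> ring

/-- Moving `k` does not change the exponent for moving `k` back, so both remaining sums are sums of
the same function of `k` over two disjoint fibers. The factor `v - v⁻¹` avoids a division in the
Laurent polynomials. -/
theorem commutator_normVec_self (hn : 2 ≤ n) {E F : Schur D n} {i : ℤ}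
    (hE : ∀ p, E (normVec p) = normMove 1 p (i + 1))
    (hF : ∀ p, F (normVec p) = normMove (-1) p i) (p : PerFun D n) :
    ((LaurentPolynomial.T 1 : BaseA) - LaurentPolynomial.T (-1)) •
      (E (F (normVec p)) - F (E (normVec p))) =
      ((LaurentPolynomial.T (((fiber p i).card : ℤ) - (fiber p (i + 1)).card) : BaseA) -
        LaurentPolynomial.T (-(((fiber p i).card : ℤ) - (fiber p (i + 1)).card))) •
        normVec p := by
  have e : ∀ a b : BaseA, a • normVec p - b • normVec p = (a - b) • normVec p :=
    fun a b => (sub_smul a b (normVec p)).symm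
  rw [commutator_normVec hE hF, returnSum_self, returnSum_self, e, smul_smul]
  congr 1
  have h1 : ∀ k ∈ fiber p i, (LaurentPolynomial.T (moveExp (-1) p i k +
      moveExp 1 (shift p k 1) (i + 1) k) : BaseA) =
      LaurentPolynomial.T (moveExp (-1) p i k + moveExp 1 p (i + 1) k) := by
    intro k hk
    rw [moveExp_shift_self_pos hn p (mem_fiber.1 hk)]
  have h2 : ∀ k ∈ fiber p (i + 1), (LaurentPolynomial.T (moveExp 1 p (i + 1) k +
      moveExp (-1) (shift p k (-1)) i k) : BaseA) =
      LaurentPolynomial.T (moveExp (-1) p i k + moveExp 1 p (i + 1) k) := by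
    intro k hk
    rw [moveExp_shift_self_neg hn p (mem_fiber.1 hk), add_comm]
  rw [Finset.sum_congr rfl h1, Finset.sum_congr rfl h2]
  apply sum_T_sub_sum_T
  · rw [Finset.disjoint_left]
    intro k hk hk'
    rw [mem_fiber] at hk hk'
    omega
  · intro k
    rw [moveExp_one, moveExp_neg_one, add_sub_cancel_right]

end commutator

/-! ### Relative positions given by bidiagonal matrices -/

section counts
variable {D n : ℕ} [NeZero D] [NeZero n]

theorem intCast_eq_iff {a b : ℤ} : (a : ZMod n) = (b : ZMod n) ↔ ∃ t : ℤ, a = b + n * t := by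
  rw [eq_comm, ZMod.intCast_eq_intCast_iff_dvd_sub]
  constructor
  · rintro ⟨t, ht⟩; exact ⟨t, by linarith⟩
  · rintro ⟨t, ht⟩; exact ⟨t, by linarith⟩

theorem intCast_add_one_ne (hn : 2 ≤ n) (i : ZMod n) : i + 1 ≠ i := by
  intro h
  have h1 : ((1 : ℤ) : ZMod n) = ((0 : ℤ) : ZMod n) := by
    push_cast
    exact add_left_cancel (a := i) (by rw [h, add_zero])
  obtain ⟨t, ht⟩ := intCast_eq_iff.1 h1
  have hn' : (2 : ℤ) ≤ n := by exact_mod_cast hn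
  rcases lt_trichotomy t 0 with h | h | h
  · nlinarith
  · subst h; simp at ht
  · nlinarith

/-- On a class modulo `D`, `p` is injective with image a full class modulo `n`. -/
theorem card_class (p : PerFun D n) (k c : ℤ) :
    ((fiber p c).filter fun l => (D : ℤ) ∣ l - k).card =
      if (c : ZMod n) = (p.1 k : ZMod n) then 1 else 0 := by
  split_ifs with h
  · obtain ⟨t, rfl⟩ := intCast_eq_iff.1 h
    rw [Finset.card_eq_one]
    refine ⟨k + D * t, ?_⟩
    ext l
    simp only [Finset.mem_filter, mem_fiber, Finset.mem_singleton]
    constructor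
    · rintro ⟨h1, h2⟩
      apply p.eq_of_dvd
      · obtain ⟨r, hr⟩ := h2
        exact ⟨r - t, by linarith⟩
      · rw [h1, p.add_mul]
    · rintro rfl
      exact ⟨p.add_mul k t, ⟨t, by ring⟩⟩
  · rw [Finset.card_eq_zero]
    apply Finset.filter_false_of_mem
    intro l hl h2
    rw [mem_fiber] at hl
    obtain ⟨t, -, h3⟩ := p.eq_add_of_dvd h2
    exact h (intCast_eq_iff.2 ⟨t, by linarith⟩)

theorem sharp_shift (p : PerFun D n) (k c : ℤ) :
    sharp (shift p k c) = sharp p - omega (p.1 k : ZMod n) + omega ((p.1 k + c : ℤ) : ZMod n) := by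
  funext x
  obtain ⟨j, rfl⟩ := exists_intCast_eq x
  have h := card_filter_shift p k c j (fun _ => True)
  unfold classCount at h
  simp only [Finset.filter_true, and_true, card_class] at h
  have e : ((j - c : ℤ) : ZMod n) = (p.1 k : ZMod n) ↔ (j : ZMod n) = ((p.1 k + c : ℤ) : ZMod n) := by
    push_cast
    rw [sub_eq_iff_eq_add]
  simp only [e] at h
  simp only [Pi.add_apply, Pi.sub_apply, sharp_intCast, omega, Pi.single_apply]
  have : (((fiber (shift p k c) j).card + (if (j : ZMod n) = (p.1 k : ZMod n) then 1 else 0) : ℕ) :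
      ℤ) = ((fiber p j).card + (if (j : ZMod n) = ((p.1 k + c : ℤ) : ZMod n) then 1 else 0) : ℕ) := by
    rw [h]
  push_cast at this ⊢
  linarith

theorem ncard_pair (q m : PerFun D n) (c j : ℤ) :
    {k : ℤ | q.1 k = c ∧ m.1 k = j}.ncard = ((fiber q c).filter fun k => m.1 k = j).card := by
  rw [← Set.ncard_coe_finset]
  congr 1
  ext k
  simp

theorem raiseMat_self (lam : PerFun D n) (i : ZMod n) (c : ℤ) :
    raiseMat lam i c c = sharp lam (c : ZMod n) - if (c : ZMod n) = i then 1 else 0 := by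
  simp [raiseMat, diagMat]

theorem raiseMat_succ (lam : PerFun D n) (i : ZMod n) (c : ℤ) :
    raiseMat lam i c (c + 1) = if (c : ZMod n) = i then 1 else 0 := by
  simp [raiseMat, diagMat]

theorem raiseMat_of_ne (lam : PerFun D n) (i : ZMod n) {c j : ℤ} (h1 : j ≠ c)
    (h2 : j ≠ c + 1) : raiseMat lam i c j = 0 := by
  simp [raiseMat, diagMat, h1, h2, Ne.symm h1]

/-- The support of the matrix on two diagonals says that `m` exceeds `q` by `0` or `1` at each
point, and the off-diagonal entry `1` says that the excess occurs on exactly one class. This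
converts a double coset into an explicit list of cosets. -/
theorem counts_raiseMat (q m lam : PerFun D n) (i : ℤ) :
    (∀ c j : ℤ, ({k : ℤ | q.1 k = c ∧ m.1 k = j}.ncard : ℤ) = raiseMat lam (i : ZMod n) c j) ↔
      sharp q = sharp lam ∧ ∃ k, q.1 k = i ∧ m = shift q k 1 := by
  simp only [ncard_pair]
  constructor
  · intro h
    -- The entry at `(q x, m x)` counts `x` and so is nonzero.
    have hne : ∀ x, m.1 x = q.1 x ∨ (m.1 x = q.1 x + 1 ∧ (q.1 x : ZMod n) = i) := by
      intro x
      have h1 : raiseMat lam (i : ZMod n) (q.1 x) (m.1 x) ≠ 0 := by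
        rw [← h]
        have : x ∈ (fiber q (q.1 x)).filter fun k => m.1 k = m.1 x := by simp
        exact_mod_cast (Finset.card_pos.2 ⟨x, this⟩).ne'
      by_cases h2 : m.1 x = q.1 x
      · exact Or.inl h2
      · right
        by_cases h3 : m.1 x = q.1 x + 1
        · refine ⟨h3, ?_⟩
          rw [h3, raiseMat_succ] at h1
          by_contra h4
          exact h1 (if_neg h4)
        · exact absurd (raiseMat_of_ne lam _ h2 h3) h1
    constructor
    · funext x
      obtain ⟨c, rfl⟩ := exists_intCast_eq x
      rw [sharp_intCast]
      have h1 := Finset.card_filter_add_card_filter_not (s := fiber q c) (fun k => m.1 k = c)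
      have h2 : (fiber q c).filter (fun k => ¬ m.1 k = c) =
          (fiber q c).filter (fun k => m.1 k = c + 1) := by
        apply Finset.filter_congr
        intro k hk
        rw [mem_fiber] at hk
        have := hne k
        rw [hk] at this
        omega
      rw [h2] at h1
      have h3 := h c c
      have h4 := h c (c + 1)
      rw [raiseMat_self] at h3
      rw [raiseMat_succ] at h4
      rw [← h1]
      push_cast
      linarith
    · have h1 := h i (i + 1)
      rw [raiseMat_succ, if_pos rfl] at h1
      obtain ⟨k, hk⟩ := Finset.card_eq_one.1 (by exact_mod_cast h1)
      have huniq : ∀ l, q.1 l = i → m.1 l = i + 1 → l = k := by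
        intro l hl hl'
        have : l ∈ (fiber q i).filter fun k => m.1 k = i + 1 := by simp [hl, hl']
        rw [hk] at this
        simpa using this
      have hkk : q.1 k = i ∧ m.1 k = i + 1 := by
        have : k ∈ (fiber q i).filter fun k => m.1 k = i + 1 := by rw [hk]; simp
        simpa using this
      refine ⟨k, hkk.1, PerFun.ext fun l => ?_⟩
      by_cases hd : (D : ℤ) ∣ l - k
      · rw [shift_apply_of_dvd q 1 hd]
        obtain ⟨t, rfl, h2⟩ := q.eq_add_of_dvd hd
        rw [h2, m.add_mul, hkk.1, hkk.2]
        ring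
      · rw [shift_apply_of_not_dvd q 1 hd]
        rcases hne l with h2 | ⟨h2, h3⟩
        · exact h2
        · exfalso
          -- A second raised point could be translated into the fiber over `i`, where only `k` is
          -- raised.
          obtain ⟨t, ht⟩ := intCast_eq_iff.1 h3
          have e1 := q.add_mul l (-t)
          have e2 := m.add_mul l (-t)
          have := huniq _ (by rw [e1, ht]; ring) (by rw [e2, h2, ht]; ring)
          exact hd ⟨t, by linarith⟩
  · rintro ⟨hs, k, hk, rfl⟩ c j
    have hcard := card_class q k c
    rw [hk] at hcard
    by_cases h1 : j = c
    · subst h1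
      rw [raiseMat_self, ← hs, sharp_intCast]
      have h2 := Finset.card_filter_add_card_filter_not (s := fiber q j) (fun l => (D : ℤ) ∣ l - k)
      have h3 : (fiber q j).filter (fun l => (shift q k 1).1 l = j) =
          (fiber q j).filter fun l => ¬ (D : ℤ) ∣ l - k := by
        apply Finset.filter_congr
        intro l hl
        rw [mem_fiber] at hl
        rw [shift_apply, hl]
        split_ifs with h <;> simp [h]
      rw [h3, ← h2, hcard]
      push_cast
      split_ifs <;> simp
    · by_cases h2 : j = c + 1
      · subst h2
        rw [raiseMat_succ]
        have h3 : (fiber q c).filter (fun l => (shift q k 1).1 l = c + 1) =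
            (fiber q c).filter fun l => (D : ℤ) ∣ l - k := by
          apply Finset.filter_congr
          intro l hl
          rw [mem_fiber] at hl
          rw [shift_apply, hl]
          split_ifs with h <;> simp [h]
        rw [h3, hcard]
        split_ifs <;> simp
      · rw [raiseMat_of_ne lam _ h1 h2]
        have : (fiber q c).filter (fun l => (shift q k 1).1 l = j) = ∅ := by
          apply Finset.filter_false_of_mem
          intro l hl h
          rw [mem_fiber] at hl
          rw [shift_apply, hl] at h
          split_ifs at h <;> omega
        rw [this]
        simp

theorem counts_diagMat (q m lam : PerFun D n) :
    (∀ c j : ℤ, ({k : ℤ | q.1 k = c ∧ m.1 k = j}.ncard : ℤ) = diagMat lam c j) ↔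
      sharp m = sharp lam ∧ q = m := by
  simp only [ncard_pair]
  constructor
  · intro h
    have e : q = m := by
      apply PerFun.ext
      intro x
      by_contra hc
      have h1 := h (q.1 x) (m.1 x)
      rw [diagMat, if_neg hc] at h1
      have : x ∈ (fiber q (q.1 x)).filter fun k => m.1 k = m.1 x := by simp
      have := Finset.card_pos.2 ⟨x, this⟩
      omega
    subst e
    refine ⟨?_, rfl⟩
    funext x
    obtain ⟨c, rfl⟩ := exists_intCast_eq x
    have h1 := h c c
    rw [diagMat, if_pos rfl, Finset.filter_true_of_mem fun k hk => mem_fiber.1 hk] at h1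
    rw [sharp_intCast, h1]
  · rintro ⟨hs, rfl⟩ c j
    unfold diagMat
    split_ifs with h
    · subst h
      rw [← hs, sharp_intCast, Finset.filter_true_of_mem fun k hk => mem_fiber.1 hk]
    · rw [Finset.filter_false_of_mem fun k hk => by rw [mem_fiber] at hk; rw [hk]; exact h]
      simp

/-! The exponents `y_s`. -/

theorem exists_rep (i : ZMod n) : ∃ r : ℤ, (1 ≤ r ∧ r ≤ n) ∧ (r : ZMod n) = i := by
  have hn := natCast_pos_of_neZero n
  obtain ⟨j, rfl⟩ := exists_intCast_eq i
  have h1 := Int.emod_nonneg (j - 1) hn.ne'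
  have h2 := Int.emod_lt_of_pos (j - 1) hn
  have h3 := Int.emod_add_mul_ediv (j - 1) n
  refine ⟨(j - 1) % n + 1, ⟨by omega, by omega⟩, intCast_eq_iff.2 ⟨-((j - 1) / n), by linarith⟩⟩

theorem rep_unique {a b : ℤ} (ha : 1 ≤ a ∧ a ≤ n) (hb : 1 ≤ b ∧ b ≤ n)
    (h : (a : ZMod n) = (b : ZMod n)) : a = b := by
  obtain ⟨t, ht⟩ := intCast_eq_iff.1 h
  rcases lt_trichotomy t 0 with h | h | h
  · nlinarith
  · subst h; simpa using ht
  · nlinarith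

/-- For the bidiagonal matrices needed here, the inequalities leave at most one pair of nonzero
entries, so the sum reduces to one product. -/
theorem ydim_eq_single {s : ℤ → ℤ → ℤ} (x : (ℤ × ℤ) × (ℤ × ℤ))
    (hx : x.2.1 ≤ x.1.1 ∧ x.1.2 < x.2.2 ∧ 1 ≤ x.1.1 ∧ x.1.1 ≤ n)
    (h : ∀ a b c d : ℤ, c ≤ a → b < d → 1 ≤ a → a ≤ n → s a b ≠ 0 → s c d ≠ 0 →
      ((a, b), (c, d)) = x) : ydim n s = s x.1.1 x.1.2 * s x.2.1 x.2.2 := by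
  unfold ydim
  rw [finsum_mem_def, finsum_eq_single _ x, Set.indicator_of_mem]
  · exact hx
  · rintro ⟨⟨a, b⟩, ⟨c, d⟩⟩ hne
    apply Set.indicator_apply_eq_zero.2
    rintro ⟨h1, h2, h3, h4⟩
    by_contra hcon
    exact hne (h a b c d h1 h2 h3 h4 (left_ne_zero_of_mul hcon) (right_ne_zero_of_mul hcon))

theorem raiseMat_ne_zero {lam : PerFun D n} {i : ZMod n} {c j : ℤ} (h : raiseMat lam i c j ≠ 0) :
    j = c ∨ (j = c + 1 ∧ (c : ZMod n) = i) := by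
  by_cases h1 : j = c
  · exact Or.inl h1
  · by_cases h2 : j = c + 1
    · refine Or.inr ⟨h2, ?_⟩
      rw [h2, raiseMat_succ] at h
      by_contra h3
      exact h (if_neg h3)
    · exact absurd (raiseMat_of_ne lam i h1 h2) h

/-- For nonzero entries at `(a, b)` and `(c, d)` one has `a ≤ b < d ≤ c + 1 ≤ a + 1`, which forces
the diagonal entry and its right neighbour in one row. -/
theorem ydim_raiseMat (lam : PerFun D n) (i : ZMod n) :
    ydim n (raiseMat lam i) = sharp lam i - 1 := by
  obtain ⟨r, hr, rfl⟩ := exists_rep i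
  rw [ydim_eq_single ((r, r), (r, r + 1)) ⟨le_rfl, lt_add_one r, hr.1, hr.2⟩]
  · simp only [raiseMat_self, raiseMat_succ, if_true, mul_one]
  · intro a b c d h1 h2 h3 h4 h5 h6
    have e1 := raiseMat_ne_zero h5
    have e2 := raiseMat_ne_zero h6
    have e3 : a = c ∧ b = c ∧ d = c + 1 := by omega
    obtain ⟨rfl, rfl, rfl⟩ := e3
    rcases e2 with e2 | ⟨-, e2⟩
    · omega
    · rw [rep_unique ⟨h3, h4⟩ hr e2]

theorem ydim_raiseMat_transpose (hn : 2 ≤ n) (lam : PerFun D n) (i : ZMod n) :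
    ydim n (fun k j => raiseMat lam i j k) = sharp lam (i + 1) := by
  obtain ⟨r, hr, hri⟩ := exists_rep (i + 1)
  have hri' : ((r - 1 : ℤ) : ZMod n) = i := by push_cast; rw [hri, add_sub_cancel_right]
  rw [ydim_eq_single ((r, r - 1), (r, r)) ⟨le_rfl, sub_one_lt r, hr.1, hr.2⟩]
  · simp only [raiseMat_self]
    have := raiseMat_succ lam i (r - 1)
    rw [sub_add_cancel, if_pos hri'] at this
    rw [this, hri, if_neg (intCast_add_one_ne hn i)]
    ring
  · intro a b c d h1 h2 h3 h4 h5 h6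
    have e1 := raiseMat_ne_zero h5
    have e2 := raiseMat_ne_zero h6
    have e3 : c = a ∧ b = a - 1 ∧ d = a := by omega
    obtain ⟨rfl, rfl, rfl⟩ := e3
    rcases e1 with e1 | ⟨-, e1⟩
    · omega
    · have : (d : ZMod n) = (r : ZMod n) := by
        rw [hri, ← e1]; push_cast; ring
      rw [rep_unique ⟨h3, h4⟩ hr this]

theorem ydim_diagMat (lam : PerFun D n) : ydim n (diagMat lam) = 0 := by
  have hn := natCast_pos_of_neZero n
  -- No pair contributes; the chosen one is an arbitrary admissible pair whose product is zero.
  rw [ydim_eq_single ((1, 1), (1, 2)) ⟨le_rfl, by norm_num, le_rfl, by simp only; omega⟩]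
  · simp [diagMat]
  · intro a b c d h1 h2 h3 h4 h5 h6
    have e1 : a = b := by by_contra h; exact h5 (if_neg h)
    have e2 : c = d := by by_contra h; exact h6 (if_neg h)
    omega

end counts

/-! ### The operators as elements of the Schur algebra -/

section operators
variable {D n : ℕ} [NeZero D] [NeZero n]

/-- The cosets are disjoint: a nonzero shift remembers the class that was moved, and a class meets
the fiber over `a` at most once. -/
theorem exists_finset_cosets (l m : PerFun D n) (a : ℤ) {c : ℤ} (hc : c ≠ 0) :
    ∃ Y : Finset (affSym D), (∀ w, w ∈ Y ↔ ∃ k, m.1 k = a ∧ l.comp w = shift m k c) ∧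
      ∑ w ∈ Y, heckeT w = ∑ k ∈ fiber m a, cosetSum l (shift m k c) := by
  classical
  refine ⟨(fiber m a).biUnion fun k => (coset_finite l (shift m k c)).toFinset, ?_, ?_⟩
  · intro w
    simp only [Finset.mem_biUnion, mem_fiber, Set.Finite.mem_toFinset, mem_coset]
  · rw [Finset.sum_biUnion]
    · rfl
    · intro k hk k' hk' hne
      rw [Function.onFun, Finset.disjoint_left]
      intro w hw hw'
      rw [Set.Finite.mem_toFinset, mem_coset] at hw hw'
      apply hne
      have e : (shift m k c).1 k = (shift m k' c).1 k := by rw [← hw, ← hw']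
      rw [shift_apply_self, shift_apply] at e
      have hd : (D : ℤ) ∣ k - k' := by
        by_contra h
        rw [if_neg h] at e
        exact hc (by linarith)
      have hk := mem_fiber.1 (Finset.mem_coe.1 hk)
      have hk' := mem_fiber.1 (Finset.mem_coe.1 hk')
      exact m.eq_of_dvd hd (hk.trans hk'.symm)

theorem doubleCosetSum_raiseMat (l m : Dom D n) (lam : PerFun D n) (i : ℤ) :
    doubleCosetSum l.1 (raiseMat lam (i : ZMod n)) m.1 =
      if sharp l.1 = sharp lam then ∑ k ∈ fiber m.1 (i + 1), cosetSum l.1 (shift m.1 k (-1))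
      else 0 := by
  have hmem : ∀ w, w ∈ doubleCoset l.1 (raiseMat lam (i : ZMod n)) m.1 ↔
      sharp l.1 = sharp lam ∧ ∃ k, m.1.1 k = i + 1 ∧ l.1.comp w = shift m.1 k (-1) := by
    intro w
    rw [← sharp_comp l.1 w]
    refine (counts_raiseMat (l.1.comp w) m.1 lam i).trans (and_congr_right fun _ => ?_)
    refine exists_congr fun k => ?_
    constructor
    · rintro ⟨h1, h2⟩
      rw [h2, shift_apply_self, shift_shift, add_neg_cancel, shift_zero, h1]
      exact ⟨rfl, rfl⟩
    · rintro ⟨h1, h2⟩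
      rw [h2, shift_apply_self, shift_shift, neg_add_cancel, shift_zero, h1]
      exact ⟨by ring, rfl⟩
  unfold doubleCosetSum
  split_ifs with h
  · obtain ⟨Y, hY, hs⟩ := exists_finset_cosets l.1 m.1 (i + 1) (c := -1) (by norm_num)
    rw [← hs]
    refine Finset.sum_congr (Finset.ext fun w => ?_) fun _ _ => rfl
    rw [Set.Finite.mem_toFinset, hmem, hY]
    exact and_iff_right h
  · apply Finset.sum_eq_zero
    intro w hw
    rw [Set.Finite.mem_toFinset, hmem] at hw
    exact absurd hw.1 h

theorem doubleCosetSum_raiseMat_transpose (l m : Dom D n) (lam : PerFun D n) (i : ℤ) :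
    doubleCosetSum l.1 (fun k j => raiseMat lam (i : ZMod n) j k) m.1 =
      if sharp m.1 = sharp lam then ∑ k ∈ fiber m.1 i, cosetSum l.1 (shift m.1 k 1)
      else 0 := by
  have hmem : ∀ w, w ∈ doubleCoset l.1 (fun k j => raiseMat lam (i : ZMod n) j k) m.1 ↔
      sharp m.1 = sharp lam ∧ ∃ k, m.1.1 k = i ∧ l.1.comp w = shift m.1 k 1 := by
    intro w
    refine Iff.trans ?_ (counts_raiseMat m.1 (l.1.comp w) lam i)
    constructor
    · intro h c j
      refine Eq.trans ?_ (h j c)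
      congr 2
      ext k
      exact and_comm
    · intro h j c
      refine Eq.trans ?_ (h c j)
      congr 2
      ext k
      exact and_comm
  unfold doubleCosetSum
  split_ifs with h
  · obtain ⟨Y, hY, hs⟩ := exists_finset_cosets l.1 m.1 i (c := 1) (by norm_num)
    rw [← hs]
    refine Finset.sum_congr (Finset.ext fun w => ?_) fun _ _ => rfl
    rw [Set.Finite.mem_toFinset, hmem, hY]
    exact and_iff_right h
  · apply Finset.sum_eq_zero
    intro w hw
    rw [Set.Finite.mem_toFinset, hmem] at hw
    exact absurd hw.1 h

theorem doubleCosetSum_diagMat (l m : Dom D n) (lam : PerFun D n) :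
    doubleCosetSum l.1 (diagMat lam) m.1 =
      if sharp m.1 = sharp lam then cosetSum l.1 m.1 else 0 := by
  have hmem : ∀ w, w ∈ doubleCoset l.1 (diagMat lam) m.1 ↔
      sharp m.1 = sharp lam ∧ l.1.comp w = m.1 := fun w => counts_diagMat (l.1.comp w) m.1 lam
  unfold doubleCosetSum
  split_ifs with h
  · refine Finset.sum_congr (Finset.ext fun w => ?_) fun _ _ => rfl
    rw [Set.Finite.mem_toFinset, Set.Finite.mem_toFinset, hmem, mem_coset]
    exact and_iff_right h
  · apply Finset.sum_eq_zero
    intro w hw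
    rw [Set.Finite.mem_toFinset, hmem] at hw
    exact absurd hw.1 h

theorem moveSum_apply (ε : ℤ) (p : PerFun D n) (a : ℤ) (l : Dom D n) :
    ((moveSum ε p a l : _) : Hecke D) = ∑ k ∈ fiber p a, cosetSum l.1 (shift p k (-ε)) := by
  unfold moveSum
  rw [Finset.sum_apply, AddSubmonoidClass.coe_finsetSum]
  rfl

/-- The stabilizer of `m` permutes the fiber over `a`, and shifting is compatible with composition.
So the union of the cosets is stable on the right, and its sum is a left multiple of `T_m`. -/
theorem exists_moveOp {ε : ℤ} (hε : ε ≠ 0) (a : ℤ) : ∃ S : Schur D n, ∀ m : Dom D n,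
    S (Tvec m.1) =
      (LaurentPolynomial.T ((fiber m.1 (a - ε)).card : ℤ) : BaseA) • moveSum ε m.1 a := by
  refine exists_schur _ fun m l => ?_
  obtain ⟨Y, hY, hs⟩ := exists_finset_cosets l.1 m.1 a (c := -ε) (by simpa using hε)
  obtain ⟨X, hX⟩ := exists_mul_cosetSum m Y fun w hw u hu => by
    rw [hY] at hw ⊢
    obtain ⟨k, hk, e⟩ := hw
    refine ⟨u.1.symm k, ?_, ?_⟩
    · rw [← hu]; simpa using hk
    · change (l.1.comp w).comp u = _
      rw [e]
      have := shift_comp m.1 u (u.1.symm k) (-ε)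
      rw [Equiv.apply_symm_apply] at this
      rw [this, mem_coset.1 hu]
  refine ⟨(LaurentPolynomial.T ((fiber m.1 (a - ε)).card : ℤ) : BaseA) • X, ?_⟩
  rw [TMod.smul_apply, moveSum_apply, smul_mul_assoc, hX, hs]

/-- The operator `e_i` on `T_D`. -/
noncomputable def eOp (i : ZMod n) : Schur D n :=
  (exists_moveOp (ε := 1) (by norm_num) ((i.val : ℤ) + 1)).choose

/-- The operator `f_i` on `T_D`. -/
noncomputable def fOp (i : ZMod n) : Schur D n :=
  (exists_moveOp (ε := -1) (by norm_num) (i.val : ℤ)).choose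

theorem shift_add_mul (p : PerFun D n) (k c t : ℤ) : shift p (k + D * t) c = shift p k c := by
  apply PerFun.ext
  intro l
  have : (D : ℤ) ∣ l - (k + D * t) ↔ (D : ℤ) ∣ l - k := by
    rw [show l - (k + D * t) = l - k + D * (-t) by ring]
    exact dvd_add_left (Dvd.intro _ rfl)
  simp only [shift_apply, this]

theorem moveSum_add_mul (ε : ℤ) (p : PerFun D n) (a t : ℤ) :
    moveSum ε p (a + n * t) = moveSum ε p a := by
  unfold moveSum
  symm
  refine Finset.sum_bij (fun k _ => k + D * t) ?_ ?_ ?_ ?_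
  · intro k hk
    rw [mem_fiber] at hk ⊢
    rw [p.add_mul, hk]
  · intro a _ b _ h; exact add_right_cancel h
  · intro k hk
    refine ⟨k + D * (-t), ?_, by ring⟩
    rw [mem_fiber] at hk ⊢
    rw [p.add_mul, hk]; ring
  · intro k _
    rw [shift_add_mul]

theorem eOp_Tvec (i : ℤ) (m : Dom D n) : eOp (i : ZMod n) (Tvec m.1) =
    (LaurentPolynomial.T ((fiber m.1 (i + 1 - 1)).card : ℤ) : BaseA) • moveSum 1 m.1 (i + 1) := by
  obtain ⟨t, ht⟩ := intCast_eq_iff (n := n) (a := (((i : ZMod n).val : ℕ) : ℤ)) (b := i).1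
    (by simp)
  unfold eOp
  rw [(exists_moveOp (ε := 1) one_ne_zero _).choose_spec, ht,
    show i + n * t + 1 - 1 = i + 1 - 1 + n * t by ring,
    show i + n * t + 1 = i + 1 + n * t by ring, card_fiber_add_mul, moveSum_add_mul]

theorem fOp_Tvec (i : ℤ) (m : Dom D n) : fOp (i : ZMod n) (Tvec m.1) =
    (LaurentPolynomial.T ((fiber m.1 (i - -1)).card : ℤ) : BaseA) • moveSum (-1) m.1 i := by
  obtain ⟨t, ht⟩ := intCast_eq_iff (n := n) (a := (((i : ZMod n).val : ℕ) : ℤ)) (b := i).1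
    (by simp)
  unfold fOp
  rw [(exists_moveOp (ε := -1) (by norm_num) _).choose_spec, ht,
    show i + n * t - -1 = i - -1 + n * t by ring, card_fiber_add_mul, moveSum_add_mul]

theorem eOp_normVec (hn : 2 ≤ n) (i : ℤ) (p : PerFun D n) :
    eOp (i : ZMod n) (normVec p) = normMove 1 p (i + 1) :=
  apply_normVec hn (Or.inl rfl) (eOp_Tvec i) p

theorem fOp_normVec (hn : 2 ≤ n) (i : ℤ) (p : PerFun D n) :
    fOp (i : ZMod n) (normVec p) = normMove (-1) p i :=
  apply_normVec hn (Or.inr rfl) (fOp_Tvec i) p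

theorem schur_ext_normVec {S S' : Schur D n} (h : ∀ p : PerFun D n, S (normVec p) = S' (normVec p)) :
    S = S' := by
  apply schur_ext
  intro m
  have : Tvec m.1 = (LaurentPolynomial.T (-(xdim m.1 : ℤ)) : BaseA) • normVec m.1 := by
    unfold normVec
    rw [smul_smul, ← LaurentPolynomial.T_add, neg_add_cancel, LaurentPolynomial.T_zero, one_smul]
  rw [this, schur_smul, schur_smul, h]

/-! Relations between the operators. -/

theorem weightOp_mul (c d : (ZMod n → ℤ) → BaseA) :
    (weightOp c : Schur D n) * weightOp d = weightOp fun μ => c μ * d μ := by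
  apply schur_ext
  intro m
  rw [Module.End.mul_apply, weightOp_Tvec, weightOp_Tvec, schur_smul, weightOp_Tvec, smul_smul,
    mul_comm]

theorem weightOp_one : (weightOp (fun _ => 1) : Schur D n) = 1 := by
  apply schur_ext
  intro m
  rw [weightOp_Tvec, one_smul, Module.End.one_apply]

theorem weightOp_smul (a : BaseA) (c : (ZMod n → ℤ) → BaseA) :
    a • (weightOp c : Schur D n) = weightOp fun μ => a * c μ := by
  apply schur_ext
  intro m
  rw [LinearMap.smul_apply, weightOp_Tvec, weightOp_Tvec, smul_smul]

theorem weightOp_congr {c d : (ZMod n → ℤ) → BaseA} (h : ∀ p : PerFun D n, c (sharp p) = d (sharp p)) :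
    (weightOp c : Schur D n) = weightOp d := by
  apply schur_ext
  intro m
  rw [weightOp_Tvec, weightOp_Tvec, h]

theorem weightOp_mul_eOp (i : ZMod n) (c : (ZMod n → ℤ) → BaseA) :
    weightOp c * eOp i =
      (eOp i : Schur D n) * weightOp fun μ => c (μ - omega (i + 1) + omega i) := by
  obtain ⟨i, rfl⟩ := exists_intCast_eq i
  apply schur_ext
  intro m
  rw [Module.End.mul_apply, Module.End.mul_apply, weightOp_Tvec, schur_smul, eOp_Tvec, schur_smul,
    smul_comm]
  congr 1
  unfold moveSum
  rw [map_sum, Finset.smul_sum]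
  refine Finset.sum_congr rfl fun k hk => ?_
  rw [mem_fiber] at hk
  rw [weightOp_Tvec, sharp_shift, hk, add_neg_cancel_right]
  push_cast
  rfl

theorem weightOp_mul_fOp (i : ZMod n) (c : (ZMod n → ℤ) → BaseA) :
    weightOp c * fOp i =
      (fOp i : Schur D n) * weightOp fun μ => c (μ - omega i + omega (i + 1)) := by
  obtain ⟨i, rfl⟩ := exists_intCast_eq i
  apply schur_ext
  intro m
  rw [Module.End.mul_apply, Module.End.mul_apply, weightOp_Tvec, schur_smul, fOp_Tvec, schur_smul,
    smul_comm]
  congr 1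
  unfold moveSum
  rw [map_sum, Finset.smul_sum]
  refine Finset.sum_congr rfl fun k hk => ?_
  rw [mem_fiber] at hk
  rw [weightOp_Tvec, sharp_shift, hk, neg_neg]
  push_cast
  rfl

theorem eOp_mul_fOp_of_ne (hn : 2 ≤ n) {i j : ZMod n} (h : i ≠ j) :
    (eOp i : Schur D n) * fOp j = fOp j * eOp i := by
  obtain ⟨i, rfl⟩ := exists_intCast_eq i
  obtain ⟨j, rfl⟩ := exists_intCast_eq j
  apply schur_ext_normVec
  intro p
  rw [Module.End.mul_apply, Module.End.mul_apply, ← sub_eq_zero,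
    commutator_normVec (eOp_normVec hn i) (fOp_normVec hn j), returnSum_eq_zero p h.symm,
    returnSum_eq_zero, sub_zero]
  push_cast
  exact fun h' => h (add_right_cancel h')

theorem eOp_fOp_commutator (hn : 2 ≤ n) (i : ZMod n) :
    ((LaurentPolynomial.T 1 : BaseA) - LaurentPolynomial.T (-1)) •
      ((eOp i : Schur D n) * fOp i - fOp i * eOp i) =
      weightOp (fun μ => LaurentPolynomial.T (μ i - μ (i + 1))) -
        weightOp fun μ => LaurentPolynomial.T (-(μ i - μ (i + 1))) := by
  obtain ⟨i, rfl⟩ := exists_intCast_eq i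
  apply schur_ext_normVec
  intro p
  rw [LinearMap.smul_apply, LinearMap.sub_apply, Module.End.mul_apply, Module.End.mul_apply,
    commutator_normVec_self hn (eOp_normVec hn i) (fOp_normVec hn i), LinearMap.sub_apply,
    weightOp_normVec, weightOp_normVec]
  have e : ((i : ZMod n) + 1) = ((i + 1 : ℤ) : ZMod n) := by push_cast; rfl
  rw [e, sharp_intCast, sharp_intCast]
  exact sub_smul (LaurentPolynomial.T _ : BaseA) (LaurentPolynomial.T _) (normVec p)

/-- The projection of `T_D` to the sum of the components of weight `μ`. -/
noncomputable def weightProj (μ : ZMod n → ℤ) : Schur D n :=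
  weightOp fun ν => if ν = μ then 1 else 0

/-! Identification of the operators with the elements `T_s`. -/

theorem weightOp_apply_apply (c : (ZMod n → ℤ) → BaseA) (x : TMod D n) (l : Dom D n) :
    ((weightOp c x l : _) : Hecke D) = c (sharp l.1) • (x l : Hecke D) := rfl

theorem isSchurT_weightProj (lam : PerFun D n) :
    IsSchurT (diagMat lam) (weightProj (sharp lam) : Schur D n) := by
  intro m l
  unfold weightProj
  rw [weightOp_Tvec, TMod.smul_apply, Tvec_apply, doubleCosetSum_diagMat]
  split_ifs <;> simp

theorem isSchurT_eOp (hn : 2 ≤ n) (lam : PerFun D n) (i : ZMod n) :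
    IsSchurT (raiseMat lam i)
      ((LaurentPolynomial.T (-(sharp lam i - 1)) : BaseA) •
        ((weightProj (sharp lam) : Schur D n) * eOp i)) := by
  obtain ⟨i, rfl⟩ := exists_intCast_eq i
  intro m l
  unfold weightProj
  rw [LinearMap.smul_apply, Module.End.mul_apply, TMod.smul_apply, weightOp_apply_apply, eOp_Tvec,
    TMod.smul_apply, moveSum_apply, doubleCosetSum_raiseMat]
  split_ifs with h
  · rw [one_smul, smul_smul, ← LaurentPolynomial.T_add, Finset.smul_sum]
    refine Finset.sum_congr rfl fun k hk => ?_
    rw [mem_fiber] at hk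
    -- Weights can be compared only if the coset is nonempty. Then `♯l_i` exceeds `♯m_i` by one,
    -- since the moved point arrives at `i` and, as `i + 1 ≠ i`, none leaves; the powers of `v`
    -- cancel.
    by_cases hc : (coset l.1 (shift m.1 k (-1))).Nonempty
    · have e := sharp_eq_of_coset hc
      have e2 : sharp lam (i : ZMod n) = (fiber m.1 i).card + 1 := by
        rw [← h, e, sharp_shift, hk, add_neg_cancel_right, ← sharp_intCast]
        simp only [Pi.add_apply, Pi.sub_apply, omega, Pi.single_apply]
        rw [if_pos trivial, if_neg, sub_zero]
        push_cast
        exact (intCast_add_one_ne hn _).symm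
      rw [e2, add_sub_cancel_right, add_sub_cancel_right, neg_add_cancel, LaurentPolynomial.T_zero,
        one_smul]
    · rw [cosetSum_eq_zero hc, smul_zero]
  · rw [zero_smul, smul_zero]

theorem isSchurT_fOp (lam : PerFun D n) (i : ZMod n) :
    IsSchurT (fun k j => raiseMat lam i j k)
      ((LaurentPolynomial.T (-sharp lam (i + 1)) : BaseA) •
        ((fOp i : Schur D n) * weightProj (sharp lam))) := by
  obtain ⟨i, rfl⟩ := exists_intCast_eq i
  intro m l
  unfold weightProj
  rw [LinearMap.smul_apply, Module.End.mul_apply, TMod.smul_apply, weightOp_Tvec, schur_smul,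
    fOp_Tvec, TMod.smul_apply, TMod.smul_apply, moveSum_apply, doubleCosetSum_raiseMat_transpose]
  have e : ((i : ZMod n) + 1) = ((i + 1 : ℤ) : ZMod n) := by push_cast; rfl
  split_ifs with h
  · rw [one_smul, smul_smul, ← LaurentPolynomial.T_add, ← h, e, sharp_intCast, sub_neg_eq_add,
      neg_add_cancel, LaurentPolynomial.T_zero, one_smul, neg_neg]
  · rw [zero_smul, smul_zero]

end operators

/-! Quantum integers. -/

theorem algebraMap_T (m : ℤ) :
    algebraMap BaseA BaseK (LaurentPolynomial.T m) = v ^ m := by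
  have hinv : v * algebraMap BaseA BaseK (LaurentPolynomial.T (-1)) = 1 := by
    rw [v, ← map_mul, ← LaurentPolynomial.T_add, add_neg_cancel, LaurentPolynomial.T_zero, map_one]
  have hv : v ≠ 0 := left_ne_zero_of_mul_eq_one hinv
  have hinv' : algebraMap BaseA BaseK (LaurentPolynomial.T (-1)) = v⁻¹ :=
    eq_inv_of_mul_eq_one_right hinv
  induction m using Int.induction_on with
  | zero => simp
  | succ i ih => rw [LaurentPolynomial.T_add, map_mul, ih, zpow_add_one₀ hv]; rfl
  | pred i ih =>
    rw [sub_eq_add_neg, LaurentPolynomial.T_add, map_mul, ih, hinv', ← sub_eq_add_neg,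
      zpow_sub_one₀ hv]

theorem v_ne_zero : v ≠ 0 := by
  intro h
  have := algebraMap_T (-1)
  have h1 : algebraMap BaseA BaseK (LaurentPolynomial.T 1) *
      algebraMap BaseA BaseK (LaurentPolynomial.T (-1)) = 1 := by
    rw [← map_mul, ← LaurentPolynomial.T_add, add_neg_cancel, LaurentPolynomial.T_zero, map_one]
  rw [algebraMap_T, zpow_one, h, zero_mul] at h1
  exact zero_ne_one h1

theorem v_zpow_ne_one {m : ℤ} (hm : m ≠ 0) : v ^ m ≠ 1 := by
  intro h
  rw [← algebraMap_T, ← map_one (algebraMap BaseA BaseK)] at h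
  have h1 := IsFractionRing.injective BaseA BaseK h
  rw [← LaurentPolynomial.T_zero] at h1
  exact hm (AddMonoidAlgebra.single_left_injective one_ne_zero h1)

theorem v_sub_inv_ne_zero : v - v⁻¹ ≠ 0 := by
  intro h
  have h1 : v = v⁻¹ := sub_eq_zero.1 h
  apply v_zpow_ne_one (m := 2) two_ne_zero
  rw [zpow_two]
  nth_rewrite 1 [h1]
  exact inv_mul_cancel₀ v_ne_zero

theorem qInt_ne_zero {m : ℤ} (hm : m ≠ 0) : qInt m ≠ 0 := by
  unfold qInt
  apply div_ne_zero _ v_sub_inv_ne_zero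
  intro h
  apply v_zpow_ne_one (m := m + m) (by omega)
  have h1 : v ^ m = v ^ (-m) := sub_eq_zero.1 h
  rw [zpow_add₀ v_ne_zero]
  nth_rewrite 1 [h1]
  rw [← zpow_add₀ v_ne_zero, neg_add_cancel, zpow_zero]

theorem qInt_zero : qInt 0 = 0 := by simp [qInt]

theorem qInt_mul_zpow (t k : ℤ) : qInt t * v ^ k = qInt (t - k) + v ^ t * qInt k := by
  have hv := v_ne_zero
  have hd := v_sub_inv_ne_zero
  unfold qInt
  rw [zpow_neg, zpow_neg, zpow_neg, zpow_sub₀ hv]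
  have h1 : v ^ t ≠ 0 := zpow_ne_zero _ hv
  have h2 : v ^ k ≠ 0 := zpow_ne_zero _ hv
  generalize v ^ t = a at *
  generalize v ^ k = b at *
  generalize v - v⁻¹ = d at *
  field_simp
  ring

/-- The recursion for the coefficient with which `f` acts along an `sl_2` string. -/
theorem qInt_mul_qInt_succ (t m : ℤ) :
    qInt (t + 1) * qInt (t + 1 - m) = qInt t * qInt (t - m) + qInt (1 - m + 2 * t) := by
  have hv := v_ne_zero
  have hd := v_sub_inv_ne_zero
  unfold qInt
  have e1 : v ^ (t + 1) = v ^ t * v := zpow_add_one₀ hv t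
  have e2 : v ^ (t - m) = v ^ t / v ^ m := zpow_sub₀ hv t m
  have e3 : v ^ (t + 1 - m) = v ^ t * v / v ^ m := by rw [zpow_sub₀ hv, e1]
  have e4 : v ^ (1 - m + 2 * t) = v ^ t * v ^ t * v / v ^ m := by
    rw [show 1 - m + 2 * t = t + t + 1 - m by ring, zpow_sub₀ hv, zpow_add_one₀ hv, zpow_add₀ hv]
  rw [zpow_neg, zpow_neg, zpow_neg, zpow_neg, zpow_neg, e1, e2, e3, e4]
  have h1 : v ^ t ≠ 0 := zpow_ne_zero _ hv
  have h2 : v ^ m ≠ 0 := zpow_ne_zero _ hv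
  generalize v ^ t = a at *
  generalize v ^ m = b at *
  rw [div_mul_div_comm, div_mul_div_comm, div_add_div _ _ (mul_ne_zero hd hd) hd,
    div_eq_div_iff (mul_ne_zero hd hd) (mul_ne_zero (mul_ne_zero hd hd) hd)]
  field_simp
  ring

theorem qFact_succ (k : ℕ) : qFact (k + 1) = qFact k * qInt ((k : ℤ) + 1) := by
  unfold qFact
  rw [Finset.prod_range_succ]

theorem qFact_ne_zero (k : ℕ) : qFact k ≠ 0 := by
  unfold qFact
  exact Finset.prod_ne_zero_iff.2 fun m _ => qInt_ne_zero (by omega)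

/-- The commutator of `z` with a `q`-commutator of `x` and `u`. -/
theorem commutator_step {K R : Type*} [Field K] [Ring R] [Algebra K R] {x z h h' u : R} {d s : K}
    (hxz : x * z - z * x = d⁻¹ • (h - h')) (i1 : h * u = s • (u * h))
    (i2 : h' * u = s⁻¹ • (u * h')) :
    z * (x * u - s • (u * x)) - (x * u - s • (u * x)) * z =
      x * (z * u - u * z) - s • ((z * u - u * z) * x) - ((s - s⁻¹) / d) • (u * h') := by
  have e0 : z * x = x * z - d⁻¹ • (h - h') := by rw [← hxz]; abel
  have e1 : z * (x * u) = x * (z * u) - d⁻¹ • (s • (u * h) - s⁻¹ • (u * h')) := by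
    rw [← mul_assoc, e0, sub_mul, mul_assoc, smul_mul_assoc, sub_mul, i1, i2]
  have e2 : u * x * z = u * (z * x) + d⁻¹ • (u * h - u * h') := by
    rw [mul_assoc, show x * z = z * x + d⁻¹ • (h - h') by rw [← hxz]; abel, mul_add,
      mul_smul_comm, mul_sub]
  rw [mul_sub, mul_smul_comm, e1, sub_mul, smul_mul_assoc, e2, mul_sub, sub_mul,
    show z * (u * x) = z * u * x from (mul_assoc _ _ _).symm,
    show x * u * z = x * (u * z) from mul_assoc _ _ _,
    show u * (z * x) = u * z * x from (mul_assoc _ _ _).symm, div_eq_mul_inv]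
  module

/-! ### Serre relations from nilpotency -/

section serre
variable {R : Type*} [Ring R] [Algebra BaseK R]

theorem qInt_smul_divPow_succ (x : R) (k : ℕ) :
    qInt ((k : ℤ) + 1) • divPow x (k + 1) = divPow x k * x := by
  unfold divPow
  rw [smul_smul, qFact_succ, mul_inv, mul_comm, mul_assoc, inv_mul_cancel₀ (qInt_ne_zero (by omega)),
    mul_one, smul_mul_assoc, pow_succ]

theorem mul_divPow_comm (x : R) (k : ℕ) : divPow x k * x = x * divPow x k := by
  unfold divPow
  rw [smul_mul_assoc, mul_smul_comm, ← pow_succ, ← pow_succ']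

/-- The iterated `q`-commutators of `x` and `y`, for `y` of weight `1 - N`. -/
noncomputable def qAd (N : ℕ) (x y : R) : ℕ → R
  | 0 => y
  | t + 1 => x * qAd N x y t - v ^ (1 - (N : ℤ) + 2 * t) • (qAd N x y t * x)

/-- The expansion of `qAd`, divided by the quantum factorial. -/
noncomputable def qAdDiv (N : ℕ) (x y : R) (t : ℕ) : R :=
  ∑ k ∈ Finset.range (t + 1),
    ((-1) ^ k * v ^ ((k : ℤ) * (t - N))) • (divPow x (t - k) * y * divPow x k)

/-- This is the Pascal recursion for quantum binomial coefficients, contained in `qInt_mul_zpow`. -/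
theorem qInt_smul_qAdDiv_succ (N : ℕ) (x y : R) (t : ℕ) :
    qInt ((t : ℤ) + 1) • qAdDiv N x y (t + 1) =
      x * qAdDiv N x y t - v ^ (1 - (N : ℤ) + 2 * t) • (qAdDiv N x y t * x) := by
  have hv := v_ne_zero
  have e1 : x * qAdDiv N x y t = ∑ k ∈ Finset.range (t + 1 + 1),
      ((-1) ^ k * v ^ ((k : ℤ) * (t - N)) * qInt ((t : ℤ) + 1 - k)) •
        (divPow x (t + 1 - k) * y * divPow x k) := by
    rw [Finset.sum_range_succ]
    push_cast
    rw [sub_self, qInt_zero, mul_zero, zero_smul, add_zero]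
    unfold qAdDiv
    rw [Finset.mul_sum]
    refine Finset.sum_congr rfl fun k hk => ?_
    have hk' : k ≤ t := by rw [Finset.mem_range] at hk; omega
    have h1 := qInt_smul_divPow_succ x (t - k)
    rw [mul_divPow_comm, show t - k + 1 = t + 1 - k by omega,
      show ((t - k : ℕ) : ℤ) + 1 = (t : ℤ) + 1 - k by omega] at h1
    rw [mul_smul_comm, ← mul_assoc, ← mul_assoc, ← h1, smul_mul_assoc, smul_mul_assoc, smul_smul]
  have e2 : v ^ (1 - (N : ℤ) + 2 * t) • (qAdDiv N x y t * x) =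
      -∑ k ∈ Finset.range (t + 1 + 1),
      ((-1) ^ k * v ^ ((k : ℤ) * (t - N)) * (v ^ ((t : ℤ) + 1) * qInt (k : ℤ))) •
        (divPow x (t + 1 - k) * y * divPow x k) := by
    rw [Finset.sum_range_succ']
    push_cast
    rw [qInt_zero, mul_zero, mul_zero, zero_smul, add_zero]
    unfold qAdDiv
    rw [Finset.sum_mul, Finset.smul_sum, ← Finset.sum_neg_distrib]
    refine Finset.sum_congr rfl fun k hk => ?_
    rw [smul_mul_assoc, mul_assoc, ← qInt_smul_divPow_succ x k, mul_smul_comm, smul_smul, smul_smul,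
      ← neg_smul]
    congr 1
    have h1 : v ^ (((k : ℤ) + 1) * ((t : ℤ) - N)) * v ^ ((t : ℤ) + 1) =
        v ^ (1 - (N : ℤ) + 2 * t) * v ^ ((k : ℤ) * (t - N)) := by
      rw [← zpow_add₀ hv, ← zpow_add₀ hv]
      congr 1
      ring
    linear_combination (-(-1) ^ k * qInt ((k : ℤ) + 1)) * h1
  rw [e1, e2, sub_neg_eq_add, ← Finset.sum_add_distrib]
  unfold qAdDiv
  rw [Finset.smul_sum]
  refine Finset.sum_congr rfl fun k hk => ?_
  rw [← add_smul, smul_smul]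
  congr 1
  have h1 := qInt_mul_zpow ((t : ℤ) + 1) k
  have h2 : v ^ ((k : ℤ) * (((t + 1 : ℕ) : ℤ) - N)) = v ^ ((k : ℤ) * (t - N)) * v ^ (k : ℤ) := by
    rw [← zpow_add₀ hv]
    congr 1
    push_cast
    ring
  rw [h2]
  linear_combination ((-1) ^ k * v ^ ((k : ℤ) * (t - N))) * h1

theorem qAd_eq (N : ℕ) (x y : R) (t : ℕ) : qAd N x y t = qFact t • qAdDiv N x y t := by
  induction t with
  | zero => simp [qAd, qAdDiv, qFact, divPow]
  | succ t ih =>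
    rw [qFact_succ, mul_smul, qInt_smul_qAdDiv_succ, qAd, ih, mul_smul_comm, smul_mul_assoc,
      smul_sub, smul_comm (v ^ _)]

/-- In each term of the expansion, one of the two powers of `x` has exponent at least `M`. -/
theorem qAd_eq_zero {N : ℕ} {x y : R} {M : ℕ} (hx : x ^ M = 0) {t : ℕ} (ht : 2 * M ≤ t) :
    qAd N x y t = 0 := by
  have hd : ∀ k, M ≤ k → divPow x k = 0 := by
    intro k hk
    unfold divPow
    rw [pow_eq_zero_of_le hk hx, smul_zero]
  rw [qAd_eq]
  unfold qAdDiv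
  rw [Finset.sum_eq_zero, smul_zero]
  intro k _
  by_cases h : M ≤ k
  · rw [hd k h, mul_zero, smul_zero]
  · rw [hd (t - k) (by omega), zero_mul, zero_mul, smul_zero]

/-- At step `N` all powers of `v` in the expansion are trivial, leaving the Serre expression up to a
sign and the order of summation. -/
theorem qAdDiv_self (N : ℕ) (x y : R) : qAdDiv N x y N = (-1) ^ N * serre N x y := by
  unfold qAdDiv serre
  rw [Finset.mul_sum, ← Finset.sum_range_reflect]
  refine Finset.sum_congr rfl fun k hk => ?_
  have hk' : k ≤ N := by rw [Finset.mem_range] at hk; omega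
  rw [show N + 1 - 1 - k = N - k by omega, show N - (N - k) = k by omega, sub_self, mul_zero,
    zpow_zero, mul_one, ← mul_assoc, ← pow_add]
  have h1 : (-1 : R) ^ (N + k) = (-1) ^ (N - k) := by
    rw [show N + k = N - k + 2 * k by omega, pow_add, pow_mul]
    simp
  rw [h1]
  have h2 : ((-1 : BaseK) ^ (N - k)) • (1 : R) = (-1) ^ (N - k) := by
    rw [← Algebra.algebraMap_eq_smul_one]; simp
  rw [← h2, smul_mul_assoc, one_mul]

/-- The quantum Serre relation holds for an element `y` that is a lowest weight vector of weight
`1 - N` for the adjoint action of a nilpotent representation of `U_q(sl_2)`. -/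
theorem serre_eq_zero {N M : ℕ} {x y z h h' : R} (hh : h' * h = 1)
    (hx : h * x = v ^ (2 : ℤ) • (x * h)) (hx' : h' * x = v ^ (-2 : ℤ) • (x * h'))
    (hy : h * y = v ^ (1 - (N : ℤ)) • (y * h)) (hy' : h' * y = v ^ (-(1 - (N : ℤ))) • (y * h'))
    (hxz : x * z - z * x = (v - v⁻¹)⁻¹ • (h - h')) (hyz : z * y = y * z) (hM : x ^ M = 0) :
    serre N x y = 0 := by
  have hv := v_ne_zero
  have weight : ∀ t : ℕ,
      h * qAd N x y t = v ^ (1 - (N : ℤ) + 2 * t) • (qAd N x y t * h) ∧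
      h' * qAd N x y t = v ^ (-(1 - (N : ℤ) + 2 * t)) • (qAd N x y t * h') := by
    intro t
    induction t with
    | zero =>
      rw [Nat.cast_zero, mul_zero, add_zero]
      exact ⟨hy, hy'⟩
    | succ t ih =>
      obtain ⟨i1, i2⟩ := ih
      rw [qAd]
      generalize qAd N x y t = u at *
      generalize v ^ (1 - (N : ℤ) + 2 * t) = s
      have e1 : v ^ (1 - (N : ℤ) + 2 * (t + 1 : ℕ)) = v ^ (2 : ℤ) * v ^ (1 - (N : ℤ) + 2 * t) := by
        rw [← zpow_add₀ hv]; congr 1; push_cast; ring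
      have e2 : v ^ (-(1 - (N : ℤ) + 2 * (t + 1 : ℕ))) =
          v ^ (-2 : ℤ) * v ^ (-(1 - (N : ℤ) + 2 * t)) := by
        rw [← zpow_add₀ hv]; congr 1; push_cast; ring
      have aux : ∀ (g : R) (α β : BaseK), g * x = α • (x * g) → g * u = β • (u * g) →
          g * (x * u - s • (u * x)) = (α * β) • ((x * u - s • (u * x)) * g) := by
        intro g α β h1 h2
        have h3 : g * (x * u) = (α * β) • (x * u * g) := by
          rw [← mul_assoc, h1, smul_mul_assoc, mul_assoc, h2, mul_smul_comm, smul_smul, mul_assoc]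
        have h4 : g * (u * x) = (α * β) • (u * x * g) := by
          rw [← mul_assoc, h2, smul_mul_assoc, mul_assoc, h1, mul_smul_comm, smul_smul, mul_assoc,
            mul_comm]
        rw [mul_sub, mul_smul_comm, h3, h4, sub_mul, smul_sub, smul_mul_assoc, smul_comm s]
      rw [e1, e2]
      exact ⟨aux h _ _ hx i1, aux h' _ _ hx' i2⟩
  have step : ∀ t : ℕ, z * qAd N x y (t + 1) - qAd N x y (t + 1) * z =
      x * (z * qAd N x y t - qAd N x y t * z) -
        v ^ (1 - (N : ℤ) + 2 * t) • ((z * qAd N x y t - qAd N x y t * z) * x) -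
        qInt (1 - (N : ℤ) + 2 * t) • (qAd N x y t * h') := by
    intro t
    obtain ⟨i1, i2⟩ := weight t
    rw [zpow_neg] at i2
    rw [qAd, qInt, zpow_neg]
    exact commutator_step hxz i1 i2
  -- The usual `sl_2` string computation: `z` annihilates the bottom `y`, and lowers each higher
  -- vector by a product of two quantum integers.
  have comm : ∀ t : ℕ, z * qAd N x y (t + 1) - qAd N x y (t + 1) * z =
      -(qInt ((t : ℤ) + 1) * qInt ((t : ℤ) + 1 - N)) • (qAd N x y t * h') := by
    intro t
    induction t with
    | zero =>
      rw [step]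
      have h1 := qInt_mul_qInt_succ 0 N
      rw [qInt_zero, zero_mul, zero_add, zero_add] at h1
      simp only [qAd, hyz, sub_self, mul_zero, zero_mul, smul_zero, Nat.cast_zero, zero_add,
        add_zero, zero_sub, h1, neg_smul]
    | succ t ih =>
      rw [step, ih]
      have h1 := qInt_mul_qInt_succ ((t : ℤ) + 1) N
      have h2 : qAd N x y (t + 1) =
        x * qAd N x y t - v ^ (1 - (N : ℤ) + 2 * t) • (qAd N x y t * x) := rfl
      have h3 : v ^ (1 - (N : ℤ) + 2 * (t + 1 : ℕ)) * v ^ (-2 : ℤ) =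
          v ^ (1 - (N : ℤ) + 2 * t) := by
        rw [← zpow_add₀ hv]; congr 1; push_cast; ring
      have h4 : qAd N x y t * h' * x = v ^ (-2 : ℤ) • (qAd N x y t * x * h') := by
        rw [mul_assoc, hx', mul_smul_comm, mul_assoc]
      have h5 : qAd N x y (t + 1) * h' = x * (qAd N x y t * h') -
          v ^ (1 - (N : ℤ) + 2 * t) • (qAd N x y t * x * h') := by
        rw [h2, sub_mul, smul_mul_assoc, mul_assoc]
      push_cast at h1 h3 ⊢
      rw [h1, smul_mul_assoc, mul_smul_comm, h4, neg_add, add_smul, neg_smul (qInt _),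
        ← sub_eq_add_neg]
      congr 1
      rw [h5, smul_sub, smul_smul, smul_smul, smul_smul, ← h3]
      congr 2
      ring
  -- For `t ≥ N` both `[t + 1]` and `[t + 1 - N]` are nonzero and `h'` can be cancelled, so
  -- vanishing at `t + 1` gives vanishing at `t`.
  have descend : ∀ j : ℕ, qAd N x y (N + j) = 0 → qAd N x y N = 0 := by
    intro j
    induction j with
    | zero => exact id
    | succ j ih =>
      intro h0
      apply ih
      have h1 := comm (N + j)
      rw [show N + (j + 1) = N + j + 1 by ring] at h0
      rw [h0, mul_zero, zero_mul, sub_zero] at h1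
      have h2 : -(qInt (((N + j : ℕ) : ℤ) + 1) * qInt (((N + j : ℕ) : ℤ) + 1 - N)) ≠ 0 :=
        neg_ne_zero.2 (mul_ne_zero (qInt_ne_zero (by omega)) (qInt_ne_zero (by push_cast; omega)))
      have h3 := (smul_eq_zero_iff_right h2).1 h1.symm
      have h4 : qAd N x y (N + j) * h' * h = 0 := by rw [h3, zero_mul]
      rwa [mul_assoc, hh, mul_one] at h4
  have h0 := descend (2 * M) (qAd_eq_zero hM (by omega))
  rw [qAd_eq, smul_eq_zero_iff_right (qFact_ne_zero N), qAdDiv_self] at h0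
  have h1 : ((-1 : R) ^ N) * ((-1) ^ N * serre N x y) = 0 := by rw [h0, mul_zero]
  rwa [← mul_assoc, ← pow_add, ← two_mul, pow_mul, neg_one_sq, one_pow, one_mul] at h1

end serre

/-! ### Weights that occur -/

section weights
variable {D n : ℕ} [NeZero D] [NeZero n]

theorem sharp_nonneg (p : PerFun D n) (i : ZMod n) : 0 ≤ sharp p i := Int.natCast_nonneg _

/-- The points with values in `[0, n)` represent each class modulo `D` exactly once. -/
theorem sum_sharp (p : PerFun D n) : ∑ i, sharp p i = D := by
  classical
  have hn := natCast_pos_of_neZero n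
  have hdisj : ∀ x ∈ (Finset.univ : Finset (ZMod n)), ∀ y ∈ (Finset.univ : Finset (ZMod n)),
      x ≠ y → Disjoint (fiber p (x.val : ℤ)) (fiber p (y.val : ℤ)) := by
    intro x _ y _ hxy
    rw [Finset.disjoint_left]
    intro k hk hk'
    rw [mem_fiber] at hk hk'
    exact hxy (ZMod.val_injective n (by exact_mod_cast hk.symm.trans hk'))
  have h1 : (Finset.univ.biUnion fun x : ZMod n => fiber p (x.val : ℤ)).card =
      (Finset.univ : Finset (ZMod D)).card := by
    refine Finset.card_bij (fun k _ => (k : ZMod D)) (fun _ _ => Finset.mem_univ _) ?_ ?_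
    · intro a ha b hb hab
      simp only [Finset.mem_biUnion, mem_fiber, Finset.mem_univ, true_and] at ha hb
      obtain ⟨x, hx⟩ := ha
      obtain ⟨y, hy⟩ := hb
      have hx' : (x.val : ℤ) < n := by exact_mod_cast ZMod.val_lt x
      have hy' : (y.val : ℤ) < n := by exact_mod_cast ZMod.val_lt y
      obtain ⟨t, rfl⟩ := intCast_eq_iff.1 hab
      rw [p.add_mul, hy] at hx
      have ht : t = 0 := by
        have := Int.natCast_nonneg x.val
        have := Int.natCast_nonneg y.val
        rcases lt_trichotomy t 0 with h | h | h
        · nlinarith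
        · exact h
        · nlinarith
      rw [ht]; simp
    · intro y _
      obtain ⟨k, rfl⟩ := exists_intCast_eq y
      have e := p.add_mul k (-(p.1 k / n))
      have e1 := Int.emod_add_mul_ediv (p.1 k) n
      refine ⟨k + D * (-(p.1 k / n)), ?_, by simp⟩
      simp only [Finset.mem_biUnion, mem_fiber, Finset.mem_univ, true_and]
      refine ⟨(p.1 k : ZMod n), ?_⟩
      rw [e, ZMod.val_intCast]
      linarith
  rw [Finset.card_biUnion hdisj, Finset.card_univ, ZMod.card] at h1
  unfold sharp
  exact_mod_cast h1

theorem sharp_le (p : PerFun D n) (i : ZMod n) : sharp p i ≤ D := by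
  rw [← sum_sharp p]
  exact Finset.single_le_sum (fun j _ => sharp_nonneg p j) (Finset.mem_univ i)

/-- Swapping at descents lowers `x_p` and keeps the weight, until the function is monotone and only
a translation remains. -/
theorem exists_dom_sharp_eq (p : PerFun D n) : ∃ m : Dom D n, sharp m.1 = sharp p := by
  induction hx : xdim p using Nat.strong_induction_on generalizing p with
  | _ N ih =>
  by_cases hp : Monotone p.1
  · obtain ⟨m, t, rfl⟩ := exists_dom_of_monotone p hp
    exact ⟨m, (sharp_comp _ _).symm⟩
  · obtain ⟨j, hj⟩ : ∃ j, p.1 (j + 1) < p.1 j := by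
      by_contra hc
      push Not at hc
      exact hp (monotone_int_of_le_succ hc)
    obtain ⟨s, hs⟩ := exists_isSwap (two_le_of_descent p hj) j
    have hlt : (p.comp s).1 j < (p.comp s).1 (j + 1) := by
      rw [PerFun.comp_apply, PerFun.comp_apply, hs.apply_left j (by simp),
        hs.apply_right (j + 1) (by simp)]
      simpa using hj
    have hpp : (p.comp s).comp s = p := by
      apply PerFun.ext
      intro l
      simp only [PerFun.comp_apply, hs.apply_apply]
    have hxq := xdim_comp_swap (p.comp s) hs hlt
    rw [hpp] at hxq
    obtain ⟨m, hm⟩ := ih _ (by omega) (p.comp s) rfl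
    exact ⟨m, hm.trans (sharp_comp _ _)⟩

/-- The `D` classes of points are distributed among the `n` values by any bijection with the
disjoint union of sets of sizes `μ_x`. For uniqueness this shows that the prescribed values reach
every nonnegative weight of sum `D`. -/
theorem exists_perFun_sharp_eq (μ : ZMod n → ℤ) (h0 : ∀ i, 0 ≤ μ i) (hs : ∑ i, μ i = D) :
    ∃ p : PerFun D n, sharp p = μ := by
  have hD := natCast_pos_of_neZero D
  have hn := natCast_pos_of_neZero n
  have hcard : Fintype.card (ZMod D) = Fintype.card (Σ x : ZMod n, Fin (μ x).toNat) := by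
    rw [ZMod.card, Fintype.card_sigma]
    simp only [Fintype.card_fin]
    have : ((∑ x : ZMod n, (μ x).toNat : ℕ) : ℤ) = D := by
      rw [Nat.cast_sum, ← hs]
      exact Finset.sum_congr rfl fun x _ => Int.toNat_of_nonneg (h0 x)
    exact_mod_cast this.symm
  obtain ⟨e⟩ := Fintype.card_eq.1 hcard
  let p : PerFun D n := ⟨fun k => ((e (k : ZMod D)).1.val : ℤ) + n * (k / D), fun k => by
    have h1 : ((k + D : ℤ) : ZMod D) = (k : ZMod D) := by simp
    have h2 : (k + D) / (D : ℤ) = k / D + 1 := Int.add_ediv_of_dvd_right (dvd_refl _) |>.trans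
      (by rw [Int.ediv_self hD.ne'])
    simp only [h1, h2]
    ring⟩
  have hp : ∀ k, p.1 k = ((e (k : ZMod D)).1.val : ℤ) + n * (k / D) := fun _ => rfl
  refine ⟨p, ?_⟩
  funext x
  rw [← Int.toNat_of_nonneg (h0 x)]
  unfold sharp
  congr 1
  rw [← Finset.card_fin (μ x).toNat]
  symm
  have hval : ∀ y : ZMod D, ((y.val : ℤ) : ZMod D) = y := fun y => by simp
  refine Finset.card_bij (fun a _ => ((e.symm ⟨x, a⟩).val : ℤ)) ?_ ?_ ?_
  · intro a _
    rw [mem_fiber, hp, hval, Equiv.apply_symm_apply, Int.ediv_eq_zero_of_lt (Int.natCast_nonneg _)]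
    · simp
    · exact_mod_cast ZMod.val_lt _
  · intro a _ b _ hab
    have := e.symm.injective (ZMod.val_injective D (by exact_mod_cast hab))
    simpa using this
  · intro k hk
    rw [mem_fiber, hp] at hk
    have hlt : ((e (k : ZMod D)).1.val : ℤ) < n := by exact_mod_cast ZMod.val_lt _
    have hx' : (x.val : ℤ) < n := by exact_mod_cast ZMod.val_lt x
    have hk0 : k / (D : ℤ) = 0 := by
      have := Int.natCast_nonneg x.val
      have := Int.natCast_nonneg (e (k : ZMod D)).1.val
      rcases lt_trichotomy (k / (D : ℤ)) 0 with h | h | h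
      · nlinarith
      · exact h
      · nlinarith
    rw [hk0, mul_zero, add_zero] at hk
    have hx : (e (k : ZMod D)).1 = x := ZMod.val_injective n (by exact_mod_cast hk)
    subst hx
    refine ⟨(e (k : ZMod D)).2, Finset.mem_univ _, ?_⟩
    rw [Sigma.eta, Equiv.symm_apply_apply, ZMod.val_intCast]
    have := Int.emod_add_mul_ediv k D
    rw [hk0] at this
    linarith

theorem exists_dom_of_weight (μ : ZMod n → ℤ) (h0 : ∀ i, 0 ≤ μ i) (hs : ∑ i, μ i = D) :
    ∃ m : Dom D n, sharp m.1 = μ := by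
  obtain ⟨p, rfl⟩ := exists_perFun_sharp_eq μ h0 hs
  exact exists_dom_sharp_eq p

/-! The Cartan part and nilpotency. -/

/-- The operator `k_i^s`, `v ^ (s (μ_i - μ_{i+1}))` on the weight `μ`. -/
noncomputable def kOp (s : ℤ) (i : ZMod n) : Schur D n :=
  weightOp fun μ => LaurentPolynomial.T (s * (μ i - μ (i + 1)))

theorem kOp_mul_neg (s : ℤ) (i : ZMod n) : (kOp s i : Schur D n) * kOp (-s) i = 1 := by
  unfold kOp
  rw [weightOp_mul, ← weightOp_one]
  apply weightOp_congr
  intro p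
  rw [← LaurentPolynomial.T_add, neg_mul, add_neg_cancel, LaurentPolynomial.T_zero]

theorem omega_sub_omega (i j : ZMod n) :
    (omega j : ZMod n → ℤ) i - omega (j + 1) i - omega j (i + 1) + omega (j + 1) (i + 1) =
      cartan i j := by
  unfold cartan omega
  have e1 : i + 1 = j + 1 ↔ i = j := add_left_inj 1
  have e2 : i + 1 = j ↔ i = j - 1 := eq_sub_iff_add_eq.symm
  simp only [Pi.single_apply, e1, e2]
  split_ifs <;> norm_num

theorem kOp_mul_eOp (s : ℤ) (i j : ZMod n) : (kOp s i : Schur D n) * eOp j =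
    (LaurentPolynomial.T (s * cartan i j) : BaseA) • (eOp j * kOp s i) := by
  unfold kOp
  rw [weightOp_mul_eOp, ← mul_smul_comm, weightOp_smul]
  congr 1
  apply weightOp_congr
  intro p
  rw [← LaurentPolynomial.T_add, ← omega_sub_omega i j]
  congr 1
  simp only [Pi.add_apply, Pi.sub_apply]
  ring

theorem kOp_mul_fOp (s : ℤ) (i j : ZMod n) : (kOp s i : Schur D n) * fOp j =
    (LaurentPolynomial.T (-s * cartan i j) : BaseA) • (fOp j * kOp s i) := by
  unfold kOp
  rw [weightOp_mul_fOp, ← mul_smul_comm, weightOp_smul]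
  congr 1
  apply weightOp_congr
  intro p
  rw [← LaurentPolynomial.T_add, ← omega_sub_omega i j]
  congr 1
  simp only [Pi.add_apply, Pi.sub_apply]
  ring

theorem weightOp_mul_pow {S : Schur D n} {ν : ZMod n → ℤ}
    (h : ∀ c, weightOp c * S = S * weightOp fun μ => c (μ + ν)) (c : (ZMod n → ℤ) → BaseA)
    (t : ℕ) : weightOp c * S ^ t = S ^ t * weightOp fun μ => c (μ + t • ν) := by
  induction t generalizing c with
  | zero => simp
  | succ t ih =>
    rw [pow_succ, ← mul_assoc, ih, mul_assoc, h, ← mul_assoc]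
    congr 2
    funext μ
    rw [succ_nsmul, add_assoc, add_comm ν]

/-- Each application of `S` lowers the `i`-th coordinate of the weight by one, while that coordinate
always lies between `0` and `D`. -/
theorem pow_eq_zero_of_weight {S : Schur D n} {ν : ZMod n → ℤ}
    (h : ∀ c, weightOp c * S = S * weightOp fun μ => c (μ + ν)) {i : ZMod n} (hi : ν i = -1) :
    S ^ (D + 1) = 0 := by
  -- The indicator of a negative coordinate acts as zero on the left of `S ^ (D + 1)` and, after
  -- transport to the right, as the identity.
  have h1 := weightOp_mul_pow h (fun μ => if μ i < 0 then 1 else 0) (D + 1)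
  have h2 : (weightOp (fun μ => if μ i < 0 then 1 else 0) : Schur D n) =
      (0 : BaseA) • weightOp fun _ => 1 := by
    rw [weightOp_smul]
    apply weightOp_congr
    intro p
    rw [if_neg (not_lt.2 (sharp_nonneg p i)), zero_mul]
  have h3 : (weightOp (fun μ => if (μ + (D + 1) • ν) i < 0 then 1 else 0) : Schur D n) = 1 := by
    rw [← weightOp_one]
    apply weightOp_congr
    intro p
    rw [if_pos]
    have := sharp_le p i
    rw [Pi.add_apply, Pi.smul_apply, hi, nsmul_eq_mul]
    push_cast
    linarith
  rw [h2, zero_smul, zero_mul, h3, mul_one] at h1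
  exact h1.symm

theorem eOp_pow_eq_zero (hn : 2 ≤ n) (i : ZMod n) : (eOp i : Schur D n) ^ (D + 1) = 0 := by
  refine pow_eq_zero_of_weight (ν := omega i - omega (i + 1)) (i := i + 1) (fun c => ?_) ?_
  · rw [weightOp_mul_eOp]
    congr 2
    funext μ
    congr 1
    abel
  · simp [omega, intCast_add_one_ne hn i]

theorem fOp_pow_eq_zero (hn : 2 ≤ n) (i : ZMod n) : (fOp i : Schur D n) ^ (D + 1) = 0 := by
  refine pow_eq_zero_of_weight (ν := omega (i + 1) - omega i) (i := i) (fun c => ?_) ?_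
  · rw [weightOp_mul_fOp]
    congr 2
    funext μ
    congr 1
    abel
  · simp [omega, (intCast_add_one_ne hn i).symm]

theorem cartan_self (hn : 2 ≤ n) (i : ZMod n) : cartan i i = 2 := by
  have h1 := intCast_add_one_ne hn i
  have h2 : i ≠ i - 1 := fun h => h1 (eq_sub_iff_add_eq.1 h)
  simp [cartan, h1.symm, h2]

theorem toNat_cartan {i j : ZMod n} (h : i ≠ j) :
    (((1 - cartan i j).toNat : ℕ) : ℤ) = 1 - cartan i j := by
  apply Int.toNat_of_nonneg
  unfold cartan
  rw [if_neg h]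
  split_ifs <;> norm_num

theorem weightProj_eq_zero {μ : ZMod n → ℤ} (h : ∀ p : PerFun D n, sharp p ≠ μ) :
    (weightProj μ : Schur D n) = 0 := by
  have : (weightProj μ : Schur D n) = (0 : BaseA) • weightOp fun _ => 1 := by
    unfold weightProj
    rw [weightOp_smul]
    apply weightOp_congr
    intro p
    rw [if_neg (h p), zero_mul]
  rw [this, zero_smul]

theorem weightProj_mul_self (μ : ZMod n → ℤ) :
    (weightProj μ : Schur D n) * weightProj μ = weightProj μ := by
  unfold weightProj
  rw [weightOp_mul]
  congr 1
  funext ν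
  split_ifs <;> simp

theorem weightProj_mul_of_ne {μ ν : ZMod n → ℤ} (h : μ ≠ ν) :
    (weightProj μ : Schur D n) * weightProj ν = 0 := by
  have : (weightProj μ : Schur D n) * weightProj ν = (0 : BaseA) • weightOp fun _ => 1 := by
    unfold weightProj
    rw [weightOp_smul, weightOp_mul]
    apply weightOp_congr
    intro p
    split_ifs with h1 h2
    · exact absurd (h1.symm.trans h2) h
    all_goals simp
  rw [this, zero_smul]

theorem weightProj_mul_eOp (μ : ZMod n → ℤ) (i : ZMod n) :
    (weightProj (μ + omega i) : Schur D n) * eOp i = eOp i * weightProj (μ + omega (i + 1)) := by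
  unfold weightProj
  rw [weightOp_mul_eOp]
  congr 2
  funext ν
  have : ν - omega (i + 1) + omega i = μ + omega i ↔ ν = μ + omega (i + 1) := by
    rw [add_left_inj, sub_eq_iff_eq_add]
  simp only [this]

theorem weightProj_mul_fOp (μ : ZMod n → ℤ) (i : ZMod n) :
    (weightProj (μ + omega (i + 1)) : Schur D n) * fOp i = fOp i * weightProj (μ + omega i) := by
  unfold weightProj
  rw [weightOp_mul_fOp]
  congr 2
  funext ν
  have : ν - omega i + omega (i + 1) = μ + omega (i + 1) ↔ ν = μ + omega i := by
    rw [add_left_inj, sub_eq_iff_eq_add]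
  simp only [this]

end weights

/-! ### Construction of the homomorphism -/

section phi
variable {D n : ℕ} [NeZero D] [NeZero n]

variable {R : Type*} [Ring R] [Algebra BaseK R]

/-- A ring homomorphism from the Schur algebra that sends the scalar `T m` to `v ^ m`. -/
def IsScalarExt (φ : Schur D n →+* R) : Prop :=
  ∀ (m : ℤ) (S : Schur D n), φ ((LaurentPolynomial.T m : BaseA) • S) = v ^ m • φ S

theorem IsScalarExt.commutator {φ : Schur D n →+* R} (hφ : IsScalarExt φ) (hn : 2 ≤ n)
    (i : ZMod n) : φ (eOp i) * φ (fOp i) - φ (fOp i) * φ (eOp i) =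
      (v - v⁻¹)⁻¹ • (φ (kOp 1 i) - φ (kOp (-1) i)) := by
  have hsub (a b : BaseA) (S : Schur D n) : φ ((a - b) • S) = φ (a • S) - φ (b • S) :=
    (congrArg φ (sub_smul a b S)).trans (map_sub φ _ _)
  have hsub' (S S' : Schur D n) : φ (S - S') = φ S - φ S' := map_sub φ S S'
  have h := congrArg φ (eOp_fOp_commutator (D := D) hn i)
  rw [hsub, hφ, hφ, ← sub_smul, hsub', hsub', map_mul, map_mul, zpow_one,
    zpow_neg_one] at h
  rw [eq_inv_smul_iff₀ v_sub_inv_ne_zero, h]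
  unfold kOp
  simp only [one_mul, neg_mul]

theorem kOp_neg_mul (s : ℤ) (i : ZMod n) : (kOp (-s) i : Schur D n) * kOp s i = 1 := by
  have h := kOp_mul_neg (D := D) (-s) i
  rwa [neg_neg] at h

/-- The `sl_2` is that of `e_i`, `f_i` and the weight operators `k_i^{±1}`; for it `e_j` has weight
`a_{ij} = 1 - N` and commutes with `f_i`. -/
theorem IsScalarExt.serre_eOp {φ : Schur D n →+* R} (hφ : IsScalarExt φ) (hn : 2 ≤ n)
    {i j : ZMod n} (h : i ≠ j) : serre (1 - cartan i j).toNat (φ (eOp i)) (φ (eOp j)) = 0 := by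
  have hN := toNat_cartan h
  have hcomm : ∀ (s c : ℤ) (k : ZMod n), s * cartan i k = c →
      φ (kOp s i) * φ (eOp k) = v ^ c • (φ (eOp k) * φ (kOp s i)) := by
    rintro s _ k rfl
    rw [← map_mul, ← map_mul, kOp_mul_eOp, hφ]
  refine serre_eq_zero (M := D + 1) (z := φ (fOp i)) (h := φ (kOp 1 i))
    (h' := φ (kOp (-1) i)) ?_ (hcomm _ _ _ ?_) (hcomm _ _ _ ?_) (hcomm _ _ _ ?_)
    (hcomm _ _ _ ?_) (hφ.commutator hn i) ?_ ?_
  · rw [← map_mul, kOp_neg_mul, map_one]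
  · rw [cartan_self hn, one_mul]
  · rw [cartan_self hn]; norm_num
  · rw [hN]; ring
  · rw [hN]; ring
  · rw [← map_mul, ← map_mul, eOp_mul_fOp_of_ne hn h.symm]
  · rw [← map_pow, eOp_pow_eq_zero hn, map_zero]

/-- The same argument with the roles of `e_i` and `f_i` exchanged, which also exchanges `k_i` and
its inverse. -/
theorem IsScalarExt.serre_fOp {φ : Schur D n →+* R} (hφ : IsScalarExt φ) (hn : 2 ≤ n)
    {i j : ZMod n} (h : i ≠ j) : serre (1 - cartan i j).toNat (φ (fOp i)) (φ (fOp j)) = 0 := by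
  have hN := toNat_cartan h
  have hcomm : ∀ (s c : ℤ) (k : ZMod n), -s * cartan i k = c →
      φ (kOp s i) * φ (fOp k) = v ^ c • (φ (fOp k) * φ (kOp s i)) := by
    rintro s _ k rfl
    rw [← map_mul, ← map_mul, kOp_mul_fOp, hφ]
  refine serre_eq_zero (M := D + 1) (z := φ (eOp i)) (h := φ (kOp (-1) i))
    (h' := φ (kOp 1 i)) ?_ (hcomm _ _ _ ?_) (hcomm _ _ _ ?_) (hcomm _ _ _ ?_)
    (hcomm _ _ _ ?_) ?_ ?_ ?_
  · rw [← map_mul, kOp_mul_neg, map_one]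
  · rw [cartan_self hn]; norm_num
  · rw [cartan_self hn]; norm_num
  · rw [hN]; ring
  · rw [hN]; ring
  · rw [← neg_sub, hφ.commutator hn, ← smul_neg, neg_sub]
  · rw [← map_mul, ← map_mul, eOp_mul_fOp_of_ne hn h]
  · rw [← map_pow, fOp_pow_eq_zero hn, map_zero]

/-- The images of the generators. -/
noncomputable def genImage (φ : Schur D n →+* R) : Gen n → R
  | Gen.e i => φ (eOp i)
  | Gen.f i => φ (fOp i)
  | Gen.a μ => φ (weightProj μ)

/-- The homomorphism from the free algebra. -/
noncomputable def freeHom (φ : Schur D n →+* R) : FreeU n →ₐ[BaseK] R :=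
  FreeAlgebra.lift BaseK (genImage φ)

theorem freeHom_e (φ : Schur D n →+* R) (i : ZMod n) : freeHom φ (eF i) = φ (eOp i) :=
  FreeAlgebra.lift_ι_apply _ _

theorem freeHom_f (φ : Schur D n →+* R) (i : ZMod n) : freeHom φ (fF i) = φ (fOp i) :=
  FreeAlgebra.lift_ι_apply _ _

theorem freeHom_a (φ : Schur D n →+* R) (μ : ZMod n → ℤ) :
    freeHom φ (aF μ) = φ (weightProj μ) :=
  FreeAlgebra.lift_ι_apply _ _

theorem map_serre {R' : Type*} [Ring R'] [Algebra BaseK R'] (ψ : R →ₐ[BaseK] R') (N : ℕ)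
    (x y : R) : ψ (serre N x y) = serre N (ψ x) (ψ y) := by
  unfold serre divPow
  simp only [map_sum, map_mul, map_pow, map_neg, map_one, map_smul]

theorem kOp_mul_weightProj (s : ℤ) (i : ZMod n) (μ : ZMod n → ℤ) :
    (kOp s i : Schur D n) * weightProj μ =
      (LaurentPolynomial.T (s * (μ i - μ (i + 1))) : BaseA) • weightProj μ := by
  unfold kOp weightProj
  rw [weightOp_mul, weightOp_smul]
  congr 1
  funext ν
  split_ifs with h
  · rw [h]
  · simp

theorem freeHom_rel {φ : Schur D n →+* R} (hφ : IsScalarExt φ) (hn : 2 ≤ n) {x y : FreeU n}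
    (h : URel n x y) : freeHom φ x = freeHom φ y := by
  cases h with
  | a_neg μ h =>
    obtain ⟨i, hi⟩ := h
    rw [freeHom_a, weightProj_eq_zero, map_zero, map_zero]
    rintro p rfl
    exact absurd (sharp_nonneg p i) (not_le.2 hi)
  | a_mul_self μ => rw [map_mul, freeHom_a, ← map_mul, weightProj_mul_self]
  | a_mul μ ν h =>
    rw [map_mul, freeHom_a, freeHom_a, ← map_mul, weightProj_mul_of_ne h, map_zero, map_zero]
  | a_e μ i =>
    rw [map_mul, map_mul, freeHom_a, freeHom_a, freeHom_e, ← map_mul, ← map_mul,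
      weightProj_mul_eOp]
  | a_f μ i =>
    rw [map_mul, map_mul, freeHom_a, freeHom_a, freeHom_f, ← map_mul, ← map_mul,
      weightProj_mul_fOp]
  | e_f_self i μ =>
    rw [map_mul, map_sub, map_mul, map_mul, map_smul, freeHom_a, freeHom_e, freeHom_f,
      hφ.commutator hn, smul_mul_assoc, sub_mul, ← map_mul, ← map_mul, kOp_mul_weightProj,
      kOp_mul_weightProj, hφ, hφ, ← sub_smul, smul_smul, one_mul, neg_one_mul, qInt,
      div_eq_inv_mul]
  | e_f i j h μ =>
    rw [map_mul, map_sub, map_mul, map_mul, freeHom_e, freeHom_f, ← map_mul φ,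
      eOp_mul_fOp_of_ne hn h, map_mul φ, sub_self, zero_mul, map_zero]
  | serre_e i j h => rw [map_serre, freeHom_e, freeHom_e, hφ.serre_eOp hn h, map_zero]
  | serre_f i j h => rw [map_serre, freeHom_f, freeHom_f, hφ.serre_fOp hn h, map_zero]

/-- The extension of scalars `S_D → S_D ⊗ K`. -/
noncomputable def schurK : Schur D n →+* BaseK ⊗[BaseA] Schur D n :=
  (Algebra.TensorProduct.includeRight : Schur D n →ₐ[BaseA] BaseK ⊗[BaseA] Schur D n).toRingHom

theorem schurK_apply (S : Schur D n) : schurK S = (1 : BaseK) ⊗ₜ[BaseA] S := rfl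

theorem isScalarExt_schurK :
    IsScalarExt (schurK : Schur D n →+* BaseK ⊗[BaseA] Schur D n) := by
  intro m S
  rw [schurK_apply, schurK_apply, TensorProduct.tmul_smul, ← algebraMap_T]
  exact (algebraMap_smul BaseK _ _).symm

/-- The homomorphism from the unital algebra `UAmb`. -/
noncomputable def ambHom (hn : 2 ≤ n) : UAmb n →ₐ[BaseK] BaseK ⊗[BaseA] Schur D n :=
  RingQuot.liftAlgHom BaseK ⟨freeHom schurK, fun _ _ h => freeHom_rel isScalarExt_schurK hn h⟩

theorem ambHom_toU (hn : 2 ≤ n) (x : FreeU n) :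
    (ambHom hn (toU n x) : BaseK ⊗[BaseA] Schur D n) = freeHom schurK x :=
  RingQuot.liftAlgHom_mkAlgHom_apply BaseK _ _ _

/-- The homomorphism `Φ_D`. -/
noncomputable def phi (hn : 2 ≤ n) : Udot n →ₙₐ[BaseK] BaseK ⊗[BaseA] Schur D n :=
  ((ambHom hn : UAmb n →ₐ[BaseK] BaseK ⊗[BaseA] Schur D n) :
    UAmb n →ₙₐ[BaseK] BaseK ⊗[BaseA] Schur D n).comp
    (NonUnitalSubalgebraClass.subtype (Udot n))

theorem phi_a (hn : 2 ≤ n) (μ : ZMod n → ℤ) :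
    (phi hn (aEl μ) : BaseK ⊗[BaseA] Schur D n) = schurK (weightProj μ) :=
  (ambHom_toU hn _).trans (freeHom_a _ μ)

theorem phi_ea (hn : 2 ≤ n) (i : ZMod n) (μ : ZMod n → ℤ) :
    (phi hn (eaEl i μ) : BaseK ⊗[BaseA] Schur D n) = schurK (eOp i * weightProj μ) :=
  (ambHom_toU hn _).trans (by rw [map_mul, map_mul, freeHom_e, freeHom_a])

theorem phi_fa (hn : 2 ≤ n) (i : ZMod n) (μ : ZMod n → ℤ) :
    (phi hn (faEl i μ) : BaseK ⊗[BaseA] Schur D n) = schurK (fOp i * weightProj μ) :=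
  (ambHom_toU hn _).trans (by rw [map_mul, map_mul, freeHom_f, freeHom_a])

theorem phi_ae (hn : 2 ≤ n) (i : ZMod n) (μ : ZMod n → ℤ) :
    (phi hn (aeEl i μ) : BaseK ⊗[BaseA] Schur D n) = schurK (weightProj μ * eOp i) :=
  (ambHom_toU hn _).trans (by rw [map_mul, map_mul, freeHom_e, freeHom_a])

theorem T_smul_T_neg_smul (m : ℤ) (S : Schur D n) :
    (LaurentPolynomial.T m : BaseA) • (LaurentPolynomial.T (-m) : BaseA) • S = S := by
  rw [smul_smul, ← LaurentPolynomial.T_add, add_neg_cancel, LaurentPolynomial.T_zero, one_smul]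

theorem isPhi_phi (hn : 2 ≤ n) : IsPhi (phi hn : Udot n →ₙₐ[BaseK] BaseK ⊗[BaseA] Schur D n) where
  map_ae l i := by
    refine ⟨_, isSchurT_eOp hn l.1 i, ?_⟩
    rw [phi_ae, ydim_raiseMat, T_smul_T_neg_smul]
    rfl
  map_fa l i := by
    refine ⟨_, isSchurT_fOp l.1 i, ?_⟩
    rw [phi_fa, ydim_raiseMat_transpose hn, T_smul_T_neg_smul]
    rfl
  map_a_zero μ _ hμ := by
    rw [phi_a, weightProj_eq_zero, map_zero]
    rintro p rfl
    exact hμ (sum_sharp p)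
  map_a l := by
    refine ⟨_, isSchurT_weightProj l.1, ?_⟩
    rw [phi_a, ydim_diagMat, LaurentPolynomial.T_zero, one_smul]
    rfl

/-! Uniqueness. -/

theorem IsSchurBracket.unique {s : ℤ → ℤ → ℤ} {E E' : BaseK ⊗[BaseA] Schur D n}
    (h : IsSchurBracket s E) (h' : IsSchurBracket s E') : E = E' := by
  obtain ⟨S, h1, rfl⟩ := h
  obtain ⟨S', h1', rfl⟩ := h'
  have : S = S' := schur_ext fun m => TMod.ext fun l => (h1 m l).trans (h1' m l).symm
  rw [this]

theorem toU_rel {x y : FreeU n} (h : URel n x y) : toU n x = toU n y :=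
  RingQuot.mkAlgHom_rel BaseK h

theorem aEl_eq_zero {μ : ZMod n → ℤ} (h : ∃ i, μ i < 0) : aEl μ = (0 : Udot n) :=
  Subtype.ext ((toU_rel (URel.a_neg μ h)).trans (map_zero _))

/-- The conditions on `Φ_D` leave no `a_μ` undetermined: a negative entry or a wrong sum gives zero,
and every other `μ` is the weight of a dominant function. -/
theorem IsPhi.map_a_cases {Ψ : Udot n →ₙₐ[BaseK] BaseK ⊗[BaseA] Schur D n} (h : IsPhi Ψ)
    (μ : ZMod n → ℤ) : Ψ (aEl μ) = 0 ∨ ∃ l : Dom D n, sharp l.1 = μ := by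
  by_cases h0 : ∀ i, 0 ≤ μ i
  · by_cases hs : ∑ i, μ i = D
    · exact Or.inr (exists_dom_of_weight μ h0 hs)
    · exact Or.inl (h.map_a_zero μ h0 hs)
  · left
    push Not at h0
    rw [aEl_eq_zero h0, map_zero]

theorem eaEl_eq_aeEl (i : ZMod n) (μ : ZMod n → ℤ) :
    eaEl i μ = aeEl i (μ - omega (i + 1) + omega i) := by
  apply Subtype.ext
  change toU n (eF i * aF μ) = toU n (aF (μ - omega (i + 1) + omega i) * eF i)
  rw [toU_rel (URel.a_e (μ - omega (i + 1)) i), sub_add_cancel]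

theorem aEl_mul_aeEl (i : ZMod n) (μ : ZMod n → ℤ) : aEl μ * aeEl i μ = aeEl i μ := by
  apply Subtype.ext
  change toU n (aF μ) * toU n (aF μ * eF i) = toU n (aF μ * eF i)
  rw [map_mul, ← mul_assoc, ← map_mul, toU_rel (URel.a_mul_self μ)]

theorem faEl_mul_aEl (i : ZMod n) (μ : ZMod n → ℤ) : faEl i μ * aEl μ = faEl i μ := by
  apply Subtype.ext
  change toU n (fF i * aF μ) * toU n (aF μ) = toU n (fF i * aF μ)
  rw [map_mul, mul_assoc, ← map_mul, toU_rel (URel.a_mul_self μ)]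

theorem IsPhi.unique {Ψ Φ : Udot n →ₙₐ[BaseK] BaseK ⊗[BaseA] Schur D n} (h : IsPhi Ψ)
    (h' : IsPhi Φ) : Ψ = Φ := by
  have ha : ∀ μ, Ψ (aEl μ) = Φ (aEl μ) := by
    intro μ
    rcases h.map_a_cases μ with h1 | ⟨l, rfl⟩
    · rcases h'.map_a_cases μ with h2 | ⟨l, rfl⟩
      · rw [h1, h2]
      · exact (h.map_a l).unique (h'.map_a l)
    · exact (h.map_a l).unique (h'.map_a l)
  have hae : ∀ i μ, Ψ (aeEl i μ) = Φ (aeEl i μ) := by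
    intro i μ
    rcases h.map_a_cases μ with h1 | ⟨l, rfl⟩
    · rw [← aEl_mul_aeEl, map_mul, map_mul, ← ha, h1, zero_mul, zero_mul]
    · exact (h.map_ae l i).unique (h'.map_ae l i)
  have hfa : ∀ i μ, Ψ (faEl i μ) = Φ (faEl i μ) := by
    intro i μ
    rcases h.map_a_cases μ with h1 | ⟨l, rfl⟩
    · rw [← faEl_mul_aEl, map_mul, map_mul, ← ha, h1, mul_zero, mul_zero]
    · exact (h.map_fa l i).unique (h'.map_fa l i)
  apply NonUnitalAlgHom.ext
  rintro ⟨x, hx⟩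
  refine NonUnitalAlgebra.adjoin_induction (R := BaseK)
    (p := fun x hx => Ψ ⟨x, hx⟩ = Φ ⟨x, hx⟩) ?_ ?_ ?_ ?_ ?_ hx
  · rintro x ((⟨μ, rfl⟩ | ⟨⟨i, μ⟩, rfl⟩) | ⟨⟨i, μ⟩, rfl⟩)
    · exact ha μ
    · have := hae i (μ - omega (i + 1) + omega i)
      rw [← eaEl_eq_aeEl] at this
      exact this
    · exact hfa i μ
  · intro x y hx hy h1 h2
    have e := congrArg₂ (· + ·) h1 h2
    simp only [← map_add] at e
    exact e
  · exact (map_zero Ψ).trans (map_zero Φ).symm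
  · intro x y hx hy h1 h2
    have e := congrArg₂ (· * ·) h1 h2
    simp only [← map_mul] at e
    exact e
  · intro r x hx h1
    have e := congrArg (r • ·) h1
    simp only [← map_smul] at e
    exact e

/-! The action on `T_D ⊗ K`. -/

theorem schurAct_schurK (S : Schur D n) (x : TMod D n) :
    schurAct D n (schurK S) ((1 : BaseK) ⊗ₜ[BaseA] x) = (1 : BaseK) ⊗ₜ[BaseA] S x := by
  change schurAct D n ((1 : BaseK) ⊗ₜ[BaseA] S) _ = _
  unfold schurAct
  refine (LinearMap.congr_fun (Algebra.TensorProduct.lift_tmul _ _ _ _ _) _).trans ?_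
  rw [map_one, one_mul]
  rfl

theorem bracket_eq (p : PerFun D n) : bracket p = (1 : BaseK) ⊗ₜ[BaseA] normVec p := rfl

theorem one_tmul_T_smul (m : ℤ) (x : TMod D n) :
    (1 : BaseK) ⊗ₜ[BaseA] ((LaurentPolynomial.T m : BaseA) • x) =
      v ^ m • ((1 : BaseK) ⊗ₜ[BaseA] x) := by
  rw [TensorProduct.tmul_smul, ← algebraMap_T, algebraMap_smul]

theorem one_tmul_normMove (ε : ℤ) (p : PerFun D n) (a : ℤ) :
    (1 : BaseK) ⊗ₜ[BaseA] normMove ε p a =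
      ∑ k ∈ fiber p a, v ^ moveExp ε p a k • bracket (shift p k (-ε)) := by
  unfold normMove
  rw [TensorProduct.tmul_sum]
  refine Finset.sum_congr rfl fun k _ => ?_
  rw [one_tmul_T_smul, bracket_eq]

theorem weightProj_sharp_normVec (p : PerFun D n) : weightProj (sharp p) (normVec p) = normVec p := by
  unfold weightProj
  rw [weightOp_normVec, if_pos rfl, one_smul]

theorem weightProj_normVec_of_ne {μ : ZMod n → ℤ} {p : PerFun D n} (h : μ ≠ sharp p) :
    weightProj μ (normVec p) = 0 := by
  unfold weightProj
  rw [weightOp_normVec, if_neg h.symm, zero_smul]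

end phi

end AffineSchur

theorem proposition2p4 (D n : ℕ) [NeZero D] [NeZero n] (hn : 2 ≤ n) :
    ∃ Φ : Udot n →ₙₐ[BaseK] (BaseK ⊗[BaseA] Schur D n),
      IsPhi Φ ∧
      (∀ Ψ : Udot n →ₙₐ[BaseK] (BaseK ⊗[BaseA] Schur D n), IsPhi Ψ → Ψ = Φ) ∧
      ∀ (i : ℤ) (p : PerFun D n),
        schurAct D n (Φ (aEl (sharp p))) (bracket p) = bracket p ∧
        (∀ μ : ZMod n → ℤ, μ ≠ sharp p →
          schurAct D n (Φ (aEl μ)) (bracket p) = 0) ∧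
        schurAct D n (Φ (eaEl (i : ZMod n) (sharp p))) (bracket p) =
          ∑ k ∈ fiber p (i + 1),
            v ^ ((((fiber p (i + 1)).filter (fun l => k < l)).card : ℤ) -
                  (((fiber p i).filter (fun l => k < l)).card : ℤ)) •
              bracket (shift p k (-1)) ∧
        schurAct D n (Φ (faEl (i : ZMod n) (sharp p))) (bracket p) =
          ∑ k ∈ fiber p i,
            v ^ ((((fiber p i).filter (fun l => l < k)).card : ℤ) -
                  (((fiber p (i + 1)).filter (fun l => l < k)).card : ℤ)) •
              bracket (shift p k 1) := by
  refine ⟨phi hn, isPhi_phi hn, fun Ψ hΨ => hΨ.unique (isPhi_phi hn), fun i p => ⟨?_, ?_, ?_, ?_⟩⟩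
  · rw [phi_a, bracket_eq, schurAct_schurK, weightProj_sharp_normVec]
  · intro μ hμ
    rw [phi_a, bracket_eq, schurAct_schurK, weightProj_normVec_of_ne hμ, TensorProduct.tmul_zero]
  · rw [phi_ea, bracket_eq, schurAct_schurK, Module.End.mul_apply, weightProj_sharp_normVec,
      eOp_normVec hn, one_tmul_normMove]
    refine Finset.sum_congr rfl fun k _ => ?_
    rw [moveExp_one, add_sub_cancel_right]
  · rw [phi_fa, bracket_eq, schurAct_schurK, Module.End.mul_apply, weightProj_sharp_normVec,
      fOp_normVec hn, one_tmul_normMove]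
    refine Finset.sum_congr rfl fun k _ => ?_
    rw [moveExp_neg_one, neg_neg]
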